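/- Let $\mathfrak g$ be a finite-dimensional simply-laced simple complex Lie algebra with Cartan subalgebra $\mathfrak h$ and Chevalley generators $e_i,f_i,\alpha_i^\vee$ ($i=1,\dots,n$). Let $\mathfrak n_+$ be the subalgebra generated by the $e_i$, put $\mathfrak b_+=\mathfrak h\oplus\mathfrak n_+$ and $f=\sum_i f_i$, let $\rho^\vee\in\mathfrak h$ be defined by $\alpha_i(\rho^\vee)=1$ for all $i$, let $\mathfrak g^i=\{x:[\rho^\vee,x]=ix\}$, and let $h^\vee$ be the (dual) Coxeter number, so that $\mathfrak n_+=\bigoplus_{i=1}^{h^\vee-1}\mathfrak g^i$. Fix an $\mathrm{ad}_{\rho^\vee}$-invariant subspace $\mathfrak s\subset\mathfrak b_+$ with $\mathfrak b_+=[f,\mathfrak n_+]\oplus\mathfrak s$, and put $\mathfrak s^d=\mathfrak s\cap\mathfrak g^d$ (this is non-zero only if $d$ is an exponent of $\mathfrak g$; in particular $\mathfrak s^0=0$). Set $V_i=\bigoplus_{d=i}^{h^\vee-1}\mathfrak s^d$. Let $K$ be $\mathbb C(z)$ with $\partial=\frac{d}{dz}$ or $\mathbb C((x))$ with $\partial=\frac{d}{dx}$,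 and write $\mathfrak n_+(K)=K\otimes\mathfrak n_+$, and so on. Elements $y\in\mathfrak n_+(K)$ act on operators $\partial+A$, $A\in\mathfrak g(K)$, by $$\exp(\mathrm{ad}\,y).(\partial+A)=\partial+\sum_{k\ge0}\frac{(\mathrm{ad}_y)^kA}{k!}-\sum_{k\ge0}\frac{(\mathrm{ad}_y)^k(\partial y)}{(k+1)!}.$$ A canonical form of an operator $\partial+f+b$, $b\in\mathfrak b_+(K)$, is an operator $\partial+f+s$ with $s\in\mathfrak s(K)$ obtained from it by such an action. Local maps. For $X^0\in\mathfrak h$ and $X^i\in\mathfrak g^i$ ($1\le i\le h^\vee-1$), the 1-Bessel operator $\partial_x+f+\frac1x\sum_{i=0}^{h^\vee-1}X^i$ over $\mathbb C((x))$ has a canonical form which is an $\mathfrak s$-Bessel operator $$\partial_x+f+\sum_{d}\sum_{l=0}^{d}\frac{s^d_l}{x^{d+1-l}},\qquad s^d_l\in\mathfrak s^d,$$ with uniquely determined coefficients $s^d_l$. Fixing $X^0$ and keeping only the coefficients with $l\ge1$ defines a map $\Phi^{X^0}:\bigoplus_{i=1}^{h^\vee-1}\mathfrak g^i\to\bigoplus_{i=1}^{h^\vee-1}V_i$,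 $(X^i)_i\mapsto (s^d_l)_{1\le l\le d}$, where $(s^d_l)_{d\ge l}\in V_l$. Global map. Let $N\ge0$, let $w_1,\dots,w_N\in\mathbb C\setminus\{0\}$ be distinct, and fix $r,X^0(1),\dots,X^0(N)\in\mathfrak h$. For all $X^i(j)\in\mathfrak g^i$ ($1\le i\le h^\vee-1$, $1\le j\le N$) the operator over $\mathbb C(z)$ $$\mathcal L_1=\partial_z+f+\frac rz+\sum_{j=1}^N\frac1{z-w_j}\sum_{i=0}^{h^\vee-1}\frac{X^i(j)}{z^i}$$ has a canonical form of the shape $$\mathcal L_{\mathfrak s}=\partial_z+f+\sum_d\frac{\bar r^d}{z^{d+1}}+\sum_{j=1}^N\sum_d z^{-d}\sum_{l=0}^d\frac{s^d_l(j)}{(z-w_j)^{d+1-l}},\qquad \bar r^d,\,s^d_l(j)\in\mathfrak s^d,$$ with uniquely determined coefficients. The extended Miura map $$F=F^{r,X^0(1),\dots,X^0(N)}:\bigoplus_{j=1}^N\bigoplus_{i=1}^{h^\vee-1}\mathfrak g^i\longrightarrow\bigoplus_{j=1}^N\bigoplus_{i=1}^{h^\vee-1}V_i$$ sends $(X^i(j))_{i,j}$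 to the coefficients $(s^d_l(j))$ with $1\le l\le d$. Theorem. The maps $\Phi^{X^0}$ ($X^0\in\mathfrak h$) and $F$ are well defined, in the sense that the existence and uniqueness assertions above hold, and $F^{r,X^0(1),\dots,X^0(N)}$ is bijective if and only if $\Phi^{X^0(j)}$ is bijective for every $j=1,\dots,N$. -/

import Mathlib

open scoped TensorProduct Matrix

noncomputable section

namespace Oper

/-- The `ℂ`-linear derivations of a field `K ⊇ ℂ`. -/
abbrev Der (K : Type*) [Field K] [Algebra ℂ K] : Type _ := Derivation ℂ K K

/-- An additive map satisfying the Leibniz rule and killing the constants is a derivation. -/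
def mkDer {K : Type*} [Field K] [Algebra ℂ K] (D : K → K) (hadd : ∀ g k, D (g + k) = D g + D k)
    (hmul : ∀ g k, D (g * k) = g * D k + k * D g) (hC : ∀ c : ℂ, D (algebraMap ℂ K c) = 0) :
    Der K :=
  Derivation.mk'
    { toFun := D
      map_add' := hadd
      map_smul' := fun c g => by
        rw [Algebra.smul_def, hmul, hC, mul_zero, add_zero, RingHom.id_apply, Algebra.smul_def] }
    (fun g k => by simpa using hmul g k)

/-! ### The derivation `d/dz` of the field `ℂ(z)` of meromorphic functions on the Riemann sphere -/

/-- The quotient rule `(p / q)' = (p' q - p q') / q ^ 2`, applied to the reduced fraction. -/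
def ratDerivFun (g : RatFunc ℂ) : RatFunc ℂ :=
  algebraMap (Polynomial ℂ) (RatFunc ℂ)
      (Polynomial.derivative g.num * g.denom - g.num * Polynomial.derivative g.denom) /
    algebraMap (Polynomial ℂ) (RatFunc ℂ) g.denom ^ 2

theorem quotient_rule_aux (a d p q : Polynomial ℂ) (h : a * q = p * d) :
    (Polynomial.derivative a * d - a * Polynomial.derivative d) * q ^ 2 =
      (Polynomial.derivative p * q - p * Polynomial.derivative q) * d ^ 2 := by
  have h' := congrArg Polynomial.derivative h
  simp only [Polynomial.derivative_mul] at h'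
  linear_combination q * d * h' - (q * Polynomial.derivative d + Polynomial.derivative q * d) * h

theorem ratDerivFun_eq (p q : Polynomial ℂ) (hq : q ≠ 0) (g : RatFunc ℂ)
    (h : g = algebraMap (Polynomial ℂ) (RatFunc ℂ) p / algebraMap (Polynomial ℂ) (RatFunc ℂ) q) :
    ratDerivFun g = algebraMap (Polynomial ℂ) (RatFunc ℂ)
          (Polynomial.derivative p * q - p * Polynomial.derivative q) /
        algebraMap (Polynomial ℂ) (RatFunc ℂ) q ^ 2 := by
  have hd : g.denom ≠ 0 := RatFunc.denom_ne_zero g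
  have hq' : algebraMap (Polynomial ℂ) (RatFunc ℂ) q ≠ 0 := RatFunc.algebraMap_ne_zero hq
  have hd' : algebraMap (Polynomial ℂ) (RatFunc ℂ) g.denom ≠ 0 := RatFunc.algebraMap_ne_zero hd
  have hh : g.num * q = p * g.denom := by
    apply RatFunc.algebraMap_injective ℂ
    rw [map_mul, map_mul, ← div_eq_div_iff hd' hq', RatFunc.num_div_denom, h]
  unfold ratDerivFun
  rw [div_eq_div_iff (pow_ne_zero 2 hd') (pow_ne_zero 2 hq'), ← map_pow, ← map_pow, ← map_mul,
    ← map_mul, quotient_rule_aux _ _ _ _ hh]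

theorem ratDerivFun_div (p q : Polynomial ℂ) (hq : q ≠ 0) :
    ratDerivFun (algebraMap (Polynomial ℂ) (RatFunc ℂ) p / algebraMap (Polynomial ℂ) (RatFunc ℂ) q)
      = algebraMap (Polynomial ℂ) (RatFunc ℂ)
          (Polynomial.derivative p * q - p * Polynomial.derivative q) /
        algebraMap (Polynomial ℂ) (RatFunc ℂ) q ^ 2 :=
  ratDerivFun_eq p q hq _ rfl

theorem exists_eq_div (g : RatFunc ℂ) : ∃ p q : Polynomial ℂ, q ≠ 0 ∧
    g = algebraMap (Polynomial ℂ) (RatFunc ℂ) p / algebraMap (Polynomial ℂ) (RatFunc ℂ) q :=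
  ⟨g.num, g.denom, RatFunc.denom_ne_zero g, (RatFunc.num_div_denom g).symm⟩

theorem ratDerivFun_add (g k : RatFunc ℂ) :
    ratDerivFun (g + k) = ratDerivFun g + ratDerivFun k := by
  obtain ⟨p, q, hq, rfl⟩ := exists_eq_div g
  obtain ⟨u, v, hv, rfl⟩ := exists_eq_div k
  have hq' : algebraMap (Polynomial ℂ) (RatFunc ℂ) q ≠ 0 := RatFunc.algebraMap_ne_zero hq
  have hv' : algebraMap (Polynomial ℂ) (RatFunc ℂ) v ≠ 0 := RatFunc.algebraMap_ne_zero hv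
  rw [div_add_div _ _ hq' hv', ← map_mul, ← map_mul, ← map_mul, ← map_add,
    ratDerivFun_div _ _ (mul_ne_zero hq hv), ratDerivFun_div _ _ hq, ratDerivFun_div _ _ hv]
  simp only [map_mul, map_sub, map_add, Polynomial.derivative_mul]
  field_simp
  ring

theorem ratDerivFun_mul (g k : RatFunc ℂ) :
    ratDerivFun (g * k) = g * ratDerivFun k + k * ratDerivFun g := by
  obtain ⟨p, q, hq, rfl⟩ := exists_eq_div g
  obtain ⟨u, v, hv, rfl⟩ := exists_eq_div k
  have hq' : algebraMap (Polynomial ℂ) (RatFunc ℂ) q ≠ 0 := RatFunc.algebraMap_ne_zero hq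
  have hv' : algebraMap (Polynomial ℂ) (RatFunc ℂ) v ≠ 0 := RatFunc.algebraMap_ne_zero hv
  rw [div_mul_div_comm, ← map_mul, ← map_mul,
    ratDerivFun_div _ _ (mul_ne_zero hq hv), ratDerivFun_div _ _ hq, ratDerivFun_div _ _ hv]
  simp only [map_mul, map_sub, map_add, Polynomial.derivative_mul]
  field_simp
  ring

theorem ratDerivFun_C (c : ℂ) : ratDerivFun (algebraMap ℂ (RatFunc ℂ) c) = 0 := by
  have h := ratDerivFun_div (Polynomial.C c) 1 one_ne_zero
  have e : algebraMap ℂ (RatFunc ℂ) c = algebraMap (Polynomial ℂ) (RatFunc ℂ) (Polynomial.C c) /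
      algebraMap (Polynomial ℂ) (RatFunc ℂ) 1 := by
    rw [map_one, div_one, RatFunc.algebraMap_C]; rfl
  rw [e, h]
  simp

/-- The derivation `d/dz` of `ℂ(z)`. -/
def ratDeriv : Der (RatFunc ℂ) := mkDer ratDerivFun ratDerivFun_add ratDerivFun_mul ratDerivFun_C

/-! ### The derivation `d/dx` of the field `ℂ((x))` of formal Laurent series -/

theorem coeff_derivative (g : LaurentSeries ℂ) (m : ℤ) :
    (LaurentSeries.derivative ℂ g).coeff m = ((m + 1 : ℤ) : ℂ) * g.coeff (m + 1) := by
  simp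

theorem coeff_mul_derivative (g k : LaurentSeries ℂ) (m : ℤ) :
    (g * LaurentSeries.derivative ℂ k).coeff m =
      ∑ ij ∈ Finset.antidiagonal g.isPWO_support k.isPWO_support (m + 1),
        (ij.2 : ℂ) * (g.coeff ij.1 * k.coeff ij.2) := by
  have hc : ∀ a, (HahnSeries.single (1 : ℤ) (1 : ℂ) * LaurentSeries.derivative ℂ k).coeff a =
      (a : ℂ) * k.coeff a := by
    intro a
    have := HahnSeries.coeff_single_mul_add (r := (1 : ℂ)) (x := LaurentSeries.derivative ℂ k)
      (a := a - 1) (b := (1 : ℤ))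
    rw [sub_add_cancel] at this
    rw [this, coeff_derivative]
    simp
  have hs : (HahnSeries.single (1 : ℤ) (1 : ℂ) * LaurentSeries.derivative ℂ k).support ⊆
      k.support := by
    intro a ha
    rw [HahnSeries.mem_support, hc] at ha
    exact right_ne_zero_of_mul ha
  have h1 := HahnSeries.coeff_single_mul_add (r := (1 : ℂ))
    (x := g * LaurentSeries.derivative ℂ k) (a := m) (b := (1 : ℤ))
  rw [one_mul, mul_left_comm] at h1
  rw [← h1, HahnSeries.coeff_mul_right' k.isPWO_support hs]
  exact Finset.sum_congr rfl fun ij _ => by rw [hc]; ring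

theorem derivative_mul (g k : LaurentSeries ℂ) :
    LaurentSeries.derivative ℂ (g * k) =
      g * LaurentSeries.derivative ℂ k + k * LaurentSeries.derivative ℂ g := by
  ext m
  rw [HahnSeries.coeff_add, coeff_mul_derivative, coeff_mul_derivative, coeff_derivative,
    HahnSeries.coeff_mul, Finset.mul_sum]
  have hsw : ∑ ij ∈ Finset.antidiagonal k.isPWO_support g.isPWO_support (m + 1),
      (ij.2 : ℂ) * (k.coeff ij.1 * g.coeff ij.2) =
      ∑ ij ∈ Finset.antidiagonal g.isPWO_support k.isPWO_support (m + 1),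
      (ij.1 : ℂ) * (g.coeff ij.1 * k.coeff ij.2) := by
    refine Finset.sum_nbij' Prod.swap Prod.swap ?_ ?_ ?_ ?_ ?_
    · intro a ha
      simp only [Finset.mem_antidiagonal, Prod.fst_swap, Prod.snd_swap] at ha ⊢
      exact ⟨ha.2.1, ha.1, by rw [add_comm]; exact ha.2.2⟩
    · intro a ha
      simp only [Finset.mem_antidiagonal, Prod.fst_swap, Prod.snd_swap] at ha ⊢
      exact ⟨ha.2.1, ha.1, by rw [add_comm]; exact ha.2.2⟩
    · intro a _; rfl
    · intro a _; rfl
    · intro a _; simp [mul_comm]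
  rw [hsw, ← Finset.sum_add_distrib]
  refine Finset.sum_congr rfl fun ij hij => ?_
  have := (Finset.mem_antidiagonal.mp hij).2.2
  rw [← this]
  push_cast
  ring

theorem derivative_C (c : ℂ) :
    LaurentSeries.derivative ℂ (algebraMap ℂ (LaurentSeries ℂ) c) = 0 := by
  ext m
  have e : algebraMap ℂ (LaurentSeries ℂ) c = HahnSeries.single 0 c := by
    rw [HahnSeries.algebraMap_apply', PowerSeries.algebraMap_apply]
    exact HahnSeries.ofPowerSeries_C c
  rw [coeff_derivative, e, HahnSeries.coeff_zero]
  by_cases h : m + 1 = 0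
  · simp [h]
  · rw [HahnSeries.coeff_single_of_ne h, mul_zero]

/-- The derivation `d/dx` of `ℂ((x))`. -/
def laurentDeriv : Der (LaurentSeries ℂ) :=
  mkDer (fun g => LaurentSeries.derivative ℂ g) (map_add _) derivative_mul derivative_C

/-! ### Lie algebra data

`b : LieAlgebra.Basis (Fin n) H` is a system of Chevalley generators `e_i, f_i, h_i = α_i^∨` of `L`
with Cartan subalgebra `H`. -/

section LieData

variable {L : Type*} [LieRing L] [LieAlgebra ℂ L] {n : ℕ} {H : LieSubalgebra ℂ L}
  (b : LieAlgebra.Basis (Fin n) H)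

/-- `ρ^∨ = ∑_{i,j} (A⁻¹)_{ij} α_i^∨`: the element of the Cartan subalgebra with `α_i(ρ^∨) = 1`
for every simple root (recall `[α_i^∨, e_j] = A_{ji} e_j`). -/
def rhoCheck : L :=
  ∑ i, ∑ j, ((b.A.map (Int.cast : ℤ → ℂ))⁻¹ i j) • b.h i

/-- The component `𝔤^i = {x | [ρ^∨, x] = i x}` of the principal gradation, in degrees `i ≥ 0`. -/
def grade (i : ℕ) : Submodule ℂ L :=
  Module.End.eigenspace (LieAlgebra.ad ℂ L (rhoCheck b)) (i : ℂ)

/-- The Coxeter number `1 + height of the highest root`, the principal gradation being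
concentrated in degrees at most the height of the highest root. In the simply-laced
case this is also the dual Coxeter number `h^∨`. -/
def coxeterNumber : ℕ := sSup {i : ℕ | grade b i ≠ ⊥} + 1

/-- `𝔫_+`, the Lie subalgebra generated by the `e_i`. -/
def nPlus : Submodule ℂ L := (LieSubalgebra.lieSpan ℂ L (Set.range b.e)).toSubmodule

/-- `𝔟_+ = 𝔥 ⊕ 𝔫_+`. -/
def bPlus : Submodule ℂ L := H.toSubmodule ⊔ nPlus b

/-- The principal nilpotent element `f = ∑_i f_i`. -/
def prinNil : L := ∑ i, b.f i

/-- A transversal subspace: an `ad ρ^∨`-invariant subspace `𝔰` of `𝔟_+` with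
`𝔟_+ = [f, 𝔫_+] ⊕ 𝔰`. -/
structure IsTransversal (s : Submodule ℂ L) : Prop where
  le_bPlus : s ≤ bPlus b
  invariant : ∀ x ∈ s, ⁅rhoCheck b, x⁆ ∈ s
  disjoint : Disjoint ((nPlus b).map (LieAlgebra.ad ℂ L (prinNil b) : L →ₗ[ℂ] L)) s
  sup_eq : (nPlus b).map (LieAlgebra.ad ℂ L (prinNil b) : L →ₗ[ℂ] L) ⊔ s = bPlus b

/-- `𝔰^d = 𝔰 ∩ 𝔤^d`; it is nonzero exactly when `d` is an exponent, and its dimension is the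
multiplicity of the exponent. Hence a sum over the exponents `d_1, …, d_n` of terms with
coefficients in `𝔰^{d_i}` is a sum over all degrees `d` of terms with coefficients in `𝔰^d`. -/
def sGrade (s : Submodule ℂ L) (d : ℕ) : Submodule ℂ L := s ⊓ grade b d

/-! ### Gauge transformations and the canonical form

An operator `∂ + A` with `A ∈ 𝔤(K) = K ⊗ 𝔤` is represented by `A`. -/

section Gauge

variable {K : Type*} [Field K] [Algebra ℂ K]

/-- The action `exp(ad y).(∂ + A) = ∂ + ∑_{k ≥ 0} (ad y)^k A / k! - ∑_{k ≥ 0} (ad y)^k y' / (k+1)!`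
of `exp y`, for `y ∈ 𝔫_+(K)` (the sums are finite because `ad y` is nilpotent);
`δ` is the derivation of `K`, extended to `K ⊗ 𝔤` coefficientwise. -/
def gaugeAct (δ : Der K) (y A : K ⊗[ℂ] L) : K ⊗[ℂ] L :=
  (∑ᶠ k : ℕ, ((k.factorial : K))⁻¹ • ((LieAlgebra.ad K (K ⊗[ℂ] L) y) ^ k) A) -
    ∑ᶠ k : ℕ, (((k + 1).factorial : K))⁻¹ •
      ((LieAlgebra.ad K (K ⊗[ℂ] L) y) ^ k) (δ.toLinearMap.rTensor L y)

/-- Gauge equivalence of `∂ + A` and `∂ + A'` under the group `{exp y | y ∈ 𝔫_+(K)}`. -/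
def GaugeEquivalent (δ : Der K) (A A' : K ⊗[ℂ] L) : Prop :=
  ∃ y ∈ (nPlus b).baseChange K, gaugeAct δ y A = A'

/-- `∂ + A'` is the canonical form of `∂ + A`: it is gauge equivalent to it, and
`A' ∈ f + 𝔰(K)`. -/
def IsCanonicalForm (s : Submodule ℂ L) (δ : Der K) (A A' : K ⊗[ℂ] L) : Prop :=
  A' - 1 ⊗ₜ[ℂ] prinNil b ∈ s.baseChange K ∧ GaugeEquivalent b δ A A'

end Gauge

/-! ### Parameter spaces -/

/-- `⊕_{i=1}^{h^∨-1} 𝔤^i`, that is `𝔫_+`. -/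
abbrev UPos : Type _ :=
  (i : Finset.Icc 1 (coxeterNumber b - 1)) → grade b (i : ℕ)

/-- `V_i`: families `(s^d)_d` with `s^d ∈ 𝔰^d`, `i ≤ d ≤ h^∨ - 1`. -/
abbrev VDeg (s : Submodule ℂ L) (i : ℕ) : Type _ :=
  (d : Finset.Icc i (coxeterNumber b - 1)) → sGrade b s (d : ℕ)

/-- `⊕_{i=1}^{h^∨-1} V_i`. -/
abbrev VPos (s : Submodule ℂ L) : Type _ :=
  (i : Finset.Icc 1 (coxeterNumber b - 1)) → VDeg b s (i : ℕ)

/-- `U_N`, the direct sum of `N` copies of `⊕_{i ≥ 1} 𝔤^i`. -/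
abbrev UN (N : ℕ) : Type _ := Fin N → UPos b

/-- `V_N`, the direct sum of `N` copies of `⊕_{i ≥ 1} V_i`. -/
abbrev VN (s : Submodule ℂ L) (N : ℕ) : Type _ := Fin N → VPos b s

/-- `∑_d c_d ⊗ s^d`. -/
def vTerm {K : Type*} [Field K] [Algebra ℂ K] {s : Submodule ℂ L} {i : ℕ} (c : ℕ → K)
    (v : VDeg b s i) : K ⊗[ℂ] L :=
  ∑ d : Finset.Icc i (coxeterNumber b - 1), c (d : ℕ) ⊗ₜ[ℂ] (v d : L)

/-! ### Local theory: Bessel operators -/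

section Bessel

variable {K : Type*} [Field K] [Algebra ℂ K]

/-- The 1-Bessel operator `∂_x + f + x⁻¹ (X^0 + ∑_{i=1}^{h^∨-1} X^i)`. -/
def oneBessel (x : K) (X0 : H) (X : UPos b) : K ⊗[ℂ] L :=
  1 ⊗ₜ[ℂ] prinNil b +
    x⁻¹ ⊗ₜ[ℂ] ((X0 : L) + ∑ i : Finset.Icc 1 (coxeterNumber b - 1), (X i : L))

/-- The `𝔰`-Bessel operator `∂_x + f + ∑_d ∑_{l=0}^d s^d_l / x^{d+1-l}`, with coefficients
`v.1 = (s^d_0)_d` and `v.2 = (s^d_l)_{1 ≤ l ≤ d}`. -/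
def sBessel {s : Submodule ℂ L} (x : K) (v : VDeg b s 0 × VPos b s) : K ⊗[ℂ] L :=
  1 ⊗ₜ[ℂ] prinNil b + vTerm b (fun d => (x ^ (d + 1))⁻¹) v.1 +
    ∑ l : Finset.Icc 1 (coxeterNumber b - 1), vTerm b (fun d => (x ^ (d + 1 - (l : ℕ)))⁻¹) (v.2 l)

end Bessel

/-- The coordinate `x` of the field `ℂ((x))` of formal Laurent series. -/
def laurentX : LaurentSeries ℂ := HahnSeries.single 1 1

/-- The map `Φ` from 1-Bessel operators to the `𝔰`-Bessel operators which are their canonical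
forms. -/
def Phi (s : Submodule ℂ L) (X0 : H) (X : UPos b) : VDeg b s 0 × VPos b s :=
  Classical.epsilon fun v =>
    IsCanonicalForm b s laurentDeriv (oneBessel b laurentX X0 X) (sBessel b laurentX v)

/-- The map `Φ^{X^0} : ⊕_{i ≥ 1} 𝔤^i → ⊕_{i ≥ 1} V_i`: the components of `Φ` in
`V_1, …, V_{h^∨-1}`, with `X^0` fixed. -/
def PhiAt (s : Submodule ℂ L) (X0 : H) : UPos b → VPos b s := fun X => (Phi b s X0 X).2

/-! ### Global theory: operators over `ℂ(z)` -/

/-- The rational function `z - w`. -/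
def zSub (w : ℂ) : RatFunc ℂ := RatFunc.X - RatFunc.C w

/-- `∂_z + f + r/z + ∑_j (z - w_j)⁻¹ (X^0(j) + ∑_{i=1}^{h^∨-1} X^i(j) / z^i)`. -/
def globalOne {N : ℕ} (w : Fin N → ℂ) (r : H) (X0 : Fin N → H) (X : UN b N) : RatFunc ℂ ⊗[ℂ] L :=
  1 ⊗ₜ[ℂ] prinNil b + (RatFunc.X)⁻¹ ⊗ₜ[ℂ] (r : L) +
    ∑ j, (zSub (w j))⁻¹ •
      ((1 : RatFunc ℂ) ⊗ₜ[ℂ] (X0 j : L) +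
        ∑ i : Finset.Icc 1 (coxeterNumber b - 1), ((RatFunc.X : RatFunc ℂ) ^ (i : ℕ))⁻¹ ⊗ₜ[ℂ] (X j i : L))

/-- `∂_z + f + ∑_d r̄^d / z^{d+1} + ∑_j ∑_d z^{-d} ∑_{l=0}^d s^d_l(j) / (z - w_j)^{d+1-l}`, with
coefficients `v.1 = (r̄^d)_d`, `v.2.1 = (s^d_0(j))_{j,d}`, `v.2.2 = (s^d_l(j))_{j, 1 ≤ l ≤ d}`. -/
def globalS {s : Submodule ℂ L} {N : ℕ} (w : Fin N → ℂ)
    (v : VDeg b s 0 × (Fin N → VDeg b s 0) × VN b s N) : RatFunc ℂ ⊗[ℂ] L :=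
  1 ⊗ₜ[ℂ] prinNil b + vTerm b (fun d => ((RatFunc.X : RatFunc ℂ) ^ (d + 1))⁻¹) v.1 +
    ∑ j, (vTerm b (fun d => ((RatFunc.X : RatFunc ℂ) ^ d)⁻¹ * (zSub (w j) ^ (d + 1))⁻¹) (v.2.1 j) +
      ∑ l : Finset.Icc 1 (coxeterNumber b - 1), vTerm b
        (fun d => ((RatFunc.X : RatFunc ℂ) ^ d)⁻¹ * (zSub (w j) ^ (d + 1 - (l : ℕ)))⁻¹)
        (v.2.2 j l))

/-- All the coefficients of the canonical form of the operator `globalOne b w r X0 X`. -/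
def miuraFull (s : Submodule ℂ L) {N : ℕ} (w : Fin N → ℂ) (r : H) (X0 : Fin N → H) (X : UN b N) :
    VDeg b s 0 × (Fin N → VDeg b s 0) × VN b s N :=
  Classical.epsilon fun v =>
    IsCanonicalForm b s ratDeriv (globalOne b w r X0 X) (globalS b w v)

/-- The extended Miura map `F^{r, X^0(1), …, X^0(N)} : U_N → V_N`. -/
def miura (s : Submodule ℂ L) {N : ℕ} (w : Fin N → ℂ) (r : H) (X0 : Fin N → H) :
    UN b N → VN b s N := fun X => (miuraFull b s w r X0 X).2.2

end LieData

end Oper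

end

open scoped TensorProduct Matrix

noncomputable section

/-! At a point with local coordinate `x`, give a term of order `m` in `x` and of degree `i` in the
principal gradation the weight `m + i + 1`. Then `f` and `X^0/x` have weight `0`, `X^i/x` has weight
`i`, and `s^d_l/x^{d+1-l}` has weight `l`. The theorem holds because gauge fixing respects weights,
so that both maps are triangular and have the same diagonal blocks up to invertible scalings.

Gauge fixing is governed by a homotopy `Ψ`, a left inverse of `ad f` on `𝔫_+` that kills `𝔰`
(`exists_isHomotopy`). To leading order in the degree, a variation `ζ` of the gauge parameter
changes the result by `[ζ, f]`. If the change of the result lies in `𝔰(K)`, applying `Ψ` determines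
`ζ` degree by degree (`Variation.rigid`). Run constructively, the same induction gives existence
(`exists_solution`), with coefficients in any family closed under the relevant products and
derivatives. Powers of `x⁻¹` yield the `𝔰`-Bessel shape; products of `z⁻¹` and `(z - w_j)⁻¹`,
expanded in partial fractions, yield the global shape. Uniqueness of the coefficients follows by
reading them off at the poles.

Rigidity has two further consequences. Operators agreeing below weight `l` have canonical forms
agreeing below weight `l` (`Solution.sub_mem`). For operators that all agree below weight `1`,
proportionality modulo weight `l + 1` of two differences of weight at least `l` passes to the
canonical forms, because the quadratic errors have weight at least `l + 1`
(`Solution.sub_smul_sub_mem`). Hence, once the lower arguments are fixed, the `l`-th component of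
`Φ^{X^0}` is affine in `X^l`, with linear part `phiLin` depending on nothing else. Near `w_j` the
global operator agrees with a 1-Bessel operator with the same `X^0(j)` below weight `1`, and a
change of `X^l(j)` acts, modulo weight `l + 1`, as the change `w_j^{-l} X^l(j)` in the Bessel
operator. So the `l`-th block of `F` is diagonal in `j`, with entries `phiLin` up to scalings
(`miura_sub_eq`).

The identity `dim 𝔤^l = dim V_l` (`finrank_VDeg`) makes these blocks square, and a triangular map
with square blocks is bijective exactly when all its blocks are injective
(`bijective_iff_of_triangular`). -/

namespace Oper

/-! ### The principal gradation and the homotopy for `ad f` -/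

section LieLevel

variable {L : Type*} [LieRing L] [LieAlgebra ℂ L] {n : ℕ} {H : LieSubalgebra ℂ L}
  (b : LieAlgebra.Basis (Fin n) H)

/-- The eigenspace of `ad ρ^∨` for an arbitrary complex eigenvalue. -/
def wt (c : ℂ) : Submodule ℂ L := Module.End.eigenspace (LieAlgebra.ad ℂ L (rhoCheck b)) c

variable {b} in
theorem mem_wt {c : ℂ} {x : L} : x ∈ wt b c ↔ ⁅rhoCheck b, x⁆ = c • x := by
  simp [wt]

theorem grade_eq_wt (i : ℕ) : grade b i = wt b (i : ℂ) := rfl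

variable {b} in
theorem lie_mem_wt {c d : ℂ} {x y : L} (hx : x ∈ wt b c) (hy : y ∈ wt b d) :
    ⁅x, y⁆ ∈ wt b (c + d) := by
  rw [mem_wt] at *
  rw [leibniz_lie, hx, hy, smul_lie, lie_smul, add_smul]

/-- In coordinates this is `α_k(ρ^∨) = 1`: the `k`-th row sum of `A A⁻¹`. -/
theorem sum_inv_mul_cartan (k : Fin n) :
    ∑ i, ∑ j, (b.A.map (Int.cast : ℤ → ℂ))⁻¹ i j * (b.A k i : ℂ) = 1 := by
  have hdet : (b.A.map (Int.cast : ℤ → ℂ)).det ≠ 0 := by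
    have h := b.nondegen.det_ne_zero
    have h2 : (b.A.map (Int.cast : ℤ → ℂ)).det = ((b.A.det : ℤ) : ℂ) := by
      have := RingHom.map_det (Int.castRingHom ℂ) b.A
      simpa [RingHom.mapMatrix_apply] using this.symm
    rw [h2]
    exact_mod_cast h
  rw [Finset.sum_comm]
  have h1 := Matrix.mul_nonsing_inv (b.A.map (Int.cast : ℤ → ℂ)) (isUnit_iff_ne_zero.mpr hdet)
  have h3 : ∀ j, ∑ i, (b.A.map (Int.cast : ℤ → ℂ))⁻¹ i j * (b.A k i : ℂ) =
      (1 : Matrix (Fin n) (Fin n) ℂ) k j := by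
    intro j
    rw [← h1, Matrix.mul_apply]
    exact Finset.sum_congr rfl fun i _ => by rw [Matrix.map_apply, mul_comm]
  simp_rw [h3, Matrix.one_apply]
  simp

theorem e_mem_wt (k : Fin n) : b.e k ∈ wt b 1 := by
  rw [mem_wt, rhoCheck, sum_lie]
  simp_rw [sum_lie, smul_lie, b.lie_h_e, ← Int.cast_smul_eq_zsmul ℂ, smul_smul,
    ← Finset.sum_smul]
  rw [sum_inv_mul_cartan]

theorem f_mem_wt (k : Fin n) : b.f k ∈ wt b (-1) := by
  rw [mem_wt, rhoCheck, sum_lie]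
  simp_rw [sum_lie, smul_lie, b.lie_h_f, ← Int.cast_smul_eq_zsmul ℂ, smul_smul,
    ← Finset.sum_smul]
  congr 1
  rw [← sum_inv_mul_cartan b k]
  simp

theorem prinNil_mem_wt : prinNil b ∈ wt b (-1) :=
  Submodule.sum_mem _ fun k _ => f_mem_wt b k

theorem rhoCheck_mem : rhoCheck b ∈ H := by
  have h : ∀ i, b.h i ∈ H := fun i => (b.h' i).2
  exact Submodule.sum_mem H.toSubmodule fun i _ => Submodule.sum_mem _ fun j _ =>
    Submodule.smul_mem _ _ (h i)

theorem cartan_le_wt : H.toSubmodule ≤ wt b 0 := by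
  intro x hx
  have := b.isLieAbelian_cartan
  rw [mem_wt, zero_smul]
  exact congrArg Subtype.val (this.trivial ⟨rhoCheck b, rhoCheck_mem b⟩ ⟨x, hx⟩)

/-- The sum of the eigenspaces with eigenvalues `σ, 2σ, 3σ, …`. -/
def halfSum (σ : ℂ) : Submodule ℂ L := ⨆ k : ℕ, wt b (σ * ((k : ℂ) + 1))

theorem lie_mem_halfSum {σ : ℂ} {x y : L} (hx : x ∈ halfSum b σ) (hy : y ∈ halfSum b σ) :
    ⁅x, y⁆ ∈ halfSum b σ := by
  unfold halfSum at hx hy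
  induction hx using Submodule.iSup_induction' with
  | mem k u hu =>
    induction hy using Submodule.iSup_induction' with
    | mem l v hv =>
      refine Submodule.mem_iSup_of_mem (k + l + 1) ?_
      have := lie_mem_wt hu hv
      rwa [← mul_add, show (k : ℂ) + 1 + ((l : ℂ) + 1) = ((k + l + 1 : ℕ) : ℂ) + 1 by
        push_cast; ring] at this
    | zero => simp
    | add v w _ _ hv hw => rw [lie_add]; exact add_mem hv hw
  | zero => simp
  | add v w _ _ hv hw => rw [add_lie]; exact add_mem hv hw

theorem lieSpan_le_halfSum {ι : Type*} {σ : ℂ} (z : ι → L) (hz : ∀ i, z i ∈ wt b σ) :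
    (LieSubalgebra.lieSpan ℂ L (Set.range z)).toSubmodule ≤ halfSum b σ := by
  intro x hx
  change x ∈ LieSubalgebra.lieSpan ℂ L (Set.range z) at hx
  induction hx using LieSubalgebra.lieSpan_induction with
  | mem u hu =>
    obtain ⟨i, rfl⟩ := hu
    exact Submodule.mem_iSup_of_mem 0 (by simpa using hz i)
  | zero => simp
  | add _ _ _ _ hu hv => exact add_mem hu hv
  | smul t _ _ hu => exact Submodule.smul_mem _ t hu
  | lie _ _ _ _ hu hv => exact lie_mem_halfSum b hu hv

theorem nPlus_le_halfSum : nPlus b ≤ halfSum b 1 := lieSpan_le_halfSum b _ (e_mem_wt b)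

theorem triangular_decomposition :
    H.toSubmodule ⊔ (LieSubalgebra.lieSpan ℂ L (Set.range b.f)).toSubmodule ⊔ nPlus b = ⊤ := by
  have h := congrArg LieSubmodule.toSubmodule b.iSup_cartan_borelLower_borelUpper_eq_top
  rw [show iSup ![H.toLieSubmodule, b.borelLower, b.borelUpper] =
    H.toLieSubmodule ⊔ b.borelLower ⊔ b.borelUpper by simp] at h
  rw [LieSubmodule.sup_toSubmodule, LieSubmodule.sup_toSubmodule, LieSubmodule.top_toSubmodule] at h
  exact h

theorem wt_iSupIndep : iSupIndep (wt b) :=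
  Module.End.eigenspaces_iSupIndep _

theorem halfSum_eq_biSup (σ : ℂ) :
    halfSum b σ = ⨆ c ∈ Set.range fun k : ℕ => σ * ((k : ℂ) + 1), wt b c := by
  rw [iSup_range]; rfl

theorem iSupIndep_parts : iSupIndep ![wt b 0, halfSum b (-1), halfSum b 1] := by
  have key := wt_iSupIndep b
  have e0 : wt b 0 = ⨆ c ∈ ({0} : Set ℂ), wt b c := by simp
  have hpos : ∀ k : ℕ, (k : ℂ) + 1 ≠ 0 := fun k => by exact_mod_cast Nat.succ_ne_zero k
  have d1 : Disjoint ({0} : Set ℂ) (Set.range fun k : ℕ => (-1 : ℂ) * ((k : ℂ) + 1)) := by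
    rw [Set.disjoint_singleton_left]
    rintro ⟨k, hk⟩
    exact hpos k (by linear_combination -hk)
  have d2 : Disjoint ({0} : Set ℂ) (Set.range fun k : ℕ => (1 : ℂ) * ((k : ℂ) + 1)) := by
    rw [Set.disjoint_singleton_left]
    rintro ⟨k, hk⟩
    exact hpos k (by simpa using hk)
  have d3 : Disjoint (Set.range fun k : ℕ => (-1 : ℂ) * ((k : ℂ) + 1))
      (Set.range fun k : ℕ => (1 : ℂ) * ((k : ℂ) + 1)) := by
    rw [Set.disjoint_left]
    rintro _ ⟨k, rfl⟩ ⟨l, hl⟩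
    have h : ((k + l + 2 : ℕ) : ℂ) = 0 := by
      push_cast
      linear_combination hl
    exact absurd h (by exact_mod_cast Nat.succ_ne_zero (k + l + 1))
  rw [iSupIndep_fin_three]
  refine ⟨?_, ?_, ?_⟩ <;>
    simp only [Matrix.cons_val_zero, Matrix.cons_val_one, Matrix.cons_val]
  · rw [e0, halfSum_eq_biSup, halfSum_eq_biSup, ← iSup_union]
    exact key.disjoint_biSup_biSup (d1.union_right d2)
  · rw [e0, halfSum_eq_biSup, halfSum_eq_biSup, ← iSup_union]
    exact key.disjoint_biSup_biSup (d3.union_right d1.symm)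
  · rw [e0, halfSum_eq_biSup, halfSum_eq_biSup, ← iSup_union]
    exact key.disjoint_biSup_biSup (d2.symm.union_right d3.symm)

/-- The three parts of the triangular decomposition lie in three independent sums of eigenspaces of
`ad ρ^∨` and together span `L`, so none of the inclusions can be strict. This identifies `𝔥` and
`𝔫_+` by degree without any root space analysis. -/
theorem parts_eq : ![H.toSubmodule, (LieSubalgebra.lieSpan ℂ L (Set.range b.f)).toSubmodule,
    nPlus b] = ![wt b 0, halfSum b (-1), halfSum b 1] := by
  refine ((iSupIndep_parts b).le_iff_eq_of_iSup_eq_top ?_).mp ?_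
  · rw [← triangular_decomposition b]
    simp
  · intro i
    fin_cases i
    · exact cartan_le_wt b
    · exact lieSpan_le_halfSum b _ (f_mem_wt b)
    · exact nPlus_le_halfSum b

theorem cartan_eq_wt : H.toSubmodule = wt b 0 := congrFun (parts_eq b) 0

theorem nPlus_eq_halfSum : nPlus b = halfSum b 1 := congrFun (parts_eq b) 2

theorem iSup_wt : ⨆ c, wt b c = ⊤ := by
  rw [eq_top_iff, ← triangular_decomposition b]
  refine sup_le (sup_le ?_ ?_) ?_
  · rw [cartan_eq_wt b]; exact le_iSup (wt b) 0
  · exact (lieSpan_le_halfSum b _ (f_mem_wt b)).trans (iSup_le fun k => le_iSup (wt b) _)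
  · exact (nPlus_le_halfSum b).trans (iSup_le fun k => le_iSup (wt b) _)

theorem grade_succ_le_nPlus (i : ℕ) : grade b (i + 1) ≤ nPlus b := by
  rw [nPlus_eq_halfSum, grade_eq_wt]
  refine le_trans (le_of_eq ?_) (le_iSup _ i)
  congr 1
  push_cast
  ring

theorem grade_le_bPlus (i : ℕ) : grade b i ≤ bPlus b := by
  rcases i with _ | i
  · rw [grade_eq_wt, Nat.cast_zero, ← cartan_eq_wt b]; exact le_sup_left
  · exact (grade_succ_le_nPlus b i).trans le_sup_right

theorem nPlus_eq_iSup : nPlus b = ⨆ i : ℕ, grade b (i + 1) := by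
  rw [nPlus_eq_halfSum, halfSum]
  refine iSup_congr fun i => ?_
  rw [grade_eq_wt]
  congr 1
  push_cast
  ring

/-- Boundedness gives the `sSup` in `coxeterNumber` its intended meaning; it comes from the
finiteness of the spectrum of `ad ρ^∨`. -/
theorem bddAbove_grade [FiniteDimensional ℂ L] : BddAbove {i : ℕ | grade b i ≠ ⊥} := by
  have h : {c : ℂ | wt b c ≠ ⊥}.Finite := by
    have := Module.End.finite_hasEigenvalue (LieAlgebra.ad ℂ L (rhoCheck b))
    exact this
  have h2 : {i : ℕ | grade b i ≠ ⊥}.Finite :=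
    Set.Finite.preimage (f := fun i : ℕ => (i : ℂ)) (Nat.cast_injective.injOn) h
  exact h2.bddAbove

theorem grade_eq_bot [FiniteDimensional ℂ L] {i : ℕ}
    (hi : coxeterNumber b ≤ i) : grade b i = ⊥ := by
  by_contra hne
  have := le_csSup (bddAbove_grade b) hne
  unfold coxeterNumber at hi
  omega

/-- The projection onto an eigenspace of `ad ρ^∨` along the sum of the others. -/
theorem exists_wtProj (c : ℂ) : ∃ p : L →ₗ[ℂ] L, (∀ x ∈ wt b c, p x = x) ∧
    ∀ d ≠ c, ∀ x ∈ wt b d, p x = 0 := by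
  have hc : IsCompl (wt b c) (⨆ d ≠ c, wt b d) := by
    refine ⟨wt_iSupIndep b c, ?_⟩
    rw [codisjoint_iff, eq_top_iff, ← iSup_wt b]
    refine iSup_le fun d => ?_
    by_cases hd : d = c
    · rw [hd]; exact le_sup_left
    · exact le_sup_of_le_right (le_iSup₂_of_le d hd le_rfl)
  refine ⟨Submodule.projection _ _ hc, fun x hx => Submodule.projection_apply_of_mem_left hc hx,
    fun d hd x hx => ?_⟩
  rw [Submodule.projection_apply_eq_zero_iff hc]
  exact (le_iSup₂_of_le (f := fun d (_ : d ≠ c) => wt b d) d hd le_rfl) hx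

/-- The projection onto an eigenspace of `ad ρ^∨`. -/
def wtProj (c : ℂ) : L →ₗ[ℂ] L := (exists_wtProj b c).choose

variable {b}

theorem wtProj_self {c : ℂ} {x : L} (hx : x ∈ wt b c) : wtProj b c x = x :=
  (exists_wtProj b c).choose_spec.1 x hx

theorem wtProj_of_ne {c d : ℂ} (h : d ≠ c) {x : L} (hx : x ∈ wt b d) : wtProj b c x = 0 :=
  (exists_wtProj b c).choose_spec.2 d h x hx

theorem wt_induction {p : L → Prop} (hm : ∀ c, ∀ x ∈ wt b c, p x) (h0 : p 0)
    (ha : ∀ x y, p x → p y → p (x + y)) (x : L) : p x :=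
  Submodule.iSup_induction (wt b) (motive := p) (by rw [iSup_wt]; trivial) hm h0 ha

theorem wtProj_mem (c : ℂ) (x : L) : wtProj b c x ∈ wt b c := by
  induction x using wt_induction (b := b) with
  | hm d x hx =>
    by_cases h : d = c
    · subst h; rwa [wtProj_self hx]
    · rw [wtProj_of_ne h hx]; exact zero_mem _
  | h0 => simp
  | ha x y hx hy => rw [map_add]; exact add_mem hx hy

theorem eq_zero_of_wtProj {x : L} (h : ∀ c, wtProj b c x = 0) : x = 0 := by
  classical
  have hx : x ∈ ⨆ c, wt b c := by rw [iSup_wt]; trivial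
  obtain ⟨f, hf, hfx⟩ := (Submodule.mem_iSup_iff_exists_finsupp _ _).mp hx
  have : ∀ c, f c = 0 := by
    intro c
    rw [← h c, ← hfx, Finsupp.sum, map_sum]
    rw [Finset.sum_eq_single c]
    · exact (wtProj_self (hf c)).symm
    · intro d _ hd
      exact wtProj_of_ne hd (hf d)
    · intro hc
      rw [Finsupp.notMem_support_iff.mp hc, map_zero]
  rw [← hfx]
  exact Finset.sum_eq_zero fun c _ => this c

theorem wtProj_lie {c d : ℂ} {y : L} (hy : y ∈ wt b d) (x : L) :
    wtProj b (d + c) ⁅y, x⁆ = ⁅y, wtProj b c x⁆ := by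
  induction x using wt_induction (b := b) with
  | hm a x hx =>
    by_cases h : a = c
    · subst h; rw [wtProj_self hx, wtProj_self (lie_mem_wt hy hx)]
    · rw [wtProj_of_ne h hx, wtProj_of_ne _ (lie_mem_wt hy hx), lie_zero]
      intro h'
      exact h (add_left_cancel h')
  | h0 => simp
  | ha x y hx hy => rw [lie_add, map_add, map_add, lie_add, hx, hy]

theorem wtProj_mem_of_invariant [FiniteDimensional ℂ L] {s : Submodule ℂ L}
    (hs : ∀ x ∈ s, ⁅rhoCheck b, x⁆ ∈ s) (c : ℂ)
    {x : L} (hx : x ∈ s) : wtProj b c x ∈ s := by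
  have h := Submodule.eq_iSup_inf_genEigenspace (p := s)
    (f := LieAlgebra.ad ℂ L (rhoCheck b)) 1 (by simpa using hs) (iSup_wt b)
  rw [h] at hx
  induction hx using Submodule.iSup_induction' with
  | mem d u hu =>
    by_cases hd : d = c
    · subst hd; rw [wtProj_self hu.2]; exact hu.1
    · rw [wtProj_of_ne hd hu.2]; exact zero_mem _
  | zero => simp
  | add u v _ _ hu hv => rw [map_add]; exact add_mem hu hv

theorem wtProj_nPlus_of_ne {c : ℂ} (hc : ∀ i : ℕ, c ≠ ((i + 1 : ℕ) : ℂ)) {x : L}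
    (hx : x ∈ nPlus b) : wtProj b c x = 0 := by
  rw [nPlus_eq_iSup] at hx
  induction hx using Submodule.iSup_induction' with
  | mem d u hu => exact wtProj_of_ne (hc d).symm hu
  | zero => simp
  | add u v _ _ hu hv => rw [map_add, hu, hv, add_zero]

/-- The centralizer of the principal nilpotent `f` has no component of positive degree. -/
theorem eq_zero_of_lie_prinNil_wt [FiniteDimensional ℂ L] {i : ℕ} {x : L} (hx : x ∈ grade b (i + 1))
    (h : ⁅prinNil b, x⁆ = 0) : x = 0 := by
  by_contra hne
  have hx' := mem_wt.mp hx
  have hρ : rhoCheck b ≠ 0 := by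
    intro h0
    rw [h0, zero_lie] at hx'
    have : ((i + 1 : ℕ) : ℂ) ≠ 0 := by exact_mod_cast Nat.succ_ne_zero i
    exact hne ((smul_eq_zero.mp hx'.symm).resolve_left this)
  -- The coefficients are chosen so that `[E, f] = 2ρ^∨`, which completes `f` to a principal
  -- `sl₂`-triple.
  let E : L := ∑ i, (2 * ∑ j, (b.A.map (Int.cast : ℤ → ℂ))⁻¹ i j) • b.e i
  have hE : E ∈ wt b 1 := Submodule.sum_mem _ fun k _ => Submodule.smul_mem _ _ (e_mem_wt b k)
  have ht : IsSl2Triple ((2 : ℂ) • rhoCheck b) E (prinNil b) := by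
    refine ⟨smul_ne_zero two_ne_zero hρ, ?_, ?_, ?_⟩
    · simp only [E, prinNil, sum_lie, lie_sum, smul_lie]
      rw [rhoCheck, Finset.smul_sum]
      refine Finset.sum_congr rfl fun i _ => ?_
      rw [Finset.sum_eq_single i, (b.sl2 i).lie_e_f, ← Finset.sum_smul, smul_smul]
      · intro j _ hj
        rw [b.lie_e_f_ne j i hj, smul_zero]
      · intro hi; exact absurd (Finset.mem_univ i) hi
    · rw [smul_lie, mem_wt.mp hE, one_smul, two_smul, two_nsmul]
    · rw [smul_lie, mem_wt.mp (prinNil_mem_wt b), two_smul, two_nsmul]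
      simp
  -- With `e` and `f` exchanged, a vector killed by `f` is primitive of weight `-2(i + 1)`; finite
  -- dimension forces such a weight to be a natural number.
  have hP : ht.symm.HasPrimitiveVectorWith x (-(2 * ((i + 1 : ℕ) : ℂ))) :=
    ⟨hne, by rw [neg_lie, smul_lie, hx', smul_smul, neg_smul], h⟩
  obtain ⟨m, hm⟩ := hP.exists_nat
  have : ((2 * (i + 1) + m : ℕ) : ℂ) = 0 := by
    push_cast
    push_cast at hm
    linear_combination -hm
  exact absurd this (by exact_mod_cast (by omega : 2 * (i + 1) + m ≠ 0))

theorem eq_zero_of_lie_prinNil [FiniteDimensional ℂ L] {x : L} (hx : x ∈ nPlus b)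
    (h : ⁅prinNil b, x⁆ = 0) : x = 0 := by
  refine eq_zero_of_wtProj (b := b) fun c => ?_
  by_cases hc : ∃ i : ℕ, c = ((i + 1 : ℕ) : ℂ)
  · obtain ⟨i, rfl⟩ := hc
    refine eq_zero_of_lie_prinNil_wt (b := b) (wtProj_mem _ x) ?_
    rw [← wtProj_lie (prinNil_mem_wt b), h, map_zero]
  · push Not at hc
    exact wtProj_nPlus_of_ne hc hx

variable {s : Submodule ℂ L}

variable (b s) in
/-- A left inverse `Ψ` of `ad f : 𝔫_+ → 𝔟_+` that vanishes on the transversal subspace. -/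
def IsHomotopy (Ψ : L →ₗ[ℂ] L) : Prop :=
  (∀ x ∈ nPlus b, Ψ ⁅prinNil b, x⁆ = x) ∧ (∀ x ∈ s, Ψ x = 0) ∧
    (∀ i, ∀ x ∈ grade b i, Ψ x ∈ grade b (i + 1)) ∧
    ∀ i, ∀ x ∈ grade b i, x - ⁅prinNil b, Ψ x⁆ ∈ sGrade b s i

theorem exists_isHomotopy [FiniteDimensional ℂ L]
    (hs : IsTransversal b s) : ∃ Ψ, IsHomotopy b s Ψ := by
  let φ : L →ₗ[ℂ] L := LieAlgebra.ad ℂ L (prinNil b)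
  have hφ : ∀ x, φ x = ⁅prinNil b, x⁆ := fun x => rfl
  have hinj : LinearMap.ker (φ.domRestrict (nPlus b)) = ⊥ := by
    rw [LinearMap.ker_eq_bot']
    intro x hx
    exact Subtype.ext (eq_zero_of_lie_prinNil (b := b) x.2 hx)
  obtain ⟨g, hg⟩ := LinearMap.exists_leftInverse_of_injective _ hinj
  obtain ⟨q, hsq, hq⟩ := hs.disjoint.symm.exists_isCompl
  let Ψ : L →ₗ[ℂ] L := (nPlus b).subtype ∘ₗ g ∘ₗ Submodule.projection _ _ hq.symm
  have h1 : ∀ x ∈ nPlus b, Ψ ⁅prinNil b, x⁆ = x := by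
    intro x hx
    have hm : ⁅prinNil b, x⁆ ∈ (nPlus b).map φ := ⟨x, hx, rfl⟩
    have e1 : Submodule.projection _ _ hq.symm ⁅prinNil b, x⁆ = ⁅prinNil b, x⁆ :=
      Submodule.projection_apply_of_mem_left hq.symm hm
    have e2 := LinearMap.congr_fun hg ⟨x, hx⟩
    simp only [Ψ, LinearMap.comp_apply, e1]
    exact congrArg Subtype.val e2
  have h2 : ∀ x ∈ s, Ψ x = 0 := by
    intro x hx
    have e1 : Submodule.projection _ _ hq.symm x = 0 :=
      (Submodule.projection_apply_eq_zero_iff hq.symm).mpr (hsq hx)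
    simp only [Ψ, LinearMap.comp_apply, e1, map_zero]
  -- Since `𝔰` is `ad ρ^∨`-invariant, both summands of `x` in `[f, 𝔫_+] ⊕ 𝔰` can be projected to
  -- their homogeneous components. This is why `Ψ`, built from an arbitrary complement, is
  -- nevertheless homogeneous on nonnegative degrees.
  have key : ∀ i, ∀ x ∈ grade b i, ∃ y ∈ grade b (i + 1), ∃ z ∈ sGrade b s i,
      ⁅prinNil b, y⁆ + z = x := by
    intro i x hx
    have hx' := grade_le_bPlus b i hx
    rw [← hs.sup_eq] at hx'
    obtain ⟨_, ⟨y, hy, rfl⟩, z, hz, rfl⟩ := Submodule.mem_sup.mp hx'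
    refine ⟨wtProj b ((i + 1 : ℕ) : ℂ) y, wtProj_mem _ _, wtProj b i z,
      ⟨wtProj_mem_of_invariant hs.invariant _ hz, wtProj_mem _ _⟩, ?_⟩
    rw [← wtProj_lie (prinNil_mem_wt b), show (-1 : ℂ) + ((i + 1 : ℕ) : ℂ) = i by push_cast; ring,
      ← map_add]
    exact wtProj_self hx
  refine ⟨Ψ, h1, h2, ?_, ?_⟩
  · intro i x hx
    obtain ⟨y, hy, z, hz, rfl⟩ := key i x hx
    rw [map_add, h1 y (grade_succ_le_nPlus b i hy), h2 z hz.1, add_zero]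
    exact hy
  · intro i x hx
    obtain ⟨y, hy, z, hz, rfl⟩ := key i x hx
    rw [map_add, h1 y (grade_succ_le_nPlus b i hy), h2 z hz.1, add_zero, add_sub_cancel_left]
    exact hz

/-- The degree `i` part of `𝔟_+ = [f, 𝔫_+] ⊕ 𝔰` is `𝔤^i = [f, 𝔤^{i+1}] ⊕ 𝔰^i`, and `ad f` is
injective on `𝔤^{i+1}`. -/
theorem finrank_grade [FiniteDimensional ℂ L] (hs : IsTransversal b s) (i : ℕ) :
    Module.finrank ℂ (grade b i) =
      Module.finrank ℂ (grade b (i + 1)) + Module.finrank ℂ (sGrade b s i) := by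
  obtain ⟨Ψ, h1, h2, h3, h4⟩ := exists_isHomotopy hs
  let φ : L →ₗ[ℂ] L := LieAlgebra.ad ℂ L (prinNil b)
  have hsup : (grade b (i + 1)).map φ ⊔ sGrade b s i = grade b i := by
    apply le_antisymm
    · refine sup_le ?_ inf_le_right
      rintro _ ⟨y, hy, rfl⟩
      have := lie_mem_wt (prinNil_mem_wt b) hy
      rwa [show (-1 : ℂ) + ((i + 1 : ℕ) : ℂ) = i by push_cast; ring] at this
    · intro x hx
      exact Submodule.mem_sup.mpr ⟨_, ⟨Ψ x, h3 i x hx, rfl⟩, _, h4 i x hx,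
        add_sub_cancel _ _⟩
  have hinf : (grade b (i + 1)).map φ ⊓ sGrade b s i = ⊥ := by
    have := hs.disjoint.mono (Submodule.map_mono (grade_succ_le_nPlus b i))
      (inf_le_left : sGrade b s i ≤ s)
    exact this.eq_bot
  have hmap : Module.finrank ℂ ((grade b (i + 1)).map φ) = Module.finrank ℂ (grade b (i + 1)) := by
    rw [← LinearMap.range_domRestrict]
    refine LinearMap.finrank_range_of_inj ?_
    rw [← LinearMap.ker_eq_bot, LinearMap.ker_eq_bot']
    intro x hx
    exact Subtype.ext (eq_zero_of_lie_prinNil_wt (b := b) x.2 hx)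
  have := Submodule.finrank_sup_add_finrank_inf_eq ((grade b (i + 1)).map φ) (sGrade b s i)
  rw [hsup, hinf, finrank_bot, add_zero, hmap] at this
  exact this

theorem finrank_grade_eq_sum [FiniteDimensional ℂ L] (hs : IsTransversal b s) (l : ℕ) :
    Module.finrank ℂ (grade b l) =
      ∑ d ∈ Finset.Icc l (coxeterNumber b - 1), Module.finrank ℂ (sGrade b s d) := by
  have hpos : 1 ≤ coxeterNumber b := Nat.succ_le_succ (Nat.zero_le _)
  by_cases hl : coxeterNumber b ≤ l
  · rw [grade_eq_bot b hl, finrank_bot, Finset.Icc_eq_empty (by omega), Finset.sum_empty]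
  · push Not at hl
    induction hl.le using Nat.decreasingInduction with
    | self => omega
    | of_succ k hk ih =>
      rw [finrank_grade hs]
      by_cases hk' : k + 1 < coxeterNumber b
      · rw [ih hk', ← Finset.insert_Icc_add_one_left_eq_Icc (by omega : k ≤ coxeterNumber b - 1),
          Finset.sum_insert (by simp), add_comm]
      · have e : coxeterNumber b - 1 = k := by omega
        rw [grade_eq_bot b (by omega : coxeterNumber b ≤ k + 1), finrank_bot, e, zero_add,
          Finset.Icc_self, Finset.sum_singleton]

/-- Telescoping `finrank_grade` up to the top degree makes the diagonal blocks square, so that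
injectivity and surjectivity of a block are equivalent. -/
theorem finrank_VDeg [FiniteDimensional ℂ L] (hs : IsTransversal b s) (l : ℕ) :
    Module.finrank ℂ (VDeg b s l) = Module.finrank ℂ (grade b l) := by
  rw [finrank_grade_eq_sum hs, Module.finrank_pi_fintype]
  exact Finset.sum_coe_sort _ fun d => Module.finrank ℂ (sGrade b s d)

end LieLevel

/-! ### Coefficient families indexed by degree, and gauge fixing -/

section Filtered

variable {L : Type*} [LieRing L] [LieAlgebra ℂ L] {n : ℕ} {H : LieSubalgebra ℂ L}
  (b : LieAlgebra.Basis (Fin n) H) {K : Type*} [Field K] [Algebra ℂ K]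

/-- The span of the tensors `c ⊗ v` with `c ∈ Γ e`, `v ∈ V e` for some index `e`. -/
def gspan (Γ : ℕ → Submodule ℂ K) (V : ℕ → Submodule ℂ L) : Submodule ℂ (K ⊗[ℂ] L) :=
  Submodule.span ℂ {z | ∃ e, ∃ c ∈ Γ e, ∃ v ∈ V e, z = c ⊗ₜ[ℂ] v}

theorem tmul_mem_gspan {Γ : ℕ → Submodule ℂ K} {V : ℕ → Submodule ℂ L} (e : ℕ) {c : K} {v : L}
    (hc : c ∈ Γ e) (hv : v ∈ V e) : c ⊗ₜ[ℂ] v ∈ gspan Γ V :=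
  Submodule.subset_span ⟨e, c, hc, v, hv, rfl⟩

theorem gspan_le {Γ : ℕ → Submodule ℂ K} {V : ℕ → Submodule ℂ L} {p : Submodule ℂ (K ⊗[ℂ] L)}
    (h : ∀ e, ∀ c ∈ Γ e, ∀ v ∈ V e, c ⊗ₜ[ℂ] v ∈ p) : gspan Γ V ≤ p := by
  refine Submodule.span_le.mpr ?_
  rintro _ ⟨e, c, hc, v, hv, rfl⟩
  exact h e c hc v hv

theorem gspan_map_mem {K' L' : Type*} [Field K'] [Algebra ℂ K'] [AddCommGroup L'] [Module ℂ L']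
    {Γ : ℕ → Submodule ℂ K} {V : ℕ → Submodule ℂ L}
    (φ : K ⊗[ℂ] L →ₗ[ℂ] K' ⊗[ℂ] L') {p : Submodule ℂ (K' ⊗[ℂ] L')}
    (h : ∀ e, ∀ c ∈ Γ e, ∀ v ∈ V e, φ (c ⊗ₜ[ℂ] v) ∈ p) {x : K ⊗[ℂ] L} (hx : x ∈ gspan Γ V) :
    φ x ∈ p :=
  gspan_le (p := p.comap φ) h hx

theorem smul_lie_tensor (c : ℂ) (x y : K ⊗[ℂ] L) : ⁅c • x, y⁆ = c • ⁅x, y⁆ := by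
  rw [← algebraMap_smul K c x, smul_lie, algebraMap_smul]

theorem lie_smul_tensor (c : ℂ) (x y : K ⊗[ℂ] L) : ⁅x, c • y⁆ = c • ⁅x, y⁆ := by
  rw [← algebraMap_smul K c y, lie_smul, algebraMap_smul]

/-- `Γ_a Γ'_b ⊆ Γ''_{a+b}`. -/
def MulLE (Γ Γ' Γ'' : ℕ → Submodule ℂ K) : Prop :=
  ∀ a, ∀ c ∈ Γ a, ∀ a', ∀ c' ∈ Γ' a', c * c' ∈ Γ'' (a + a')

/-- `δ Γ_a ⊆ Γ'_{a+1}`. -/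
def DerLE (δ : Der K) (Γ Γ' : ℕ → Submodule ℂ K) : Prop :=
  ∀ a, ∀ c ∈ Γ a, δ c ∈ Γ' (a + 1)

theorem lie_mem_gspan {Γ Γ' Γ'' : ℕ → Submodule ℂ K} {V V' V'' : ℕ → Submodule ℂ L}
    (hΓ : MulLE Γ Γ' Γ'')
    (hV : ∀ a, ∀ v ∈ V a, ∀ a', ∀ v' ∈ V' a', ⁅v, v'⁆ ∈ V'' (a + a'))
    {x y : K ⊗[ℂ] L} (hx : x ∈ gspan Γ V) (hy : y ∈ gspan Γ' V') :
    ⁅x, y⁆ ∈ gspan Γ'' V'' := by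
  unfold gspan at hx hy
  induction hx using Submodule.span_induction with
  | mem x hx =>
    obtain ⟨a, c, hc, v, hv, rfl⟩ := hx
    induction hy using Submodule.span_induction with
    | mem y hy =>
      obtain ⟨a', c', hc', v', hv', rfl⟩ := hy
      rw [LieAlgebra.ExtendScalars.bracket_tmul]
      exact tmul_mem_gspan _ (hΓ _ _ hc _ _ hc') (hV _ _ hv _ _ hv')
    | zero => simp
    | add u v _ _ hu hv => rw [lie_add]; exact add_mem hu hv
    | smul t u _ hu => rw [lie_smul_tensor]; exact Submodule.smul_mem _ _ hu
  | zero => simp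
  | add u v _ _ hu hv => rw [add_lie]; exact add_mem hu hv
  | smul t u _ hu => rw [smul_lie_tensor]; exact Submodule.smul_mem _ _ hu

/-- The elements of `𝔫_+(K)` (or of `𝔟_+(K)`) with component of degree `e` in `Γ_e ⊗ 𝔤^e`. -/
def gaugeFil (Γ : ℕ → Submodule ℂ K) : Submodule ℂ (K ⊗[ℂ] L) := gspan Γ (grade b)

/-- The operators with component of degree `e - 1` in `Γ_e ⊗ 𝔤^{e-1}`. -/
def operFil (Γ : ℕ → Submodule ℂ K) : Submodule ℂ (K ⊗[ℂ] L) :=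
  gspan Γ fun e => wt b ((e : ℂ) - 1)

/-- The principal nilpotent element as an element of `𝔤(K)`. -/
abbrev prinNilK (K : Type*) [Field K] [Algebra ℂ K] : K ⊗[ℂ] L := (1 : K) ⊗ₜ[ℂ] prinNil b

/-- The derivation of `𝔤(K)` induced by a derivation of `K`. -/
abbrev derMap (δ : Der K) : K ⊗[ℂ] L →ₗ[ℂ] K ⊗[ℂ] L := δ.toLinearMap.rTensor L

/-- The family agreeing with `S` in degrees `0 < e < d`, with `B` in degrees `e ≥ d`, and
vanishing in degree `0`. -/
def mix (d : ℕ) (S B : ℕ → Submodule ℂ K) (e : ℕ) : Submodule ℂ K :=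
  if e = 0 then ⊥ else if e < d then S e else B e

/-- The family `Γ` with its component of degree `0` removed. -/
def pos (Γ : ℕ → Submodule ℂ K) (e : ℕ) : Submodule ℂ K := if e = 0 then ⊥ else Γ e

variable {b}

theorem mem_mix {d : ℕ} {S B : ℕ → Submodule ℂ K} {e : ℕ} {c : K} :
    c ∈ mix d S B e ↔ (e = 0 → c = 0) ∧ (e ≠ 0 → e < d → c ∈ S e) ∧ (e ≠ 0 → d ≤ e → c ∈ B e) := by
  unfold mix
  split_ifs with h1 h2
  · simp [h1]
  · simp [h1, h2]
  · simp [h1, h2]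
    omega

theorem mem_pos {Γ : ℕ → Submodule ℂ K} {e : ℕ} {c : K} :
    c ∈ pos Γ e ↔ (e = 0 → c = 0) ∧ (e ≠ 0 → c ∈ Γ e) := by
  unfold pos
  split_ifs with h1
  · simp [h1]
  · simp [h1]

theorem gaugeFil_mono {Γ Γ' : ℕ → Submodule ℂ K} (h : ∀ e, Γ e ≤ Γ' e) :
    gaugeFil b Γ ≤ gaugeFil b Γ' :=
  gspan_le fun e _ hc _ hv => tmul_mem_gspan e (h e hc) hv

theorem operFil_mono {Γ Γ' : ℕ → Submodule ℂ K} (h : ∀ e, Γ e ≤ Γ' e) :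
    operFil b Γ ≤ operFil b Γ' :=
  gspan_le fun e _ hc _ hv => tmul_mem_gspan e (h e hc) hv

/-- The index of an operator component is its degree plus one, whereas that of a gauge parameter is
its degree. With this shift indices add under the bracket, `f` has index `0`, and a derivative
raises the index by one. -/
theorem lie_mem_operFil {Γ Γ' Γ'' : ℕ → Submodule ℂ K} (hΓ : MulLE Γ Γ' Γ'')
    {x y : K ⊗[ℂ] L} (hx : x ∈ gaugeFil b Γ) (hy : y ∈ operFil b Γ') :
    ⁅x, y⁆ ∈ operFil b Γ'' := by
  refine lie_mem_gspan hΓ ?_ hx hy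
  intro a v hv a' v' hv'
  have := lie_mem_wt hv hv'
  rwa [show (a : ℂ) + ((a' : ℂ) - 1) = ((a + a' : ℕ) : ℂ) - 1 by push_cast; ring] at this

theorem derMap_mem {δ : Der K} {Γ Γ' : ℕ → Submodule ℂ K} (h : DerLE δ Γ Γ') {x : K ⊗[ℂ] L}
    (hx : x ∈ gaugeFil b Γ) : derMap δ x ∈ operFil b Γ' := by
  refine gspan_map_mem _ (fun e c hc v hv => ?_) hx
  rw [LinearMap.rTensor_tmul]
  refine tmul_mem_gspan (e + 1) (h e c hc) ?_
  rwa [show (((e + 1 : ℕ) : ℂ)) - 1 = e by push_cast; ring]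

/-- As `f` has index `0` and constant coefficients, bracketing with it changes neither the index nor
the coefficient. -/
theorem lie_prinNilK_mem {Γ : ℕ → Submodule ℂ K} {x : K ⊗[ℂ] L} (hx : x ∈ gaugeFil b Γ) :
    ⁅x, prinNilK b K⁆ ∈ operFil b Γ := by
  have hf : prinNilK b K ∈ operFil b (fun e => if e = 0 then (ℂ ∙ (1 : K)) else ⊥) := by
    refine tmul_mem_gspan 0 ?_ ?_
    · simp
    · simpa using prinNil_mem_wt b
  refine lie_mem_operFil ?_ hx hf
  intro a c hc a' c' hc'
  dsimp only at hc'
  split_ifs at hc' with h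
  · subst h
    obtain ⟨t, rfl⟩ := Submodule.mem_span_singleton.mp hc'
    rw [mul_smul_comm, mul_one]
    exact Submodule.smul_mem _ _ hc
  · rw [(Submodule.mem_bot ℂ).mp hc', mul_zero]
    exact zero_mem _

theorem wt_eq_bot [FiniteDimensional ℂ L] {e : ℕ} (h : coxeterNumber b + 1 ≤ e) : wt b
    ((e : ℂ) - 1) = ⊥ := by
  obtain ⟨k, rfl⟩ : ∃ k, e = k + 1 := ⟨e - 1, by omega⟩
  have := grade_eq_bot b (by omega : coxeterNumber b ≤ k)
  rwa [grade_eq_wt, show (k : ℂ) = ((k + 1 : ℕ) : ℂ) - 1 by push_cast; ring] at this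

/-- Once the threshold has passed the top degree, only the `S` part is left. This is what terminates
the inductions on the threshold. -/
theorem gaugeFil_mix_le [FiniteDimensional ℂ L] {d : ℕ} (hd : coxeterNumber b ≤ d)
    (S B : ℕ → Submodule ℂ K) :
    gaugeFil b (mix d S B) ≤ gaugeFil b (pos S) := by
  refine gspan_le fun e c hc v hv => ?_
  obtain ⟨h0, h1, -⟩ := mem_mix.mp hc
  by_cases he : e < d
  · exact tmul_mem_gspan e (mem_pos.mpr ⟨h0, fun h => h1 h he⟩) hv
  · rw [grade_eq_bot b (by omega), Submodule.mem_bot] at hv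
    rw [hv, TensorProduct.tmul_zero]
    exact zero_mem _

theorem operFil_mix_le [FiniteDimensional ℂ L] {d : ℕ} (hd : coxeterNumber b + 1 ≤ d)
    (S B : ℕ → Submodule ℂ K) :
    operFil b (mix d S B) ≤ operFil b (pos S) := by
  refine gspan_le fun e c hc v hv => ?_
  obtain ⟨h0, h1, -⟩ := mem_mix.mp hc
  by_cases he : e < d
  · exact tmul_mem_gspan e (mem_pos.mpr ⟨h0, fun h => h1 h he⟩) hv
  · rw [wt_eq_bot (by omega), Submodule.mem_bot] at hv
    rw [hv, TensorProduct.tmul_zero]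
    exact zero_mem _

theorem operFil_pos_bot : operFil b (pos (⊥ : ℕ → Submodule ℂ K)) = ⊥ := by
  rw [eq_bot_iff]
  refine gspan_le fun e c hc v _ => ?_
  have : c = 0 := by
    obtain ⟨h0, h1⟩ := mem_pos.mp hc
    by_cases he : e = 0
    · exact h0 he
    · simpa using h1 he
  rw [this, TensorProduct.zero_tmul]
  exact zero_mem _

/-! ### The truncated exponential series -/

/-- `∑_{k < M} P_k / k! - ∑_{k < M} Q_k / (k+1)!`. -/
def expSum (M : ℕ) (P Q : ℕ → K ⊗[ℂ] L) : K ⊗[ℂ] L :=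
  (∑ k ∈ Finset.range M, (k.factorial : ℂ)⁻¹ • P k) -
    ∑ k ∈ Finset.range M, ((k + 1).factorial : ℂ)⁻¹ • Q k

theorem expSum_sub (M : ℕ) (P Q P' Q' : ℕ → K ⊗[ℂ] L) :
    expSum M (fun k => P k - P' k) (fun k => Q k - Q' k) = expSum M P Q - expSum M P' Q' := by
  simp only [expSum, smul_sub, Finset.sum_sub_distrib]
  abel

theorem expSum_smul (M : ℕ) (c : ℂ) (P Q : ℕ → K ⊗[ℂ] L) :
    expSum M (fun k => c • P k) (fun k => c • Q k) = c • expSum M P Q := by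
  simp only [expSum, smul_sub, Finset.smul_sum]
  congr 1 <;> exact Finset.sum_congr rfl fun k _ => smul_comm _ _ _

/-- `(ad y)^k A`. -/
def adIter (y A : K ⊗[ℂ] L) (k : ℕ) : K ⊗[ℂ] L := ((LieAlgebra.ad K (K ⊗[ℂ] L) y) ^ k) A

theorem adIter_zero (y A : K ⊗[ℂ] L) : adIter y A 0 = A := rfl

theorem adIter_succ (y A : K ⊗[ℂ] L) (k : ℕ) : adIter y A (k + 1) = ⁅y, adIter y A k⁆ := by
  unfold adIter
  rw [pow_succ']
  rfl

theorem inv_natCast_smul (m : ℕ) (x : K ⊗[ℂ] L) : ((m : K))⁻¹ • x = ((m : ℂ))⁻¹ • x := by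
  rw [← algebraMap_smul K ((m : ℂ)⁻¹) x, map_inv₀, map_natCast]

/-- Every component of `y` has index at least one, so each bracket raises the lowest index by at
least one. This is the nilpotency of `ad y`. -/
theorem adIter_mem_mix {M0 : ℕ → Submodule ℂ K} (hm : MulLE M0 M0 M0) {y A : K ⊗[ℂ] L}
    (hy : y ∈ gaugeFil b (pos M0)) {d : ℕ} (hA : A ∈ operFil b (mix d ⊥ M0)) (k : ℕ) :
    adIter y A k ∈ operFil b (mix (d + k) ⊥ M0) := by
  induction k with
  | zero => simpa [adIter_zero] using hA
  | succ k ih =>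
    rw [adIter_succ]
    refine lie_mem_operFil ?_ hy ih
    intro a c hc a' c' hc'
    obtain ⟨h0, h1⟩ := mem_pos.mp hc
    obtain ⟨h0', h1', h2'⟩ := mem_mix.mp hc'
    by_cases ha : a = 0
    · rw [h0 ha, zero_mul]; exact zero_mem _
    by_cases ha' : a' = 0
    · rw [h0' ha', mul_zero]; exact zero_mem _
    by_cases hd : a' < d + k
    · have := h1' ha' hd
      rw [Pi.bot_apply, Submodule.mem_bot] at this
      rw [this, mul_zero]
      exact zero_mem _
    · refine mem_mix.mpr ⟨fun h => by omega, fun _ h => by omega, fun _ _ => ?_⟩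
      exact hm _ _ (h1 ha) _ _ (h2' ha' (by omega))

theorem operFil_mix_one (M0 S : ℕ → Submodule ℂ K) : operFil b (mix 1 S M0) = operFil b
    (pos M0) := by
  congr 1
  funext e
  unfold mix pos
  by_cases h : e = 0
  · simp [h]
  · simp only [h, if_false]
    rw [if_neg (by omega)]

theorem gaugeFil_mix_one (M0 S : ℕ → Submodule ℂ K) :
    gaugeFil b (mix 1 S M0) = gaugeFil b (pos M0) := by
  congr 1
  funext e
  unfold mix pos
  by_cases h : e = 0
  · simp [h]
  · simp only [h, if_false]
    rw [if_neg (by omega)]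

theorem lie_mem_pos {M0 : ℕ → Submodule ℂ K} (hm : MulLE M0 M0 M0) {y A : K ⊗[ℂ] L}
    (hy : y ∈ gaugeFil b (pos M0)) (hA : A - prinNilK b K ∈ operFil b (pos M0)) :
    ⁅y, A⁆ ∈ operFil b (pos M0) := by
  rw [← sub_add_cancel A (prinNilK b K), lie_add]
  refine add_mem (lie_mem_operFil ?_ hy hA) (lie_prinNilK_mem hy)
  intro a c hc a' c' hc'
  obtain ⟨h0, h1⟩ := mem_pos.mp hc
  obtain ⟨h0', h1'⟩ := mem_pos.mp hc'
  by_cases ha : a = 0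
  · rw [h0 ha, zero_mul]; exact zero_mem _
  by_cases ha' : a' = 0
  · rw [h0' ha', mul_zero]; exact zero_mem _
  exact mem_pos.mpr ⟨fun h => by omega, fun _ => hm _ _ (h1 ha) _ _ (h1' ha')⟩

/-- The operator contains `f`, of index `0`, so the count of indices starts only after the first
bracket, at index `1`. -/
theorem adIter_succ_mem {M0 : ℕ → Submodule ℂ K} (hm : MulLE M0 M0 M0) {y A : K ⊗[ℂ] L}
    (hy : y ∈ gaugeFil b (pos M0)) (hA : A - prinNilK b K ∈ operFil b (pos M0)) (k : ℕ) :
    adIter y A (k + 1) ∈ operFil b (mix (1 + k) ⊥ M0) := by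
  have h1 : ⁅y, A⁆ ∈ operFil b (mix 1 ⊥ M0) := by
    rw [operFil_mix_one]
    exact lie_mem_pos hm hy hA
  have h2 := adIter_mem_mix hm hy h1 k
  have e : adIter y A (k + 1) = adIter y ⁅y, A⁆ k := by
    unfold adIter
    rw [pow_succ]
    rfl
  rwa [e]

theorem mix_le_pos {d : ℕ} (M0 : ℕ → Submodule ℂ K) (e : ℕ) : mix d ⊥ M0 e ≤ pos M0 e := by
  intro c hc
  obtain ⟨h0, h1, h2⟩ := mem_mix.mp hc
  refine mem_pos.mpr ⟨h0, fun he => ?_⟩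
  by_cases hd : e < d
  · have := h1 he hd
    rw [Pi.bot_apply, Submodule.mem_bot] at this
    rw [this]; exact zero_mem _
  · exact h2 he (by omega)

theorem derLE_pos {δ : Der K} {M0 : ℕ → Submodule ℂ K} (h : DerLE δ M0 M0) :
    DerLE δ (pos M0) (pos M0) := by
  intro a c hc
  obtain ⟨h0, h1⟩ := mem_pos.mp hc
  refine mem_pos.mpr ⟨fun h => by omega, fun _ => ?_⟩
  by_cases ha : a = 0
  · rw [h0 ha, map_zero]; exact zero_mem _
  · exact h _ _ (h1 ha)

theorem adIter_derMap_mem {δ : Der K} {M0 : ℕ → Submodule ℂ K} (hm : MulLE M0 M0 M0)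
    (hD : DerLE δ M0 M0) {y : K ⊗[ℂ] L} (hy : y ∈ gaugeFil b (pos M0)) (k : ℕ) :
    adIter y (derMap δ y) k ∈ operFil b (mix (1 + k) ⊥ M0) := by
  refine adIter_mem_mix hm hy ?_ k
  rw [operFil_mix_one]
  exact derMap_mem (derLE_pos hD) hy

theorem mulLE_top : MulLE (⊤ : ℕ → Submodule ℂ K) ⊤ ⊤ := fun _ _ _ _ _ _ => Submodule.mem_top

theorem derLE_top (δ : Der K) : DerLE δ (⊤ : ℕ → Submodule ℂ K) ⊤ :=
  fun _ _ _ => Submodule.mem_top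

theorem pos_le_pos {Γ Γ' : ℕ → Submodule ℂ K} (h : ∀ e, Γ e ≤ Γ' e) (e : ℕ) :
    pos Γ e ≤ pos Γ' e := by
  intro c hc
  rw [mem_pos] at hc ⊢
  exact ⟨hc.1, fun he => h e (hc.2 he)⟩

/-- The largest possible index of a nonzero operator component is `coxeterNumber b`, so all iterates
of order at least `coxeterNumber b + 1` vanish and both series are finite sums with a common bound.
-/
theorem gaugeAct_eq_expSum [FiniteDimensional ℂ L] (δ : Der K) {y A : K ⊗[ℂ] L}
    (hy : y ∈ gaugeFil b (pos (⊤ : ℕ → Submodule ℂ K)))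
    (hA : A - prinNilK b K ∈ operFil b (pos (⊤ : ℕ → Submodule ℂ K))) :
    gaugeAct δ y A =
      expSum (coxeterNumber b + 1) (adIter y A) (adIter y (derMap δ y)) := by
  have hvan : ∀ {d : ℕ} {x : K ⊗[ℂ] L}, coxeterNumber b + 1 ≤ d →
      x ∈ operFil b (mix d ⊥ (⊤ : ℕ → Submodule ℂ K)) → x = 0 := by
    intro d x hd hx
    have := operFil_mix_le hd _ _ hx
    rwa [operFil_pos_bot, Submodule.mem_bot] at this
  unfold gaugeAct expSum
  congr 1
  · rw [finsum_eq_finsetSum_of_support_subset (s := Finset.range (coxeterNumber b + 1))]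
    · exact Finset.sum_congr rfl fun k _ => inv_natCast_smul _ _
    · intro k hk
      by_contra hk'
      rw [Finset.coe_range, Set.mem_Iio, not_lt] at hk'
      obtain ⟨j, rfl⟩ : ∃ j, k = j + 1 := ⟨k - 1, by omega⟩
      have : adIter y A (j + 1) = 0 := hvan (by omega) (adIter_succ_mem mulLE_top hy hA j)
      exact hk (by
        dsimp only
        rw [show ((LieAlgebra.ad K (K ⊗[ℂ] L) y) ^ (j + 1)) A = 0 from this, smul_zero])
  · rw [finsum_eq_finsetSum_of_support_subset (s := Finset.range (coxeterNumber b + 1))]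
    · exact Finset.sum_congr rfl fun k _ => inv_natCast_smul _ _
    · intro k hk
      by_contra hk'
      rw [Finset.coe_range, Set.mem_Iio, not_lt] at hk'
      have : adIter y (derMap δ y) k = 0 :=
        hvan (by omega) (adIter_derMap_mem mulLE_top (derLE_top δ) hy k)
      exact hk (by
        dsimp only
        rw [show ((LieAlgebra.ad K (K ⊗[ℂ] L) y) ^ k) (δ.toLinearMap.rTensor L y) = 0 from this,
          smul_zero])

/-! ### Comparison of gauge transformations -/

/-- The families of coefficients between which two gauge transformations are compared. -/
structure Comparison (δ : Der K) (M0 B S : ℕ → Submodule ℂ K) : Prop where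
  mul_base : MulLE M0 M0 M0
  der_base : DerLE δ M0 M0
  mul_big : MulLE M0 B B
  mul_small : MulLE M0 S S
  der_big : DerLE δ B B
  der_small : DerLE δ S S
  le : ∀ e, S e ≤ B e

variable {δ : Der K} {M0 B S : ℕ → Submodule ℂ K}

/-- The factor from `pos M0` has index at least one, so a product of index below `d + 1` has its
other factor in the range where it is already known to lie in `S`. -/
theorem Comparison.mulLE_mix (h : Comparison δ M0 B S) (d : ℕ) :
    MulLE (pos M0) (mix d S B) (mix (d + 1) S B) := by
  intro a c hc a' c' hc'
  obtain ⟨h0, h1⟩ := mem_pos.mp hc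
  obtain ⟨h0', h1', h2'⟩ := mem_mix.mp hc'
  by_cases ha : a = 0
  · rw [h0 ha, zero_mul]; exact zero_mem _
  by_cases ha' : a' = 0
  · rw [h0' ha', mul_zero]; exact zero_mem _
  refine mem_mix.mpr ⟨fun h => by omega, fun _ hd => ?_, fun _ hd => ?_⟩
  · exact h.mul_small _ _ (h1 ha) _ _ (h1' ha' (by omega))
  · by_cases hd' : a' < d
    · exact h.le _ (h.mul_small _ _ (h1 ha) _ _ (h1' ha' hd'))
    · exact h.mul_big _ _ (h1 ha) _ _ (h2' ha' (by omega))

theorem MulLE.symm {Γ Γ' Γ'' : ℕ → Submodule ℂ K} (h : MulLE Γ Γ' Γ'') : MulLE Γ' Γ Γ'' := by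
  intro a c hc a' c' hc'
  rw [mul_comm, add_comm]
  exact h _ _ hc' _ _ hc

theorem Comparison.derLE_mix (h : Comparison δ M0 B S) (d : ℕ) :
    DerLE δ (mix d S B) (mix (d + 1) S B) := by
  intro a c hc
  obtain ⟨h0, h1, h2⟩ := mem_mix.mp hc
  by_cases ha : a = 0
  · rw [h0 ha, map_zero]; exact zero_mem _
  refine mem_mix.mpr ⟨fun h => by omega, fun _ hd => ?_, fun _ hd => ?_⟩
  · exact h.der_small _ _ (h1 ha (by omega))
  · exact h.der_big _ _ (h2 ha (by omega))

theorem Comparison.pos_le_mix (h : Comparison δ M0 B S) (d e : ℕ) : pos S e ≤ mix d S B e := by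
  intro c hc
  obtain ⟨h0, h1⟩ := mem_pos.mp hc
  exact mem_mix.mpr ⟨h0, fun he _ => h1 he, fun he _ => h.le _ (h1 he)⟩

theorem Comparison.mix_succ_le (h : Comparison δ M0 B S) (d e : ℕ) :
    mix (d + 1) S B e ≤ mix d S B e := by
  intro c hc
  obtain ⟨h0, h1, h2⟩ := mem_mix.mp hc
  refine mem_mix.mpr ⟨h0, fun he hd => h1 he (by omega), fun he hd => ?_⟩
  by_cases hd' : e < d + 1
  · exact h.le _ (h1 he hd')
  · exact h2 he (by omega)

variable (b) in
/-- `Z`, `R` are, up to `S`, the first-order variations of the sequences `P`, `Q` of iterated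
brackets with `y` when `y` is varied by `ζ`. -/
structure Variation (δ : Der K) (M0 S : ℕ → Submodule ℂ K) (y ζ : K ⊗[ℂ] L)
    (P Q Z R : ℕ → K ⊗[ℂ] L) : Prop where
  gauge_mem : y ∈ gaugeFil b (pos M0)
  P_zero : P 0 - prinNilK b K ∈ operFil b (pos M0)
  P_succ : ∀ k, P (k + 1) ∈ operFil b (pos M0)
  Q_mem : ∀ k, Q k ∈ operFil b (pos M0)
  Z_zero : Z 0 ∈ operFil b (pos S)
  Z_succ : ∀ k, Z (k + 1) - (⁅y, Z k⁆ + ⁅ζ, P k⁆) ∈ operFil b (pos S)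
  R_zero : R 0 - derMap δ ζ ∈ operFil b (pos S)
  R_succ : ∀ k, R (k + 1) - (⁅y, R k⁆ + ⁅ζ, Q k⁆) ∈ operFil b (pos S)

/-- The only contribution of `ζ` that does not gain an index is its bracket with the `f` in `P 0`.
Everything else involves a derivative or a bracket with a term of positive index, and so lies in `S`
up to one degree more. -/
theorem Variation.step (h : Comparison δ M0 B S) {y ζ : K ⊗[ℂ] L} {P Q Z R : ℕ → K ⊗[ℂ] L}
    (hv : Variation b δ M0 S y ζ P Q Z R) {d : ℕ} (hζ : ζ ∈ gaugeFil b (mix d S B)) {M : ℕ}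
    (hM : 2 ≤ M) : expSum M Z R - ⁅ζ, prinNilK b K⁆ ∈ operFil b (mix (d + 1) S B) := by
  have hS : operFil b (pos S) ≤ operFil b (mix (d + 1) S B) := operFil_mono (h.pos_le_mix _)
  have hmix : operFil b (mix (d + 1) S B) ≤ operFil b (mix d S B) := operFil_mono (h.mix_succ_le _)
  have br1 : ∀ x ∈ operFil b (mix d S B), ⁅y, x⁆ ∈ operFil b (mix (d + 1) S B) := fun x hx =>
    lie_mem_operFil (h.mulLE_mix d) hv.gauge_mem hx
  have br2 : ∀ x ∈ operFil b (pos M0), ⁅ζ, x⁆ ∈ operFil b (mix (d + 1) S B) := fun x hx =>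
    lie_mem_operFil (h.mulLE_mix d).symm hζ hx
  have hR : ∀ k, R k ∈ operFil b (mix (d + 1) S B) := by
    intro k
    induction k with
    | zero =>
      rw [← sub_add_cancel (R 0) (derMap δ ζ)]
      exact add_mem (hS hv.R_zero) (derMap_mem (h.derLE_mix d) hζ)
    | succ k ih =>
      rw [← sub_add_cancel (R (k + 1)) (⁅y, R k⁆ + ⁅ζ, Q k⁆)]
      exact add_mem (hS (hv.R_succ k)) (add_mem (br1 _ (hmix ih)) (br2 _ (hv.Q_mem k)))
  -- The term `[ζ, f]` enters here only: `P 0` is `f` plus components of positive index, while the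
  -- later `P k` have no component of index `0`.
  have hZ1 : Z 1 - ⁅ζ, prinNilK b K⁆ ∈ operFil b (mix (d + 1) S B) := by
    have e : Z 1 - ⁅ζ, prinNilK b K⁆ = (Z 1 - (⁅y, Z 0⁆ + ⁅ζ, P 0⁆)) +
        (⁅y, Z 0⁆ + ⁅ζ, P 0 - prinNilK b K⁆) := by
      rw [lie_sub]; abel
    rw [e]
    exact add_mem (hS (hv.Z_succ 0)) (add_mem (br1 _ (hmix (hS hv.Z_zero))) (br2 _ hv.P_zero))
  have hZ1' : Z 1 ∈ operFil b (mix d S B) := by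
    rw [← sub_add_cancel (Z 1) ⁅ζ, prinNilK b K⁆]
    exact add_mem (hmix hZ1) (lie_prinNilK_mem hζ)
  have hZ : ∀ k, Z (k + 2) ∈ operFil b (mix (d + 1) S B) := by
    intro k
    induction k with
    | zero =>
      rw [← sub_add_cancel (Z (0 + 2)) (⁅y, Z 1⁆ + ⁅ζ, P 1⁆)]
      exact add_mem (hS (hv.Z_succ 1)) (add_mem (br1 _ hZ1') (br2 _ (hv.P_succ 0)))
    | succ k ih =>
      rw [← sub_add_cancel (Z (k + 1 + 2)) (⁅y, Z (k + 2)⁆ + ⁅ζ, P (k + 2)⁆)]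
      exact add_mem (hS (hv.Z_succ (k + 2)))
        (add_mem (br1 _ (hmix ih)) (br2 _ (hv.P_succ (k + 1))))
  obtain ⟨m, rfl⟩ : ∃ m, M = m + 2 := ⟨M - 2, by omega⟩
  unfold expSum
  rw [Finset.sum_range_succ', Finset.sum_range_succ']
  have e : ∀ a c z1 z0 r : K ⊗[ℂ] L, a + z1 + z0 - r - c = a + (z1 - c) + z0 - r := by
    intros; abel
  rw [e]
  refine sub_mem (add_mem (add_mem ?_ ?_) ?_) ?_
  · exact Submodule.sum_mem _ fun k _ => Submodule.smul_mem _ _ (hZ k)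
  · simpa using hZ1
  · exact Submodule.smul_mem _ _ (hS hv.Z_zero)
  · exact Submodule.sum_mem _ fun k _ => Submodule.smul_mem _ _ (hR k)

section Homotopy

variable {s : Submodule ℂ L} {Ψ : L →ₗ[ℂ] L}

theorem IsHomotopy.lTensor_mem (hΨ : IsHomotopy b s Ψ) {Γ : ℕ → Submodule ℂ K} (h0 : Γ 0 = ⊥)
    {x : K ⊗[ℂ] L} (hx : x ∈ operFil b Γ) : Ψ.lTensor K x ∈ gaugeFil b Γ := by
  refine gspan_map_mem _ (fun e c hc v hv => ?_) hx
  rw [LinearMap.lTensor_tmul]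
  rcases e with _ | e
  · rw [h0, Submodule.mem_bot] at hc
    rw [hc, TensorProduct.zero_tmul]; exact zero_mem _
  · refine tmul_mem_gspan (e + 1) hc (hΨ.2.2.1 e v ?_)
    rwa [show (((e + 1 : ℕ) : ℂ)) - 1 = e by push_cast; ring] at hv

theorem IsHomotopy.lTensor_baseChange (hΨ : IsHomotopy b s Ψ) {x : K ⊗[ℂ] L}
    (hx : x ∈ s.baseChange K) : Ψ.lTensor K x = 0 := by
  have h : s.baseChange K ≤ LinearMap.ker (Ψ.baseChange K) := by
    rw [Submodule.baseChange_eq_span, Submodule.span_le]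
    rintro _ ⟨v, hv, rfl⟩
    simp [hΨ.2.1 v hv]
  exact h hx

theorem IsHomotopy.lTensor_lie (hΨ : IsHomotopy b s Ψ) {Γ : ℕ → Submodule ℂ K}
    {x : K ⊗[ℂ] L} (hx : x ∈ gaugeFil b (pos Γ)) : Ψ.lTensor K ⁅prinNilK b K, x⁆ = x := by
  unfold gaugeFil gspan at hx
  induction hx using Submodule.span_induction with
  | mem x hx =>
    obtain ⟨e, c, hc, v, hv, rfl⟩ := hx
    rw [LieAlgebra.ExtendScalars.bracket_tmul, one_mul, LinearMap.lTensor_tmul]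
    rcases e with _ | e
    · rw [(mem_pos.mp hc).1 rfl, TensorProduct.zero_tmul, TensorProduct.zero_tmul]
    · rw [hΨ.1 v (grade_succ_le_nPlus b e hv)]
  | zero => simp
  | add u v _ _ hu hv => rw [lie_add, map_add, hu, hv]
  | smul t u _ hu => rw [lie_smul_tensor, map_smul, hu]

/-- Applying `Ψ` to `Variation.step` kills the total variation, which lies in `𝔰(K)`, and turns `[ζ,
f]` into `-ζ`. Hence `ζ` lies in `S` in one more degree, and iterating exhausts all degrees. -/
theorem Variation.rigid [FiniteDimensional ℂ L] (hΨ : IsHomotopy b s Ψ) (h : Comparison δ M0 B S)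
    {y ζ : K ⊗[ℂ] L}
    {P Q Z R : ℕ → K ⊗[ℂ] L} (hv : Variation b δ M0 S y ζ P Q Z R)
    (hζ : ζ ∈ gaugeFil b (pos B)) {M : ℕ} (hM : 2 ≤ M) (hσ : expSum M Z R ∈ s.baseChange K) :
    ζ ∈ gaugeFil b (pos S) ∧ expSum M Z R ∈ operFil b (pos S) := by
  have key : ∀ d : ℕ, ζ ∈ gaugeFil b (mix (d + 1) S B) := by
    intro d
    induction d with
    | zero => rwa [zero_add, gaugeFil_mix_one]
    | succ d ih =>
      have h1 := hv.step h ih hM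
      have h2 := hΨ.lTensor_mem (Γ := mix (d + 1 + 1) S B) (by simp [mix]) h1
      rw [map_sub, hΨ.lTensor_baseChange hσ, ← lie_skew, map_neg, hΨ.lTensor_lie hζ] at h2
      simpa using h2
  have hζ' : ζ ∈ gaugeFil b (pos S) := gaugeFil_mix_le (by omega) S B (key (coxeterNumber b))
  refine ⟨hζ', ?_⟩
  have h1 := operFil_mix_le (by omega) S B (hv.step h (key (coxeterNumber b)) hM)
  have := add_mem h1 (lie_prinNilK_mem hζ')
  rwa [sub_add_cancel] at this

/-- A solution of the gauge fixing problem whose data have coefficients in the family `M0`. -/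
structure Solution (b : LieAlgebra.Basis (Fin n) H) (s : Submodule ℂ L) (δ : Der K)
    (M0 : ℕ → Submodule ℂ K) (y A T : K ⊗[ℂ] L) : Prop where
  gauge_mem : y ∈ gaugeFil b (pos M0)
  oper_mem : A - prinNilK b K ∈ operFil b (pos M0)
  canonical : T - prinNilK b K ∈ s.baseChange K
  act : gaugeAct δ y A = T

theorem two_le_coxeter : 2 ≤ coxeterNumber b + 1 := by
  unfold coxeterNumber
  omega

theorem Solution.eq_expSum [FiniteDimensional ℂ L] {y A T : K ⊗[ℂ] L}
    (h : Solution b s δ M0 y A T) :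
    T = expSum (coxeterNumber b + 1) (adIter y A) (adIter y (derMap δ y)) := by
  rw [← h.act]
  exact gaugeAct_eq_expSum δ (gaugeFil_mono (pos_le_pos fun _ => le_top) h.gauge_mem)
    (operFil_mono (pos_le_pos fun _ => le_top) h.oper_mem)

/-- From `[y, p] - [y', p'] = [y, p - p'] + [y - y', p']`, differences of iterated brackets satisfy
the recursion exactly, with no error term. -/
theorem variation_diff (h : Comparison δ M0 B S) {y A y' A' : K ⊗[ℂ] L}
    (hy : y ∈ gaugeFil b (pos M0)) (hy' : y' ∈ gaugeFil b (pos M0))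
    (hA' : A' - prinNilK b K ∈ operFil b (pos M0))
    (hAA : A - A' ∈ operFil b (pos S)) :
    Variation b δ M0 S y (y - y') (adIter y' A') (adIter y' (derMap δ y'))
      (fun k => adIter y A k - adIter y' A' k)
      (fun k => adIter y (derMap δ y) k - adIter y' (derMap δ y') k) where
  gauge_mem := hy
  P_zero := hA'
  P_succ k := operFil_mono (mix_le_pos M0) (adIter_succ_mem h.mul_base hy' hA' k)
  Q_mem k := operFil_mono (mix_le_pos M0) (adIter_derMap_mem h.mul_base h.der_base hy' k)
  Z_zero := hAA
  Z_succ k := by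
    rw [adIter_succ, adIter_succ, lie_sub, sub_lie]
    rw [show ∀ p q r : K ⊗[ℂ] L, p - q - (p - r + (r - q)) = 0 by intros; abel]
    exact zero_mem _
  R_zero := by
    simp only [adIter_zero, map_sub, sub_self]
    exact zero_mem _
  R_succ k := by
    rw [adIter_succ, adIter_succ, lie_sub, sub_lie]
    rw [show ∀ p q r : K ⊗[ℂ] L, p - q - (p - r + (r - q)) = 0 by intros; abel]
    exact zero_mem _

/-- Gauge fixing does not lower the precision to which two operators agree. Taking `S = 0` gives
uniqueness; taking `S` to be a weight filtration gives the triangularity of the maps. -/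
theorem Solution.sub_mem [FiniteDimensional ℂ L] (hΨ : IsHomotopy b s Ψ) (h : Comparison δ M0 M0 S)
    {y A T y' A' T' : K ⊗[ℂ] L} (h1 : Solution b s δ M0 y A T) (h2 : Solution b s δ M0 y' A' T')
    (hAA : A - A' ∈ operFil b (pos S)) :
    y - y' ∈ gaugeFil b (pos S) ∧ T - T' ∈ operFil b (pos S) := by
  have hv := variation_diff h h1.gauge_mem h2.gauge_mem h2.oper_mem hAA
  have e := expSum_sub (coxeterNumber b + 1) (adIter y A) (adIter y (derMap δ y))
    (adIter y' A') (adIter y' (derMap δ y'))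
  rw [← h1.eq_expSum, ← h2.eq_expSum] at e
  have := hv.rigid hΨ h (Submodule.sub_mem _ h1.gauge_mem h2.gauge_mem) two_le_coxeter (by
    rw [e]
    have := Submodule.sub_mem _ h1.canonical h2.canonical
    rwa [sub_sub_sub_cancel_right] at this)
  rwa [e] at this

theorem comparison_bot (hm : MulLE M0 M0 M0) (hD : DerLE δ M0 M0) : Comparison δ M0 M0 ⊥ where
  mul_base := hm
  der_base := hD
  mul_big := hm
  der_big := hD
  mul_small a c _ a' c' hc' := by
    rw [Pi.bot_apply, Submodule.mem_bot] at hc'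
    rw [hc', mul_zero]; exact zero_mem _
  der_small a c hc := by
    rw [Pi.bot_apply, Submodule.mem_bot] at hc
    rw [hc, map_zero]; exact zero_mem _
  le _ := bot_le

theorem Solution.unique [FiniteDimensional ℂ L] (hΨ : IsHomotopy b s Ψ) {y A T y' T' : K ⊗[ℂ] L}
    (h1 : Solution b s δ ⊤ y A T) (h2 : Solution b s δ ⊤ y' A T') : T = T' := by
  have := (h1.sub_mem hΨ (comparison_bot mulLE_top (derLE_top δ)) h2
    (by rw [sub_self]; exact zero_mem _)).2
  rw [operFil_pos_bot, Submodule.mem_bot] at this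
  exact sub_eq_zero.mp this

theorem Solution.mono {M0' : ℕ → Submodule ℂ K} (h : ∀ e, M0 e ≤ M0' e) {y A T : K ⊗[ℂ] L}
    (h1 : Solution b s δ M0 y A T) : Solution b s δ M0' y A T :=
  ⟨gaugeFil_mono (pos_le_pos h) h1.gauge_mem, operFil_mono (pos_le_pos h) h1.oper_mem,
    h1.canonical, h1.act⟩

/-- Existence of the canonical form, with control of the coefficients. -/
theorem exists_solution [FiniteDimensional ℂ L] (hΨ : IsHomotopy b s Ψ) (hm : MulLE M0 M0 M0)
    (hD : DerLE δ M0 M0)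
    {A : K ⊗[ℂ] L} (hA : A - prinNilK b K ∈ operFil b (pos M0)) :
    ∃ y T, Solution b s δ M0 y A T ∧
      T - prinNilK b K ∈ gspan (fun e => M0 (e + 1)) (sGrade b s) := by
  have hS : gspan (fun e => M0 (e + 1)) (sGrade b s) ≤ (s.baseChange K).restrictScalars ℂ :=
    gspan_le fun e c _ v hv => Submodule.tmul_mem_baseChange_of_mem c hv.1
  have hcmp := comparison_bot hm hD
  -- Successive approximation: the error left after subtracting `f` and the part `σ` already in `𝔰`
  -- is pushed to indices above `d`. The start is `y = 0`, `σ = 0`, where the error `A - f` has only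
  -- positive indices.
  have key : ∀ d : ℕ, ∃ y ∈ gaugeFil b (pos M0),
      ∃ σ ∈ gspan (fun e => M0 (e + 1)) (sGrade b s),
      expSum (coxeterNumber b + 1) (adIter y A) (adIter y (derMap δ y)) - prinNilK b K - σ ∈
        operFil b (mix (d + 1) ⊥ M0) := by
    intro d
    induction d with
    | zero =>
      refine ⟨0, zero_mem _, 0, zero_mem _, ?_⟩
      have e0 : ∀ X : K ⊗[ℂ] L, ∀ k, adIter 0 X (k + 1) = 0 := fun X k => by
        rw [adIter_succ, zero_lie]
      have e : expSum (coxeterNumber b + 1) (adIter 0 A) (adIter 0 (derMap δ (0 : K ⊗[ℂ] L))) =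
        A := by
        unfold expSum
        rw [Finset.sum_range_succ', Finset.sum_range_succ']
        simp [e0, adIter_zero]
      rwa [e, sub_zero, zero_add, operFil_mix_one]
    | succ d ih =>
      obtain ⟨y, hy, σ, hσ, hw⟩ := ih
      set w := expSum (coxeterNumber b + 1) (adIter y A) (adIter y (derMap δ y)) -
        prinNilK b K - σ with hwdef
      -- Adding `η` to the gauge parameter changes the result by `[η, f] = -[f, Ψ w]` up to higher
      -- index. The part of the error in the image of `ad f` is thereby cancelled.
      set η := Ψ.lTensor K w with hη
      have hηm : η ∈ gaugeFil b (mix (d + 1) ⊥ M0) := hΨ.lTensor_mem (by simp [mix]) hw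
      have hηp : η ∈ gaugeFil b (pos M0) := gaugeFil_mono (mix_le_pos M0) hηm
      have hy' : y + η ∈ gaugeFil b (pos M0) := add_mem hy hηp
      have hv := variation_diff (A := A) hcmp hy' hy hA (by rw [sub_self]; exact zero_mem _)
      rw [add_sub_cancel_left] at hv
      have hstep := hv.step hcmp hηm (two_le_coxeter (b := b))
      rw [expSum_sub] at hstep
      -- What `Ψ` cannot remove lies in `𝔰`, degree by degree and with the same coefficients. It is
      -- absorbed into `σ`.
      have hres : w - ⁅prinNilK b K, η⁆ ∈ gspan (fun e => M0 (e + 1)) (sGrade b s) := by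
        have hlin : ∀ x ∈ operFil b (pos M0), x - ⁅prinNilK b K, Ψ.lTensor K x⁆ ∈
            gspan (fun e => M0 (e + 1)) (sGrade b s) := by
          intro x hx
          unfold operFil gspan at hx
          induction hx using Submodule.span_induction with
          | mem x hx =>
            obtain ⟨e, c, hc, v, hv, rfl⟩ := hx
            rw [LinearMap.lTensor_tmul, LieAlgebra.ExtendScalars.bracket_tmul, one_mul,
              ← TensorProduct.tmul_sub]
            rcases e with _ | e
            · rw [(mem_pos.mp hc).1 rfl, TensorProduct.zero_tmul]; exact zero_mem _
            · refine tmul_mem_gspan e ((mem_pos.mp hc).2 (Nat.succ_ne_zero e)) (hΨ.2.2.2 e v ?_)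
              dsimp only at hv
              rwa [show (((e + 1 : ℕ) : ℂ)) - 1 = e by push_cast; ring] at hv
          | zero => simp
          | add u v _ _ hu hv =>
            rw [map_add, lie_add, add_sub_add_comm]; exact add_mem hu hv
          | smul t u _ hu =>
            rw [map_smul, lie_smul_tensor, ← smul_sub]; exact Submodule.smul_mem _ _ hu
        exact hlin w (operFil_mono (mix_le_pos M0) hw)
      refine ⟨y + η, hy', σ + (w - ⁅prinNilK b K, η⁆), add_mem hσ hres, ?_⟩
      convert hstep using 1
      rw [← lie_skew η, hwdef]
      abel
  obtain ⟨y, hy, σ, hσ, hw⟩ := key (coxeterNumber b)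
  have h0 := operFil_mix_le (le_refl _) _ _ hw
  rw [operFil_pos_bot, Submodule.mem_bot, sub_eq_zero] at h0
  rw [← gaugeAct_eq_expSum δ (gaugeFil_mono (pos_le_pos fun _ => le_top) hy)
    (operFil_mono (pos_le_pos fun _ => le_top) hA)] at h0
  exact ⟨y, _, ⟨hy, hA, by rw [h0]; exact hS hσ, rfl⟩, by rw [h0]; exact hσ⟩

/-- If two pairs of operators have proportional differences up to `S`, then so do their canonical
forms. -/
theorem Solution.sub_smul_sub_mem [FiniteDimensional ℂ L] (hΨ : IsHomotopy b s Ψ)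
    {B1 Bl : ℕ → Submodule ℂ K}
    (h1 : Comparison δ M0 M0 B1) (hl : Comparison δ M0 M0 Bl) (hS : Comparison δ M0 Bl S)
    (h1l : MulLE B1 Bl S) (hl1 : ∀ e, Bl e ≤ B1 e) {y A T : Fin 4 → K ⊗[ℂ] L}
    (h : ∀ i, Solution b s δ M0 (y i) (A i) (T i))
    (h01 : A 0 - A 1 ∈ operFil b (pos Bl)) (h23 : A 2 - A 3 ∈ operFil b (pos Bl))
    (h02 : A 0 - A 2 ∈ operFil b (pos B1)) (c : ℂ)
    (hc : A 0 - A 1 - c • (A 2 - A 3) ∈ operFil b (pos S)) :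
    T 0 - T 1 - c • (T 2 - T 3) ∈ operFil b (pos S) := by
  have y01 := ((h 0).sub_mem hΨ hl (h 1) h01).1
  have y23 := ((h 2).sub_mem hΨ hl (h 3) h23).1
  have y02 := ((h 0).sub_mem hΨ h1 (h 2) h02).1
  have h13 : A 1 - A 3 ∈ operFil b (pos B1) := by
    have e : A 1 - A 3 = A 0 - A 2 - (A 0 - A 1) + (A 2 - A 3) := by abel
    rw [e]
    exact add_mem (Submodule.sub_mem _ h02 (operFil_mono (pos_le_pos hl1) h01))
      (operFil_mono (pos_le_pos hl1) h23)
  have y13 := ((h 1).sub_mem hΨ h1 (h 3) h13).1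
  have posmul : ∀ {Γ Γ' Γ'' : ℕ → Submodule ℂ K}, MulLE Γ Γ' Γ'' →
      MulLE (pos Γ) (pos Γ') (pos Γ'') := by
    intro Γ Γ' Γ'' hm a x hx a' x' hx'
    obtain ⟨g0, g1⟩ := mem_pos.mp hx
    obtain ⟨g0', g1'⟩ := mem_pos.mp hx'
    by_cases ha : a = 0
    · rw [g0 ha, zero_mul]; exact zero_mem _
    by_cases ha' : a' = 0
    · rw [g0' ha', mul_zero]; exact zero_mem _
    exact mem_pos.mpr ⟨fun h => by omega, fun _ => hm _ _ (g1 ha) _ _ (g1' ha')⟩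
  have dmem : ∀ {Γ : ℕ → Submodule ℂ K} {i j : Fin 4}, Comparison δ M0 M0 Γ →
      A i - A j ∈ operFil b (pos Γ) → y i - y j ∈ gaugeFil b (pos Γ) →
      ∀ k, adIter (y i) (A i) k - adIter (y j) (A j) k ∈ operFil b (pos Γ) := by
    intro Γ i j hΓ hA hy k
    induction k with
    | zero => exact hA
    | succ k ih =>
      rw [adIter_succ, adIter_succ]
      have e : ⁅y i, adIter (y i) (A i) k⁆ - ⁅y j, adIter (y j) (A j) k⁆ =
          ⁅y i, adIter (y i) (A i) k - adIter (y j) (A j) k⁆ +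
            ⁅y i - y j, adIter (y j) (A j) k⁆ := by
        rw [lie_sub, sub_lie]; abel
      rw [e]
      refine add_mem (lie_mem_operFil (posmul hΓ.mul_small) (h i).gauge_mem ih) ?_
      -- The iterate of order zero is treated apart because it contains `f`, which does not belong
      -- to the family of positive indices.
      rcases k with _ | k
      · rw [adIter_zero, ← sub_add_cancel (A j) (prinNilK b K), lie_add]
        exact add_mem (lie_mem_operFil (posmul hΓ.mul_small.symm) hy (h j).oper_mem)
          (lie_prinNilK_mem hy)
      · exact lie_mem_operFil (posmul hΓ.mul_small.symm) hy
          (operFil_mono (mix_le_pos M0) (adIter_succ_mem hΓ.mul_base (h j).gauge_mem (h j).oper_mem k))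
  have emem : ∀ {Γ : ℕ → Submodule ℂ K} {i j : Fin 4}, Comparison δ M0 M0 Γ →
      y i - y j ∈ gaugeFil b (pos Γ) →
      ∀ k, adIter (y i) (derMap δ (y i)) k - adIter (y j) (derMap δ (y j)) k ∈
        operFil b (pos Γ) := by
    intro Γ i j hΓ hy k
    induction k with
    | zero =>
      rw [adIter_zero, adIter_zero, ← map_sub]
      exact derMap_mem (derLE_pos hΓ.der_small) hy
    | succ k ih =>
      rw [adIter_succ, adIter_succ]
      have e : ⁅y i, adIter (y i) (derMap δ (y i)) k⁆ - ⁅y j, adIter (y j) (derMap δ (y j)) k⁆ =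
          ⁅y i, adIter (y i) (derMap δ (y i)) k - adIter (y j) (derMap δ (y j)) k⁆ +
            ⁅y i - y j, adIter (y j) (derMap δ (y j)) k⁆ := by
        rw [lie_sub, sub_lie]; abel
      rw [e]
      exact add_mem (lie_mem_operFil (posmul hΓ.mul_small) (h i).gauge_mem ih)
        (lie_mem_operFil (posmul hΓ.mul_small.symm) hy (operFil_mono (mix_le_pos M0)
          (adIter_derMap_mem hΓ.mul_base hΓ.der_base (h j).gauge_mem k)))
  -- The second difference obeys the recursion of a first variation up to products of a difference
  -- between the two pairs and a difference within a pair. With the former in `B1` and the latter in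
  -- `Bl`, these products lie in `S`.
  have ident : ∀ p0 p1 p2 p3 : K ⊗[ℂ] L,
      ⁅y 0, p0⁆ - ⁅y 1, p1⁆ - c • (⁅y 2, p2⁆ - ⁅y 3, p3⁆) -
        (⁅y 0, p0 - p1 - c • (p2 - p3)⁆ + ⁅y 0 - y 1 - c • (y 2 - y 3), p1⁆) =
      c • ⁅y 0 - y 2, p2 - p3⁆ + c • ⁅y 2 - y 3, p1 - p3⁆ := by
    intro p0 p1 p2 p3
    simp only [lie_sub, sub_lie, lie_smul_tensor, smul_lie_tensor, smul_sub]
    abel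
  have hv : Variation b δ M0 S (y 0) (y 0 - y 1 - c • (y 2 - y 3)) (adIter (y 1) (A 1))
      (adIter (y 1) (derMap δ (y 1)))
      (fun k => adIter (y 0) (A 0) k - adIter (y 1) (A 1) k -
        c • (adIter (y 2) (A 2) k - adIter (y 3) (A 3) k))
      (fun k => adIter (y 0) (derMap δ (y 0)) k - adIter (y 1) (derMap δ (y 1)) k -
        c • (adIter (y 2) (derMap δ (y 2)) k - adIter (y 3) (derMap δ (y 3)) k)) :=
    { gauge_mem := (h 0).gauge_mem
      P_zero := (h 1).oper_mem
      P_succ := fun k => operFil_mono (mix_le_pos M0)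
        (adIter_succ_mem hl.mul_base (h 1).gauge_mem (h 1).oper_mem k)
      Q_mem := fun k => operFil_mono (mix_le_pos M0)
        (adIter_derMap_mem hl.mul_base hl.der_base (h 1).gauge_mem k)
      Z_zero := hc
      Z_succ := fun k => by
        simp only [adIter_succ]
        rw [ident]
        exact add_mem (Submodule.smul_mem _ _
            (lie_mem_operFil (posmul h1l) y02 (dmem hl h23 y23 k)))
          (Submodule.smul_mem _ _ (lie_mem_operFil (posmul h1l.symm) y23 (dmem h1 h13 y13 k)))
      R_zero := by
        simp only [adIter_zero, map_sub, map_smul, sub_self]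
        exact zero_mem _
      R_succ := fun k => by
        simp only [adIter_succ]
        rw [ident]
        exact add_mem (Submodule.smul_mem _ _
            (lie_mem_operFil (posmul h1l) y02 (emem hl y23 k)))
          (Submodule.smul_mem _ _ (lie_mem_operFil (posmul h1l.symm) y23 (emem h1 y13 k))) }
  have e : expSum (coxeterNumber b + 1)
      (fun k => adIter (y 0) (A 0) k - adIter (y 1) (A 1) k -
        c • (adIter (y 2) (A 2) k - adIter (y 3) (A 3) k))
      (fun k => adIter (y 0) (derMap δ (y 0)) k - adIter (y 1) (derMap δ (y 1)) k -
        c • (adIter (y 2) (derMap δ (y 2)) k - adIter (y 3) (derMap δ (y 3)) k)) =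
      T 0 - T 1 - c • (T 2 - T 3) := by
    rw [(h 0).eq_expSum, (h 1).eq_expSum, (h 2).eq_expSum, (h 3).eq_expSum, ← expSum_sub,
      ← expSum_sub, ← expSum_smul, ← expSum_sub]
  have hmem : T 0 - T 1 - c • (T 2 - T 3) ∈ s.baseChange K := by
    have a1 := Submodule.sub_mem _ (h 0).canonical (h 1).canonical
    have a2 := Submodule.sub_mem _ (h 2).canonical (h 3).canonical
    rw [sub_sub_sub_cancel_right] at a1 a2
    refine Submodule.sub_mem _ a1 ?_
    rw [← algebraMap_smul K c]
    exact Submodule.smul_mem _ _ a2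
  -- The big family is now `Bl`: the second difference of gauge parameters is known to lie there,
  -- and rigidity improves it to `S`.
  have := (hv.rigid hΨ hS (Submodule.sub_mem _ y01 (Submodule.smul_mem _ c y23)) two_le_coxeter
    (by rw [e]; exact hmem)).2
  rwa [e] at this

end Homotopy

end Filtered

/-! ### Canonical forms, change of field and coefficients in `𝔰` -/

section CanonicalForms

variable {L : Type*} [LieRing L] [LieAlgebra ℂ L] {n : ℕ} {H : LieSubalgebra ℂ L}
  {b : LieAlgebra.Basis (Fin n) H} {K : Type*} [Field K] [Algebra ℂ K] {s : Submodule ℂ L}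

theorem gaugeFil_pos_le (Γ : ℕ → Submodule ℂ K) :
    gaugeFil b (pos Γ) ≤ ((nPlus b).baseChange K).restrictScalars ℂ := by
  refine gspan_le fun e c hc v hv => ?_
  rcases e with _ | e
  · rw [(mem_pos.mp hc).1 rfl, TensorProduct.zero_tmul]; exact zero_mem _
  · exact Submodule.tmul_mem_baseChange_of_mem c (grade_succ_le_nPlus b e hv)

theorem baseChange_induction {p : Submodule ℂ L} {motive : K ⊗[ℂ] L → Prop} (zero : motive 0)
    (add : ∀ x y, motive x → motive y → motive (x + y))
    (tmul : ∀ (c : K), ∀ v ∈ p, motive (c ⊗ₜ[ℂ] v)) {x : K ⊗[ℂ] L} (hx : x ∈ p.baseChange K) :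
    motive x := by
  rw [Submodule.baseChange_eq_span] at hx
  induction hx using Submodule.closure_induction with
  | zero => exact zero
  | add u v _ _ hu hv => exact add u v hu hv
  | smul_mem c x hx =>
    obtain ⟨v, hv, rfl⟩ := hx
    simpa [TensorProduct.smul_tmul'] using tmul c v hv

/-- Every gauge parameter admitted by `IsCanonicalForm` fits the coarsest family, so uniqueness
holds against all gauge transformations and not only those with controlled coefficients. -/
theorem baseChange_nPlus_le {y : K ⊗[ℂ] L} (hy : y ∈ (nPlus b).baseChange K) :
    y ∈ gaugeFil b (pos (⊤ : ℕ → Submodule ℂ K)) := by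
  have htmul : ∀ (c : K) (v : L), v ∈ nPlus b →
      c ⊗ₜ[ℂ] v ∈ gaugeFil b (pos (⊤ : ℕ → Submodule ℂ K)) := by
    intro c v hv
    rw [nPlus_eq_iSup] at hv
    induction hv using Submodule.iSup_induction' with
    | mem i v hv =>
      exact tmul_mem_gspan (i + 1)
        (mem_pos.mpr ⟨fun h => by omega, fun _ => Submodule.mem_top⟩) hv
    | zero => rw [TensorProduct.tmul_zero]; exact zero_mem _
    | add u v _ _ hu hv => rw [TensorProduct.tmul_add]; exact add_mem hu hv
  exact baseChange_induction (zero_mem _) (fun _ _ => add_mem) htmul hy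

theorem Solution.isCanonicalForm {δ : Der K} {M0 : ℕ → Submodule ℂ K} {y A T : K ⊗[ℂ] L}
    (h : Solution b s δ M0 y A T) : IsCanonicalForm b s δ A T :=
  ⟨h.canonical, y, gaugeFil_pos_le _ h.gauge_mem, h.act⟩

theorem IsCanonicalForm.exists_solution {δ : Der K} {A T : K ⊗[ℂ] L}
    (h : IsCanonicalForm b s δ A T) (hA : A - prinNilK b K ∈ operFil b (pos ⊤)) :
    ∃ y, Solution b s δ ⊤ y A T := by
  obtain ⟨hT, y, hy, hact⟩ := h
  exact ⟨y, baseChange_nPlus_le hy, hA, hT, hact⟩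

/-! ### Extension of the field of coefficients -/

section Map

variable {K' : Type*} [Field K'] [Algebra ℂ K'] (ι : K →ₐ[ℂ] K')

/-- The map `𝔤(K) → 𝔤(K')` induced by `ι : K → K'`. -/
def coeffMap (L : Type*) [LieRing L] [LieAlgebra ℂ L] : K ⊗[ℂ] L →ₗ[ℂ] K' ⊗[ℂ] L :=
  ι.toLinearMap.rTensor L

@[simp] theorem coeffMap_tmul (c : K) (v : L) : coeffMap ι L (c ⊗ₜ[ℂ] v) = ι c ⊗ₜ[ℂ] v := rfl

theorem coeffMap_lie (x y : K ⊗[ℂ] L) :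
    coeffMap ι L ⁅x, y⁆ = ⁅coeffMap ι L x, coeffMap ι L y⁆ := by
  induction x using TensorProduct.induction_on with
  | zero => simp
  | tmul k v =>
    induction y using TensorProduct.induction_on with
    | zero => simp
    | tmul k' v' => simp [LieAlgebra.ExtendScalars.bracket_tmul]
    | add x y hx hy => rw [lie_add, map_add, map_add, lie_add, hx, hy]
  | add x y hx hy => rw [add_lie, map_add, map_add, add_lie, hx, hy]

theorem coeffMap_adIter (y A : K ⊗[ℂ] L) (k : ℕ) :
    coeffMap ι L (adIter y A k) = adIter (coeffMap ι L y) (coeffMap ι L A) k := by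
  induction k with
  | zero => rfl
  | succ k ih => rw [adIter_succ, adIter_succ, coeffMap_lie, ih]

theorem coeffMap_derMap {δ : Der K} {δ' : Der K'} (hδ : ∀ c, ι (δ c) = δ' (ι c))
    (x : K ⊗[ℂ] L) : coeffMap ι L (derMap δ x) = derMap δ' (coeffMap ι L x) := by
  induction x using TensorProduct.induction_on with
  | zero => simp
  | tmul k v => simp [hδ]
  | add x y hx hy => simp only [map_add, hx, hy]

/-- The truncated series is a universal expression in brackets and derivatives, so it commutes with
an extension of differential fields. -/
theorem Solution.map [FiniteDimensional ℂ L] {δ : Der K} {δ' : Der K'}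
    (hδ : ∀ c, ι (δ c) = δ' (ι c)) {Γ : ℕ → Submodule ℂ K} {Γ' : ℕ → Submodule ℂ K'}
    (hΓ : ∀ e, ∀ c ∈ Γ e, ι c ∈ Γ' e) {y A T : K ⊗[ℂ] L} (h : Solution b s δ Γ y A T) :
    Solution b s δ' Γ' (coeffMap ι L y) (coeffMap ι L A) (coeffMap ι L T) := by
  have hpos : ∀ e, ∀ c ∈ pos Γ e, ι c ∈ pos Γ' e := fun e c hc => by
    rw [mem_pos] at hc ⊢
    exact ⟨fun he => by rw [hc.1 he, map_zero], fun he => hΓ e c (hc.2 he)⟩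
  have hf : coeffMap ι L (prinNilK b K) = prinNilK b K' := by simp
  have h1 : coeffMap ι L y ∈ gaugeFil b (pos Γ') :=
    gspan_map_mem _ (fun e c hc v hv => tmul_mem_gspan e (hpos e c hc) hv) h.gauge_mem
  have h2 : coeffMap ι L A - prinNilK b K' ∈ operFil b (pos Γ') := by
    rw [← hf, ← map_sub]
    exact gspan_map_mem _ (fun e c hc v hv => tmul_mem_gspan e (hpos e c hc) hv) h.oper_mem
  refine ⟨h1, h2, ?_, ?_⟩
  · rw [← hf, ← map_sub]
    refine baseChange_induction (motive := fun x => coeffMap ι L x ∈ s.baseChange K') ?_ ?_ ?_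
      h.canonical
    · rw [map_zero]; exact zero_mem _
    · intro u v hu hv
      rw [map_add]; exact add_mem hu hv
    · intro c v hv
      exact Submodule.tmul_mem_baseChange_of_mem (ι c) hv
  · rw [gaugeAct_eq_expSum δ' (gaugeFil_mono (pos_le_pos fun _ => le_top) h1)
      (operFil_mono (pos_le_pos fun _ => le_top) h2), h.eq_expSum]
    simp only [expSum, map_sub, map_sum, map_smul, coeffMap_adIter, coeffMap_derMap ι hδ]

end Map

/-! ### Coefficients of families in `𝔰` -/

/-- The component of degree `d` of an element of `V_i`. -/
def VDeg.comp {i : ℕ} (v : VDeg b s i) (d : ℕ) : L :=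
  if h : d ∈ Finset.Icc i (coxeterNumber b - 1) then (v ⟨d, h⟩ : L) else 0

/-- The coefficient `s^d_l` of a family `((s^d_0)_d, (s^d_l)_{1 ≤ l ≤ d})`. -/
def coef (v : VDeg b s 0 × VPos b s) (d l : ℕ) : L :=
  if l = 0 then v.1.comp d
  else if h : l ∈ Finset.Icc 1 (coxeterNumber b - 1) then (v.2 ⟨l, h⟩).comp d else 0

theorem one_le_coxeterNumber : 1 ≤ coxeterNumber b := Nat.succ_le_succ (Nat.zero_le _)

theorem coef_of_lt {v : VDeg b s 0 × VPos b s} {d l : ℕ} (h : d < l) : coef v d l = 0 := by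
  unfold coef
  rw [if_neg (by omega)]
  split_ifs with h1
  · unfold VDeg.comp
    rw [dif_neg (by rw [Finset.mem_Icc]; show ¬(l ≤ d ∧ _); omega)]
  · rfl

theorem VDeg.comp_mem {i : ℕ} (v : VDeg b s i) (d : ℕ) : v.comp d ∈ sGrade b s d := by
  unfold VDeg.comp
  split_ifs with h
  · exact (v ⟨d, h⟩).2
  · exact zero_mem _

theorem coef_mem (v : VDeg b s 0 × VPos b s) (d l : ℕ) : coef v d l ∈ sGrade b s d := by
  unfold coef
  split_ifs
  · exact VDeg.comp_mem _ _
  · exact VDeg.comp_mem _ _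
  · exact zero_mem _

theorem VDeg.ext_comp {i : ℕ} {v v' : VDeg b s i}
    (h : ∀ d, i ≤ d → d < coxeterNumber b → v.comp d = v'.comp d) : v = v' := by
  funext ⟨d, hd⟩
  have hd' := Finset.mem_Icc.mp hd
  have := h d hd'.1 (by have := one_le_coxeterNumber (b := b); omega)
  unfold VDeg.comp at this
  rw [dif_pos hd, dif_pos hd] at this
  exact Subtype.ext this

theorem coef_coe (v : VDeg b s 0 × VPos b s) (l : Finset.Icc 1 (coxeterNumber b - 1)) (d : ℕ) :
    coef v d l = (v.2 l).comp d := by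
  obtain ⟨l, hl⟩ := l
  unfold coef
  rw [if_neg (by have := Finset.mem_Icc.mp hl; show ¬ l = 0; omega), dif_pos hl]

theorem ext_coef {v v' : VDeg b s 0 × VPos b s}
    (h : ∀ d l, l ≤ d → d < coxeterNumber b → coef v d l = coef v' d l) : v = v' := by
  refine Prod.ext (VDeg.ext_comp fun d _ hd => ?_) (funext fun l => VDeg.ext_comp fun d hl hd => ?_)
  · simpa [coef] using h d 0 (Nat.zero_le d) hd
  · rw [← coef_coe, ← coef_coe]
    exact h d l hl hd

theorem vTerm_eq_sum {i : ℕ} (c : ℕ → K) (v : VDeg b s i) :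
    vTerm b c v = ∑ d ∈ Finset.range (coxeterNumber b), c d ⊗ₜ[ℂ] v.comp d := by
  unfold vTerm
  have hsub : Finset.Icc i (coxeterNumber b - 1) ⊆ Finset.range (coxeterNumber b) := by
    intro d hd
    have := one_le_coxeterNumber (b := b)
    rw [Finset.mem_Icc] at hd
    rw [Finset.mem_range]; omega
  refine Eq.trans ?_ (Finset.sum_subset (M := K ⊗[ℂ] L) hsub ?_)
  · rw [← Finset.sum_coe_sort (Finset.Icc i (coxeterNumber b - 1))]
    refine Finset.sum_congr rfl fun d _ => ?_
    unfold VDeg.comp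
    rw [dif_pos d.2]
  · intro d _ hd
    unfold VDeg.comp
    rw [dif_neg hd, TensorProduct.tmul_zero]

/-- `∑_{d,l} c_{l,d} ⊗ s^d_l`. -/
def famSum (c : ℕ → ℕ → K) (v : VDeg b s 0 × VPos b s) : K ⊗[ℂ] L :=
  vTerm b (c 0) v.1 + ∑ l : Finset.Icc 1 (coxeterNumber b - 1), vTerm b (c l) (v.2 l)

theorem famSum_eq_sum (c : ℕ → ℕ → K) (v : VDeg b s 0 × VPos b s) :
    famSum c v = ∑ l ∈ Finset.range (coxeterNumber b), ∑ d ∈ Finset.range (coxeterNumber b),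
      c l d ⊗ₜ[ℂ] coef v d l := by
  unfold famSum
  have e : Finset.range (coxeterNumber b) =
      insert 0 (Finset.Icc 1 (coxeterNumber b - 1)) := by
    ext d
    have := one_le_coxeterNumber (b := b)
    rw [Finset.mem_insert, Finset.mem_Icc, Finset.mem_range]; omega
  have e2 : ∀ g : ℕ → K ⊗[ℂ] L, ∑ l ∈ Finset.range (coxeterNumber b), g l =
      g 0 + ∑ l : Finset.Icc 1 (coxeterNumber b - 1), g l := fun g => by
    rw [e, Finset.sum_insert (by simp), Finset.sum_coe_sort _ g]
  rw [e2]
  congr 1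
  · rw [vTerm_eq_sum]
    exact Finset.sum_congr rfl fun d _ => by simp [coef]
  · refine Finset.sum_congr rfl fun l _ => ?_
    rw [vTerm_eq_sum]
    exact Finset.sum_congr rfl fun d _ => by rw [coef_coe]

/-- A family with prescribed coefficients. -/
def ofCoef (τ : ℕ → ℕ → L) (hτ : ∀ d l, τ d l ∈ sGrade b s d) : VDeg b s 0 × VPos b s :=
  (fun d => ⟨τ d 0, hτ d 0⟩, fun l d => ⟨τ d l, hτ d l⟩)

theorem coef_ofCoef {τ : ℕ → ℕ → L} (hτ : ∀ d l, τ d l ∈ sGrade b s d) {d l : ℕ} (hl : l ≤ d)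
    (hd : d < coxeterNumber b) : coef (ofCoef τ hτ) d l = τ d l := by
  unfold coef ofCoef VDeg.comp
  by_cases h : l = 0
  · subst h
    rw [if_pos rfl, dif_pos (by rw [Finset.mem_Icc]; omega)]
  · rw [if_neg h, dif_pos (by rw [Finset.mem_Icc]; omega),
      dif_pos (by rw [Finset.mem_Icc]; show l ≤ d ∧ _; omega)]

theorem coef_add (v v' : VDeg b s 0 × VPos b s) (d l : ℕ) :
    coef (v + v') d l = coef v d l + coef v' d l := by
  unfold coef VDeg.comp
  split_ifs <;> simp

theorem coef_sub (v v' : VDeg b s 0 × VPos b s) (d l : ℕ) :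
    coef (v - v') d l = coef v d l - coef v' d l := by
  unfold coef VDeg.comp
  split_ifs <;> simp

theorem coef_smul (t : ℂ) (v : VDeg b s 0 × VPos b s) (d l : ℕ) :
    coef (t • v) d l = t • coef v d l := by
  unfold coef VDeg.comp
  split_ifs <;> simp

theorem famSum_add (c : ℕ → ℕ → K) (v v' : VDeg b s 0 × VPos b s) :
    famSum c (v + v') = famSum c v + famSum c v' := by
  simp only [famSum_eq_sum, coef_add, TensorProduct.tmul_add, Finset.sum_add_distrib]

theorem famSum_smul (c : ℕ → ℕ → K) (t : ℂ) (v : VDeg b s 0 × VPos b s) :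
    famSum c (t • v) = t • famSum c v := by
  simp only [famSum_eq_sum, coef_smul, TensorProduct.tmul_smul, Finset.smul_sum]

theorem famSum_sub (c : ℕ → ℕ → K) (v v' : VDeg b s 0 × VPos b s) :
    famSum c (v - v') = famSum c v - famSum c v' := by
  simp only [famSum_eq_sum, coef_sub, TensorProduct.tmul_sub, Finset.sum_sub_distrib]

variable (b s) in
/-- The space of the elements `∑_{d,l} c_{l,d} ⊗ s^d_l`. -/
def famSpace (c : ℕ → ℕ → K) : Submodule ℂ (K ⊗[ℂ] L) where
  carrier := {z | ∃ v : VDeg b s 0 × VPos b s, famSum c v = z}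
  add_mem' := by
    rintro _ _ ⟨v, rfl⟩ ⟨v', rfl⟩
    exact ⟨v + v', famSum_add c v v'⟩
  zero_mem' := ⟨0, by simpa using famSum_sub c (0 : VDeg b s 0 × VPos b s) 0⟩
  smul_mem' := by
    rintro t _ ⟨v, rfl⟩
    exact ⟨t • v, famSum_smul c t v⟩

theorem tmul_mem_famSpace (c : ℕ → ℕ → K) {d l : ℕ} (hl : l ≤ d) (hd : d < coxeterNumber b)
    {σ : L} (hσ : σ ∈ sGrade b s d) : c l d ⊗ₜ[ℂ] σ ∈ famSpace b s c := by
  classical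
  refine ⟨ofCoef (fun d' l' => if d' = d ∧ l' = l then σ else 0) ?_, ?_⟩
  · intro d' l'
    split_ifs with h
    · rw [h.1]; exact hσ
    · exact zero_mem _
  · have hz : ∀ l' d', d' ∈ Finset.range (coxeterNumber b) → (d' ≠ d ∨ l' ≠ l) →
        c l' d' ⊗ₜ[ℂ] coef (ofCoef (fun d' l' => if d' = d ∧ l' = l then σ else 0) (by
          intro d' l'
          split_ifs with h
          · rw [h.1]; exact hσ
          · exact zero_mem _) : VDeg b s 0 × VPos b s) d' l' = 0 := by
      intro l' d' hd' hne
      by_cases hl' : l' ≤ d'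
      · rw [coef_ofCoef _ hl' (Finset.mem_range.mp hd'), if_neg (by tauto), TensorProduct.tmul_zero]
      · rw [coef_of_lt (by omega), TensorProduct.tmul_zero]
    rw [famSum_eq_sum, Finset.sum_eq_single l, Finset.sum_eq_single d]
    · rw [coef_ofCoef _ hl hd, if_pos ⟨rfl, rfl⟩]
    · exact fun d' hd' hne => hz l d' hd' (Or.inl hne)
    · intro h; exact absurd (Finset.mem_range.mpr hd) h
    · exact fun l' _ hne => Finset.sum_eq_zero fun d' hd' => hz l' d' hd' (Or.inr hne)
    · intro h; exact absurd (Finset.mem_range.mpr (by omega)) h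

variable (b) in
/-- The map `g ⊗ v ↦ λ(g) v_d`, with `v_d` the component of degree `d` of `v`. -/
def extract (lam : K →ₗ[ℂ] ℂ) (d : ℕ) : K ⊗[ℂ] L →ₗ[ℂ] L :=
  (TensorProduct.lid ℂ L).toLinearMap ∘ₗ TensorProduct.map lam (wtProj b d)

theorem extract_tmul (lam : K →ₗ[ℂ] ℂ) (d : ℕ) (g : K) (v : L) :
    extract b lam d (g ⊗ₜ[ℂ] v) = lam g • wtProj b d v := by
  simp [extract]

theorem extract_famSum (lam : K →ₗ[ℂ] ℂ) {d : ℕ} (hd : d < coxeterNumber b) (c : ℕ → ℕ → K)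
    (v : VDeg b s 0 × VPos b s) :
    extract b lam d (famSum c v) = ∑ l ∈ Finset.range (d + 1), lam (c l d) • coef v d l := by
  rw [famSum_eq_sum]
  simp only [map_sum, extract_tmul]
  have h : ∀ l, ∑ d' ∈ Finset.range (coxeterNumber b), lam (c l d') • wtProj b d (coef v d' l) =
      lam (c l d) • coef v d l := by
    intro l
    rw [Finset.sum_eq_single d]
    · rw [wtProj_self (coef_mem v d l).2]
    · intro d' _ hne
      rw [wtProj_of_ne (by exact_mod_cast hne) (coef_mem v d' l).2, smul_zero]
    · intro h; exact absurd (Finset.mem_range.mpr hd) h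
  simp only [h]
  symm
  refine Finset.sum_subset (Finset.range_mono (by omega)) fun l _ hl => ?_
  rw [Finset.mem_range, not_lt] at hl
  rw [coef_of_lt (by omega), smul_zero]

end CanonicalForms

/-! ### Places and the weight filtration -/

/-- The data of a completed local ring at a point of a curve: a field of functions with a
derivation `δ`, a local coordinate `x` and the functionals `co m` which extract the coefficients of
`x^m`. -/
structure Place (K : Type*) [Field K] [Algebra ℂ K] (δ : Der K) where
  /-- The local coordinate. -/
  x : K
  /-- The coefficient of `x^m`. -/
  co : ℤ → K →ₗ[ℂ] ℂ
  der_x : δ x = 1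
  co_one : ∀ m, co m 1 = if m = 0 then 1 else 0
  co_inv_mul : ∀ (k : ℕ) m g, co m ((x ^ k)⁻¹ * g) = co (m + k) g
  co_mul : ∀ p q g k, (∀ m < p, co m g = 0) → (∀ m < q, co m k = 0) →
    ∀ m < p + q, co m (g * k) = 0
  co_der : ∀ p g, (∀ m < p, co m g = 0) → ∀ m < p - 1, co m (δ g) = 0

namespace Place

variable {K : Type*} [Field K] [Algebra ℂ K] {δ : Der K} (P : Place K δ)

/-- The functions of order at least `p`. -/
def ordGE (p : ℤ) : Submodule ℂ K := ⨅ m : {m : ℤ // m < p}, LinearMap.ker (P.co m)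

variable {P}

theorem mem_ordGE {p : ℤ} {g : K} : g ∈ P.ordGE p ↔ ∀ m < p, P.co m g = 0 := by
  simp [ordGE, Submodule.mem_iInf]

theorem ordGE_anti {p q : ℤ} (h : p ≤ q) : P.ordGE q ≤ P.ordGE p := fun g hg => by
  rw [mem_ordGE] at *
  exact fun m hm => hg m (by omega)

theorem mul_mem_ordGE {p q : ℤ} {g k : K} (hg : g ∈ P.ordGE p) (hk : k ∈ P.ordGE q) :
    g * k ∈ P.ordGE (p + q) := by
  rw [mem_ordGE] at *
  exact P.co_mul p q g k hg hk

theorem der_mem_ordGE {p : ℤ} {g : K} (hg : g ∈ P.ordGE p) : δ g ∈ P.ordGE (p - 1) := by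
  rw [mem_ordGE] at *
  exact P.co_der p g hg

theorem co_pow_inv (k : ℕ) (m : ℤ) : P.co m (P.x ^ k)⁻¹ = if m + k = 0 then 1 else 0 := by
  have := P.co_inv_mul k m 1
  rwa [mul_one, P.co_one] at this

theorem x_pow_inv_mem {k : ℕ} {p : ℤ} (h : p ≤ -k) : (P.x ^ k)⁻¹ ∈ P.ordGE p := by
  rw [mem_ordGE]
  intro m hm
  rw [co_pow_inv, if_neg (by omega)]

theorem x_inv_mem {p : ℤ} (h : p ≤ -1) : P.x⁻¹ ∈ P.ordGE p := by
  simpa using P.x_pow_inv_mem (k := 1) (by simpa using h)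

variable (P)

/-- The coefficients of the operators of weight at least `p`. -/
def weightFil (p e : ℕ) : Submodule ℂ K := P.ordGE ((p : ℤ) - e)

/-- Orders add under multiplication just as indices do, so weights add under the bracket. A
derivative lowers the order by one and raises the index by one, hence preserves the weight. -/
theorem mulLE_weightFil (p q : ℕ) :
    MulLE (P.weightFil p) (P.weightFil q) (P.weightFil (p + q)) := by
  intro a c hc a' c' hc'
  exact ordGE_anti (by push_cast; omega) (mul_mem_ordGE hc hc')

theorem derLE_weightFil (p : ℕ) : DerLE δ (P.weightFil p) (P.weightFil p) := by
  intro a c hc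
  exact ordGE_anti (by push_cast; omega) (der_mem_ordGE hc)

theorem comparison_weightFil {p q : ℕ} (h : p ≤ q) :
    Comparison δ (P.weightFil 0) (P.weightFil p) (P.weightFil q) where
  mul_base := P.mulLE_weightFil 0 0
  der_base := P.derLE_weightFil 0
  mul_big := by simpa using P.mulLE_weightFil 0 p
  mul_small := by simpa using P.mulLE_weightFil 0 q
  der_big := P.derLE_weightFil p
  der_small := P.derLE_weightFil q
  le e := ordGE_anti (by omega)

theorem mulLE_weightFil_succ (l : ℕ) :
    MulLE (P.weightFil 1) (P.weightFil l) (P.weightFil (l + 1)) := by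
  rw [add_comm]
  exact P.mulLE_weightFil 1 l

end Place

section

variable {L : Type*} [LieRing L] [LieAlgebra ℂ L] {n : ℕ} {H : LieSubalgebra ℂ L}
  {b : LieAlgebra.Basis (Fin n) H} {s : Submodule ℂ L}

theorem extract_eq_zero {K : Type*} [Field K] [Algebra ℂ K] {Γ : ℕ → Submodule ℂ K}
    {lam : K →ₗ[ℂ] ℂ} {d : ℕ} (h : ∀ c ∈ Γ (d + 1), lam c = 0) {x : K ⊗[ℂ] L}
    (hx : x ∈ operFil b Γ) : extract b lam d x = 0 := by
  have : operFil b Γ ≤ LinearMap.ker (extract b lam d) := by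
    refine gspan_le fun e c hc v hv => ?_
    rw [LinearMap.mem_ker, extract_tmul]
    by_cases he : e = d + 1
    · subst he
      rw [h c hc, zero_smul]
    · rw [wtProj_of_ne _ hv, smul_zero]
      intro h
      apply he
      have : (e : ℂ) = ((d + 1 : ℕ) : ℂ) := by push_cast; linear_combination h
      exact_mod_cast this
  exact this hx

/-- In degree `d` the coefficient of `x^m` has weight `m + d + 1`; it must vanish when this is less
than `p`. -/
theorem extract_weightFil {K : Type*} [Field K] [Algebra ℂ K] {δ : Der K} (P : Place K δ)
    {p d : ℕ} {m : ℤ} (hm : m < (p : ℤ) - (d + 1 : ℕ)) {x : K ⊗[ℂ] L}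
    (hx : x ∈ operFil b (pos (P.weightFil p))) : extract b (P.co m) d x = 0 := by
  refine extract_eq_zero (fun c hc => ?_) hx
  have := (mem_pos.mp hc).2 (Nat.succ_ne_zero d)
  exact Place.mem_ordGE.mp this m hm

/-! ### Shape of the canonical form of a 1-Bessel operator -/

section Local

variable {K : Type*} [Field K] [Algebra ℂ K]

/-- The span of the powers `x^{-k}`, `0 < k ≤ d` (and of `1` if `d = 0`). -/
def localFam (x : K) (d : ℕ) : Submodule ℂ K :=
  Submodule.span ℂ {c | ∃ k ≤ d, (k = 0 → d = 0) ∧ c = x⁻¹ ^ k}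

/-- Excluding constants in positive degree is compatible with products and derivatives. Since
operator components of degree `d` have index `d + 1`, it leaves there the pole orders `1, …, d + 1`,
those of an `𝔰`-Bessel operator. -/
theorem mulLE_localFam (x : K) : MulLE (localFam x) (localFam x) (localFam x) := by
  intro a c hc a' c' hc'
  have := Submodule.mul_mem_mul hc hc'
  unfold localFam at this
  rw [Submodule.span_mul_span] at this
  refine Submodule.span_mono ?_ this
  rintro _ ⟨_, ⟨k, hk, hk', rfl⟩, _, ⟨l, hl, hl', rfl⟩, rfl⟩
  exact ⟨k + l, by omega, by omega, (pow_add _ _ _).symm⟩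

theorem derivation_inv_pow {δ : Der K} {x : K} (hδ : δ x = 1) (k : ℕ) :
    δ (x⁻¹ ^ k) = -(k : ℂ) • x⁻¹ ^ (k + 1) := by
  rcases k with _ | k
  · simp
  · have h1 : ((-((k + 1 : ℕ) : ℂ)) • x⁻¹ ^ (k + 1 + 1) : K) =
        -((k + 1 : ℕ) : K) * x⁻¹ ^ (k + 1 + 1) := by
      rw [Algebra.smul_def, map_neg, map_natCast]
    rw [h1, Derivation.leibniz_pow, Derivation.leibniz_inv, hδ, Nat.add_sub_cancel]
    simp only [smul_eq_mul, nsmul_eq_mul]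
    ring

theorem derLE_localFam {δ : Der K} {x : K} (hδ : δ x = 1) :
    DerLE δ (localFam x) (localFam x) := by
  intro a c hc
  unfold localFam at hc
  induction hc using Submodule.span_induction with
  | mem c hc =>
    obtain ⟨k, hk, hk', rfl⟩ := hc
    rw [derivation_inv_pow hδ]
    exact Submodule.smul_mem _ _ (Submodule.subset_span ⟨k + 1, by omega, by omega, rfl⟩)
  | zero => rw [map_zero]; exact zero_mem _
  | add u v _ _ hu hv => rw [map_add]; exact add_mem hu hv
  | smul t u _ hu => rw [Derivation.map_smul]; exact Submodule.smul_mem _ _ hu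

theorem inv_mem_localFam (x : K) (d : ℕ) : x⁻¹ ∈ localFam x (d + 1) :=
  Submodule.subset_span ⟨1, by omega, by omega, by simp⟩

/-- The coefficients of an `𝔰`-Bessel operator. -/
def besselCoeff (x : K) (l d : ℕ) : K := (x ^ (d + 1 - l))⁻¹

theorem sBessel_eq (x : K) (v : VDeg b s 0 × VPos b s) :
    sBessel b x v = prinNilK b K + famSum (besselCoeff x) v := by
  unfold sBessel famSum
  rw [add_assoc]
  rfl

theorem tmul_mem_of_span {p : Submodule ℂ (K ⊗[ℂ] L)} {S : Set K} {σ : L}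
    (h : ∀ c ∈ S, c ⊗ₜ[ℂ] σ ∈ p) {c : K} (hc : c ∈ Submodule.span ℂ S) : c ⊗ₜ[ℂ] σ ∈ p := by
  induction hc using Submodule.span_induction with
  | mem c hc => exact h c hc
  | zero => rw [TensorProduct.zero_tmul]; exact zero_mem _
  | add u v _ _ hu hv => rw [TensorProduct.add_tmul]; exact add_mem hu hv
  | smul t u _ hu => rw [TensorProduct.smul_tmul' t u σ |>.symm]; exact Submodule.smul_mem _ _ hu

theorem gspan_localFam_le [FiniteDimensional ℂ L] (x : K) :
    gspan (fun e => localFam x (e + 1)) (sGrade b s) ≤ famSpace b s (besselCoeff x) := by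
  refine gspan_le fun e c hc σ hσ => ?_
  by_cases he : e < coxeterNumber b
  · refine tmul_mem_of_span ?_ hc
    rintro _ ⟨k, hk, hk', rfl⟩
    -- A pole of order `k` in degree `e` corresponds to `l = e + 1 - k`; the bound `l ≤ e` uses `k ≥
    -- 1`.
    have := tmul_mem_famSpace (besselCoeff x) (d := e) (l := e + 1 - k) (by omega) he hσ
    rwa [besselCoeff, show e + 1 - (e + 1 - k) = k by omega, ← inv_pow] at this
  · have : σ ∈ grade b e := hσ.2
    rw [grade_eq_bot b (by omega), Submodule.mem_bot] at this
    rw [this, TensorProduct.tmul_zero]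
    exact zero_mem _

theorem mem_wt_of_grade {i : ℕ} {v : L} (h : v ∈ grade b i) : v ∈ wt b i := h

theorem oneBessel_sub_mem (x : K) (X0 : H) (X : UPos b) :
    oneBessel b x X0 X - prinNilK b K ∈ operFil b (pos (localFam x)) := by
  unfold oneBessel
  rw [add_sub_cancel_left, TensorProduct.tmul_add, TensorProduct.tmul_sum]
  have hpos : ∀ e, x⁻¹ ∈ pos (localFam x) (e + 1) := fun e =>
    mem_pos.mpr ⟨fun h => by omega, fun _ => inv_mem_localFam x e⟩
  refine add_mem (tmul_mem_gspan 1 (hpos 0) ?_) (Submodule.sum_mem _ fun i _ =>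
    tmul_mem_gspan (i + 1) (hpos i) ?_)
  · simpa using cartan_le_wt b X0.2
  · simpa [grade_eq_wt] using mem_wt_of_grade (X i).2

theorem exists_bessel_solution [FiniteDimensional ℂ L] {Ψ : L →ₗ[ℂ] L} (hΨ : IsHomotopy b s Ψ)
    {δ : Der K} {x : K}
    (hδ : δ x = 1) (X0 : H) (X : UPos b) : ∃ (y : K ⊗[ℂ] L) (v : VDeg b s 0 × VPos b s),
      Solution b s δ (localFam x) y (oneBessel b x X0 X) (sBessel b x v) := by
  obtain ⟨y, T, hT, hmem⟩ := exists_solution hΨ (mulLE_localFam x) (derLE_localFam hδ)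
    (oneBessel_sub_mem x X0 X)
  obtain ⟨v, hv⟩ := gspan_localFam_le x hmem
  refine ⟨y, v, ?_⟩
  rw [sBessel_eq, hv, add_sub_cancel]
  exact hT

/-- The canonical form of a 1-Bessel operator with respect to a local coordinate. -/
def phiGen (b : LieAlgebra.Basis (Fin n) H) (s : Submodule ℂ L) (δ : Der K) (x : K) (X0 : H)
    (X : UPos b) : VDeg b s 0 × VPos b s :=
  Classical.epsilon fun v => IsCanonicalForm b s δ (oneBessel b x X0 X) (sBessel b x v)

theorem oneBessel_sub_eq (x : K) (X0 : H) (X X' : UPos b) :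
    oneBessel b x X0 X - oneBessel b x X0 X' =
      ∑ i : Finset.Icc 1 (coxeterNumber b - 1), x⁻¹ ⊗ₜ[ℂ] ((X i : L) - X' i) := by
  unfold oneBessel
  rw [← TensorProduct.tmul_sum, Finset.sum_sub_distrib, add_sub_add_left_eq_sub,
    ← TensorProduct.tmul_sub, add_sub_add_left_eq_sub]

end Local

/-! ### The local map and its diagonal blocks -/

section AtPlace

variable {K : Type*} [Field K] [Algebra ℂ K] {δ : Der K} (P : Place K δ)

theorem localFam_le_weightFil (e : ℕ) : localFam P.x e ≤ P.weightFil 0 e := by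
  refine Submodule.span_le.mpr ?_
  rintro _ ⟨k, hk, -, rfl⟩
  rw [inv_pow]
  exact Place.x_pow_inv_mem (by push_cast; omega)

/-- In a fixed degree, different `l` occur with different powers of `x`, so a single Laurent
coefficient isolates each of them. -/
theorem extract_bessel {d l : ℕ} (hl : l ≤ d) (hd : d < coxeterNumber b)
    (v : VDeg b s 0 × VPos b s) :
    extract b (P.co ((l : ℤ) - (d + 1 : ℕ))) d (famSum (besselCoeff P.x) v) =
      coef v d l := by
  rw [extract_famSum _ hd, Finset.sum_eq_single l]
  · rw [besselCoeff, Place.co_pow_inv, if_pos (by omega), one_smul]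
  · intro l' hl' hne
    rw [Finset.mem_range] at hl'
    rw [besselCoeff, Place.co_pow_inv, if_neg (by omega), zero_smul]
  · intro h
    exact absurd (Finset.mem_range.mpr (by omega)) h

theorem famSum_bessel_injective :
    Function.Injective (famSum (besselCoeff P.x) (b := b) (s := s)) := by
  intro v v' h
  refine ext_coef fun d l hl hd => ?_
  rw [← extract_bessel P hl hd, h, extract_bessel P hl hd]

variable {Ψ : L →ₗ[ℂ] L}

theorem existsUnique_bessel [FiniteDimensional ℂ L] (hΨ : IsHomotopy b s Ψ) (X0 : H) (X : UPos b) :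
    ∃! v : VDeg b s 0 × VPos b s, IsCanonicalForm b s δ
      (oneBessel b P.x X0 X) (sBessel b P.x v) := by
  obtain ⟨y, v, h⟩ := exists_bessel_solution hΨ P.der_x X0 X
  refine ⟨v, h.isCanonicalForm, fun v' hv' => ?_⟩
  obtain ⟨y', h'⟩ := hv'.exists_solution
    (operFil_mono (pos_le_pos fun _ => le_top) (oneBessel_sub_mem _ X0 X))
  have := (h'.unique hΨ (h.mono fun _ => le_top))
  rw [sBessel_eq, sBessel_eq] at this
  exact famSum_bessel_injective P (add_left_cancel this)

theorem phi_solution [FiniteDimensional ℂ L] (hΨ : IsHomotopy b s Ψ) (X0 : H) (X : UPos b) :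
    ∃ y, Solution b s δ (P.weightFil 0) y (oneBessel b P.x X0 X)
      (sBessel b P.x (phiGen b s δ P.x X0 X)) := by
  obtain ⟨y, v, h⟩ := exists_bessel_solution hΨ P.der_x X0 X
  have hspec : IsCanonicalForm b s δ (oneBessel b P.x X0 X)
      (sBessel b P.x (phiGen b s δ P.x X0 X)) := Classical.epsilon_spec
      (p := fun v => IsCanonicalForm b s δ (oneBessel b P.x X0 X) (sBessel b P.x v))
      ⟨v, h.isCanonicalForm⟩
  rw [(existsUnique_bessel P hΨ X0 X).unique hspec h.isCanonicalForm]
  exact ⟨y, h.mono (localFam_le_weightFil P)⟩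

theorem tmul_mem_weightFil {p i : ℕ} {c : K} (hc : c ∈ P.ordGE ((p : ℤ) - (i + 1 : ℕ)))
    {v : L} (hv : v ∈ grade b i) : c ⊗ₜ[ℂ] v ∈ operFil b (pos (P.weightFil p)) := by
  refine tmul_mem_gspan (i + 1) (mem_pos.mpr ⟨fun h => by omega, fun _ => hc⟩) ?_
  simpa [grade_eq_wt] using hv

theorem oneBessel_sub_mem_weightFil {l : ℕ} (X0 : H) {X X' : UPos b}
    (h : ∀ i : Finset.Icc 1 (coxeterNumber b - 1), (i : ℕ) < l → X i = X' i) :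
    oneBessel b P.x X0 X - oneBessel b P.x X0 X' ∈ operFil b (pos (P.weightFil l)) := by
  rw [oneBessel_sub_eq]
  refine Submodule.sum_mem _ fun i _ => ?_
  by_cases hi : (i : ℕ) < l
  · rw [h i hi, sub_self, TensorProduct.tmul_zero]
    exact zero_mem _
  · exact tmul_mem_weightFil P (Place.x_inv_mem (by push_cast; omega)) (sub_mem (X i).2 (X' i).2)

/-- The coefficients of degree at least `1` of the canonical form of a 1-Bessel operator. -/
def phiAtGen (b : LieAlgebra.Basis (Fin n) H) (s : Submodule ℂ L) (δ : Der K) (x : K) (X0 : H) :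
    UPos b → VPos b s := fun X => (phiGen b s δ x X0 X).2

/-- The components of `Φ^{X^0}` depend on the top argument linearly, up to a translation, with a
linear part which does not depend on the lower arguments. -/
theorem phiAt_sub_eq [FiniteDimensional ℂ L] (hΨ : IsHomotopy b s Ψ) (X0 : H)
    (l : Finset.Icc 1 (coxeterNumber b - 1))
    {X X' Y Y' : UPos b} (hX : ∀ i < l, X i = X' i) (hY : ∀ i < l, Y i = Y' i) (c : ℂ)
    (hc : X l - X' l = c • (Y l - Y' l)) :
    phiAtGen b s δ P.x X0 X l - phiAtGen b s δ P.x X0 X' l = c •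
      (phiAtGen b s δ P.x X0 Y l - phiAtGen b s δ P.x X0 Y' l) := by
  have hl1 := (Finset.mem_Icc.mp l.2).1
  obtain ⟨y0, h0⟩ := phi_solution P hΨ X0 X
  obtain ⟨y1, h1⟩ := phi_solution P hΨ X0 X'
  obtain ⟨y2, h2⟩ := phi_solution P hΨ X0 Y
  obtain ⟨y3, h3⟩ := phi_solution P hΨ X0 Y'
  -- The families are weight at least `1` between the pairs (all four operators share `X^0`), at
  -- least `l` within a pair, and `l + 1` for the error.
  have key := Solution.sub_smul_sub_mem hΨ (P.comparison_weightFil (Nat.zero_le 1))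
    (P.comparison_weightFil (Nat.zero_le l)) (P.comparison_weightFil (Nat.le_succ l))
    (P.mulLE_weightFil_succ l) (P.comparison_weightFil hl1).le
    (y := ![y0, y1, y2, y3])
    (A := ![oneBessel b P.x X0 X, oneBessel b P.x X0 X', oneBessel b P.x X0 Y,
      oneBessel b P.x X0 Y'])
    (T := ![sBessel b P.x (phiGen b s δ P.x X0 X), sBessel b P.x (phiGen b s δ P.x X0 X'),
      sBessel b P.x (phiGen b s δ P.x X0 Y), sBessel b P.x (phiGen b s δ P.x X0 Y')])
    (by
      intro i
      fin_cases i
      · exact h0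
      · exact h1
      · exact h2
      · exact h3)
    (oneBessel_sub_mem_weightFil P X0 fun i hi => hX i hi)
    (oneBessel_sub_mem_weightFil P X0 fun i hi => hY i hi)
    (oneBessel_sub_mem_weightFil P X0 fun i hi => by
      have := (Finset.mem_Icc.mp i.2).1
      omega) c
    (by
      change oneBessel b P.x X0 X - oneBessel b P.x X0 X' -
        c • (oneBessel b P.x X0 Y - oneBessel b P.x X0 Y') ∈ _
      rw [oneBessel_sub_eq, oneBessel_sub_eq, Finset.smul_sum, ← Finset.sum_sub_distrib]
      refine Submodule.sum_mem _ fun i _ => ?_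
      rw [← TensorProduct.tmul_smul, ← TensorProduct.tmul_sub]
      rcases lt_trichotomy i l with hi | rfl | hi
      · rw [hX i hi, hY i hi, sub_self, sub_self, smul_zero, sub_self, TensorProduct.tmul_zero]
        exact zero_mem _
      · have := congrArg Subtype.val hc
        simp only [Submodule.coe_sub, Submodule.coe_smul] at this
        rw [this, sub_self, TensorProduct.tmul_zero]
        exact zero_mem _
      · have hi' : (l : ℕ) < i := hi
        exact tmul_mem_weightFil P (Place.x_inv_mem (by push_cast; omega))
          (sub_mem (sub_mem (X i).2 (X' i).2)
            (Submodule.smul_mem _ _ (sub_mem (Y i).2 (Y' i).2))))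
  change sBessel b P.x (phiGen b s δ P.x X0 X) - sBessel b P.x (phiGen b s δ P.x X0 X') -
    c • (sBessel b P.x (phiGen b s δ P.x X0 Y) - sBessel b P.x (phiGen b s δ P.x X0 Y')) ∈ _ at key
  simp only [sBessel_eq, add_sub_add_left_eq_sub] at key
  rw [← famSum_sub, ← famSum_sub, ← famSum_smul, ← famSum_sub] at key
  funext ⟨d, hd⟩
  have hd' := Finset.mem_Icc.mp hd
  -- The power `l - (d + 1)` in degree `d` has weight exactly `l`, so the error of weight `l + 1`
  -- does not contribute.
  have e := extract_weightFil P (d := d) (m := (l : ℤ) - (d + 1 : ℕ)) (by push_cast; omega) key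
  rw [extract_bessel P hd'.1 (by have := one_le_coxeterNumber (b := b); omega), coef_sub, coef_smul,
    coef_sub, coef_sub, sub_eq_zero] at e
  simp only [coef_coe, VDeg.comp, dif_pos hd] at e
  exact Subtype.ext e

/-- The linear part of the component of degree `l` of `Φ^{X^0}`. -/
def phiLin [FiniteDimensional ℂ L] (hΨ : IsHomotopy b s Ψ) (X0 : H)
    (l : Finset.Icc 1 (coxeterNumber b - 1)) :
    grade b l →ₗ[ℂ] VDeg b s l where
  toFun ξ := phiAtGen b s δ P.x X0 (Pi.single l ξ) l - phiAtGen b s δ P.x X0 0 l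
  map_add' ξ η := by
    have h : ∀ ζ : grade b l, ∀ i < l, (Pi.single l ζ : UPos b) i = 0 := fun ζ i hi =>
      Pi.single_eq_of_ne hi.ne _
    have := phiAt_sub_eq P hΨ X0 l (X := Pi.single l (ξ + η)) (X' := Pi.single l η)
      (Y := Pi.single l ξ) (Y' := 0) (fun i hi => by rw [h _ i hi, h _ i hi])
      (fun i hi => by rw [h _ i hi]; rfl) 1 (by simp)
    rw [one_smul] at this
    rw [← this]
    abel
  map_smul' c ξ := by
    have h : ∀ ζ : grade b l, ∀ i < l, (Pi.single l ζ : UPos b) i = 0 := fun ζ i hi =>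
      Pi.single_eq_of_ne hi.ne _
    exact phiAt_sub_eq P hΨ X0 l (X := Pi.single l (c • ξ)) (X' := 0)
      (Y := Pi.single l ξ) (Y' := 0) (fun i hi => by rw [h _ i hi]; rfl)
      (fun i hi => by rw [h _ i hi]; rfl) c (by simp)

/-- The pair defining `phiLin` may have different lower arguments from the given pair. The
second-difference estimate shows that the linear part does not notice. -/
theorem phiAt_sub_eq_phiLin [FiniteDimensional ℂ L] (hΨ : IsHomotopy b s Ψ) (X0 : H)
    (l : Finset.Icc 1 (coxeterNumber b - 1)) {X X' : UPos b} (hX : ∀ i < l, X i = X' i) :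
    phiAtGen b s δ P.x X0 X l - phiAtGen b s δ P.x X0 X' l = phiLin P hΨ X0 l (X l - X' l) := by
  have := phiAt_sub_eq P hΨ X0 l (X := X) (X' := X')
    (Y := Pi.single l (X l - X' l)) (Y' := 0) hX
    (fun i hi => by rw [Pi.single_eq_of_ne hi.ne]; rfl) 1 (by simp)
  rw [one_smul] at this
  exact this

end AtPlace

end

/-! ### The places of `ℂ((x))` and `ℂ(z)` -/

theorem algebraMap_laurent (c : ℂ) : algebraMap ℂ (LaurentSeries ℂ) c = HahnSeries.single 0 c := by
  rw [HahnSeries.algebraMap_apply', PowerSeries.algebraMap_apply]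
  exact HahnSeries.ofPowerSeries_C c

section Field

variable {K : Type*} [Field K] [Algebra ℂ K]

/-- A linear functional, from an additive map compatible with the multiplication by constants. -/
def mkDual (f : K → ℂ) (hadd : ∀ g k, f (g + k) = f g + f k)
    (hC : ∀ (c : ℂ) g, f (algebraMap ℂ K c * g) = c * f g) : K →ₗ[ℂ] ℂ where
  toFun := f
  map_add' := hadd
  map_smul' c g := by rw [Algebra.smul_def, hC]; rfl

theorem der_mul (δ : Der K) (g k : K) : δ (g * k) = g * δ k + k * δ g := by simp

theorem der_algebraMap (δ : Der K) (c : ℂ) : δ (algebraMap ℂ K c) = 0 := δ.map_algebraMap c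

theorem der_add (δ : Der K) (g k : K) : δ (g + k) = δ g + δ k := map_add δ g k

theorem der_div (δ : Der K) (g k : K) : δ (g / k) = (δ g * k - g * δ k) / k ^ 2 := by
  rw [Derivation.leibniz_div]
  simp only [smul_eq_mul]
  ring

end Field

theorem coeff_algebraMap_mul (m : ℤ) (c : ℂ) (g : LaurentSeries ℂ) :
    (algebraMap ℂ (LaurentSeries ℂ) c * g).coeff m = c * g.coeff m := by
  rw [algebraMap_laurent]
  have := HahnSeries.coeff_single_mul_add (r := c) (x := g) (a := m) (b := (0 : ℤ))
  rwa [add_zero] at this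

theorem laurentDeriv_apply (g : LaurentSeries ℂ) :
    laurentDeriv g = LaurentSeries.derivative ℂ g := rfl

/-- The place `x = 0` of `ℂ((x))`. -/
def laurentPlace : Place (LaurentSeries ℂ) laurentDeriv where
  x := laurentX
  co m := mkDual (fun g => g.coeff m) (fun _ _ => rfl) (coeff_algebraMap_mul m)
  der_x := by
    ext m
    rw [laurentDeriv_apply, coeff_derivative, laurentX, HahnSeries.coeff_one]
    by_cases h : m = 0
    · simp [h]
    · rw [HahnSeries.coeff_single_of_ne (by omega), mul_zero, if_neg h]
  co_one m := by
    change (1 : LaurentSeries ℂ).coeff m = _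
    rw [HahnSeries.coeff_one]
    congr
  co_inv_mul k m g := by
    have h : (laurentX ^ k)⁻¹ = HahnSeries.single (-(k : ℤ)) (1 : ℂ) := by
      rw [laurentX, HahnSeries.single_pow, HahnSeries.inv_single]
      simp
    have := HahnSeries.coeff_single_mul_add (r := (1 : ℂ)) (x := g) (a := m + k) (b := -(k : ℤ))
    rw [h]
    rwa [one_mul, add_neg_cancel_right] at this
  co_mul p q g k hg hk m hm := by
    change (g * k).coeff m = 0
    rw [HahnSeries.coeff_mul]
    refine Finset.sum_eq_zero fun ij hij => ?_
    obtain ⟨-, -, h⟩ := Finset.mem_antidiagonal.mp hij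
    by_cases h1 : ij.1 < p
    · rw [show g.coeff ij.1 = 0 from hg _ h1, zero_mul]
    · rw [show k.coeff ij.2 = 0 from hk _ (by omega), mul_zero]
  co_der p g hg m hm := by
    change (LaurentSeries.derivative ℂ g).coeff m = 0
    rw [coeff_derivative,
      show g.coeff (m + 1) = 0 from hg _ (by omega), mul_zero]

/-- The expansion of a polynomial at the point `w`. -/
def polyExpand (w : ℂ) : Polynomial ℂ →+* LaurentSeries ℂ :=
  (HahnSeries.ofPowerSeries ℤ ℂ).comp
    ((Polynomial.coeToPowerSeries.ringHom).comp (Polynomial.taylorAlgHom w).toRingHom)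

theorem polyExpand_apply (w : ℂ) (p : Polynomial ℂ) : polyExpand w p =
    HahnSeries.ofPowerSeries ℤ ℂ ((Polynomial.taylor w p : Polynomial ℂ) : PowerSeries ℂ) := rfl

theorem polyExpand_injective (w : ℂ) : Function.Injective (polyExpand w) :=
  HahnSeries.ofPowerSeries_injective.comp
    ((Polynomial.coe_injective ℂ).comp (Polynomial.taylor_injective w))

theorem polyExpand_C (w c : ℂ) :
    polyExpand w (Polynomial.C c) = algebraMap ℂ (LaurentSeries ℂ) c := by
  rw [polyExpand_apply, Polynomial.taylor_C, Polynomial.coe_C, HahnSeries.ofPowerSeries_C,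
    algebraMap_laurent]
  rfl

theorem polyExpand_X_sub (w w' : ℂ) : polyExpand w (Polynomial.X - Polynomial.C w') =
    HahnSeries.ofPowerSeries ℤ ℂ (PowerSeries.X + PowerSeries.C (w - w')) := by
  rw [polyExpand_apply, map_sub, Polynomial.taylor_X, Polynomial.taylor_C]
  simp [add_sub_assoc]

theorem polyExpand_X (w : ℂ) :
    polyExpand w Polynomial.X = laurentX + algebraMap ℂ (LaurentSeries ℂ) w := by
  rw [polyExpand_apply, Polynomial.taylor_X, Polynomial.coe_add, Polynomial.coe_X,
    Polynomial.coe_C, map_add, HahnSeries.ofPowerSeries_X, HahnSeries.ofPowerSeries_C,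
    algebraMap_laurent]
  rfl

theorem polyExpand_derivative (w : ℂ) (p : Polynomial ℂ) :
    polyExpand w (Polynomial.derivative p) = laurentDeriv (polyExpand w p) := by
  induction p using Polynomial.induction_on with
  | C a => rw [Polynomial.derivative_C, map_zero, polyExpand_C, der_algebraMap]
  | add p q hp hq => rw [Polynomial.derivative_add, map_add, map_add, der_add, hp, hq]
  | monomial n a h =>
    rw [pow_succ, ← mul_assoc, Polynomial.derivative_mul, map_add, map_mul, h,
      map_mul (polyExpand w) _ Polynomial.X, map_mul (polyExpand w) _ (Polynomial.derivative _),
      der_mul _ _ (polyExpand w Polynomial.X), Polynomial.derivative_X, map_one, polyExpand_X,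
      der_add, der_algebraMap, show laurentDeriv laurentX = 1 from laurentPlace.der_x]
    ring

theorem polyExpand_nonZeroDivisors (w : ℂ) :
    nonZeroDivisors (Polynomial ℂ) ≤ (nonZeroDivisors (LaurentSeries ℂ)).comap (polyExpand w) :=
  nonZeroDivisors_le_comap_nonZeroDivisors_of_injective _ (polyExpand_injective w)

/-- The expansion of a rational function at the point `w`. -/
def ratExpand (w : ℂ) : RatFunc ℂ →ₐ[ℂ] LaurentSeries ℂ :=
  { RatFunc.liftRingHom (polyExpand w) (polyExpand_nonZeroDivisors w) with
    commutes' := fun c => by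
      rw [show algebraMap ℂ (RatFunc ℂ) c = algebraMap (Polynomial ℂ) (RatFunc ℂ) (Polynomial.C c)
        from by rw [RatFunc.algebraMap_C]; rfl]
      exact (RatFunc.liftRingHom_algebraMap _ _ _).trans (polyExpand_C w c) }

theorem ratExpand_algebraMap (w : ℂ) (p : Polynomial ℂ) :
    ratExpand w (algebraMap (Polynomial ℂ) (RatFunc ℂ) p) = polyExpand w p :=
  RatFunc.liftRingHom_algebraMap _ _ _

theorem ratExpand_derivative (w : ℂ) (g : RatFunc ℂ) :
    ratExpand w (ratDeriv g) = laurentDeriv (ratExpand w g) := by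
  obtain ⟨p, q, hq, rfl⟩ := exists_eq_div g
  have hq' : polyExpand w q ≠ 0 := (map_ne_zero_iff _ (polyExpand_injective w)).mpr hq
  rw [show ratDeriv = ratDerivFun from rfl]
  rw [ratDerivFun_div _ _ hq, map_div₀, map_div₀, map_pow]
  simp only [ratExpand_algebraMap]
  rw [der_div, map_sub, map_mul, map_mul, polyExpand_derivative, polyExpand_derivative]

theorem zSub_eq (w : ℂ) : zSub w =
    algebraMap (Polynomial ℂ) (RatFunc ℂ) (Polynomial.X - Polynomial.C w) := by
  rw [map_sub, RatFunc.algebraMap_X, RatFunc.algebraMap_C]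
  rfl

theorem X_eq_zSub : (RatFunc.X : RatFunc ℂ) = zSub 0 := by
  rw [zSub, map_zero, sub_zero]

theorem ratExpand_zSub (w w' : ℂ) : ratExpand w (zSub w') =
    HahnSeries.ofPowerSeries ℤ ℂ (PowerSeries.X + PowerSeries.C (w - w')) := by
  rw [zSub_eq, ratExpand_algebraMap, polyExpand_X_sub]

theorem zSub_ne_zero (w : ℂ) : zSub w ≠ 0 := by
  rw [zSub_eq]
  exact RatFunc.algebraMap_ne_zero (Polynomial.X_sub_C_ne_zero w)

section Comap

variable {K K' : Type*} [Field K] [Algebra ℂ K] [Field K'] [Algebra ℂ K'] {δ : Der K} {δ' : Der K'}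

/-- The restriction of a place to a differential subfield which contains the local coordinate. -/
def Place.comap (P : Place K' δ') (ι : K →ₐ[ℂ] K') (hδ : ∀ c, ι (δ c) = δ' (ι c)) (x : K)
    (hx : ι x = P.x) : Place K δ where
  x := x
  co m := (P.co m).comp ι.toLinearMap
  der_x := ι.toRingHom.injective (by simpa [hδ, hx] using P.der_x)
  co_one m := by simpa using P.co_one m
  co_inv_mul k m g := by simpa [hx] using P.co_inv_mul k m (ι g)
  co_mul p q g k hg hk m hm := by simpa using P.co_mul p q (ι g) (ι k) hg hk m hm
  co_der p g hg m hm := by simpa [hδ] using P.co_der p (ι g) hg m hm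

end Comap

theorem ratExpand_zSub_self (w : ℂ) : ratExpand w (zSub w) = laurentPlace.x := by
  rw [ratExpand_zSub, sub_self, map_zero, add_zero, HahnSeries.ofPowerSeries_X]
  rfl

/-- The place of `ℂ(z)` at the point `w`. -/
def ratPlace (w : ℂ) : Place (RatFunc ℂ) ratDeriv :=
  laurentPlace.comap (ratExpand w) (ratExpand_derivative w) (zSub w)
    (ratExpand_zSub_self w)

theorem ratPlace_x (w : ℂ) : (ratPlace w).x = zSub w := rfl

theorem ratDeriv_zSub (w : ℂ) : ratDeriv (zSub w) = 1 := (ratPlace w).der_x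

theorem ratPlace_co (w : ℂ) (m : ℤ) (g : RatFunc ℂ) :
    (ratPlace w).co m g = (ratExpand w g).coeff m := rfl

theorem ratExpand_inv_pow {w w' : ℂ} (h : w ≠ w') (k : ℕ) : ratExpand w (zSub w' ^ k)⁻¹ =
    HahnSeries.ofPowerSeries ℤ ℂ ((PowerSeries.X + PowerSeries.C (w - w'))⁻¹ ^ k) := by
  have : (PowerSeries.X + PowerSeries.C (w - w')) * (PowerSeries.X + PowerSeries.C (w - w'))⁻¹ =
    1 :=
    PowerSeries.mul_inv_cancel _ (by simpa [sub_eq_zero] using h)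
  rw [map_inv₀, map_pow, map_pow, ratExpand_zSub, ← inv_pow]
  congr 1
  refine inv_eq_of_mul_eq_one_right ?_
  rw [← map_mul, this, map_one]

theorem inv_zSub_pow_mem {w w' : ℂ} (h : w ≠ w') (k : ℕ) :
    (zSub w' ^ k)⁻¹ ∈ (ratPlace w).ordGE 0 := by
  rw [Place.mem_ordGE]
  intro m hm
  rw [ratPlace_co, ratExpand_inv_pow h, PowerSeries.coeff_coe, if_pos hm]

theorem inv_zSub_mem {w w' : ℂ} (h : w ≠ w') : (zSub w')⁻¹ ∈ (ratPlace w).ordGE 0 := by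
  simpa using inv_zSub_pow_mem h 1

theorem co_zero_inv_zSub_pow {w w' : ℂ} (h : w ≠ w') (k : ℕ) :
    (ratPlace w).co 0 (zSub w' ^ k)⁻¹ = ((w - w') ^ k)⁻¹ := by
  rw [ratPlace_co, ratExpand_inv_pow h, PowerSeries.coeff_coe, if_neg (by simp)]
  simp

/-! ### Computing `Φ` over `ℂ(z)` -/

section PhiComap

variable {L : Type*} [LieRing L] [LieAlgebra ℂ L] {n : ℕ} {H : LieSubalgebra ℂ L}
  {b : LieAlgebra.Basis (Fin n) H} {s : Submodule ℂ L} {Ψ : L →ₗ[ℂ] L}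
variable {K K' : Type*} [Field K] [Algebra ℂ K] [Field K'] [Algebra ℂ K'] {δ : Der K} {δ' : Der K'}

theorem coeffMap_oneBessel (ι : K →ₐ[ℂ] K') (x : K) (X0 : H) (X : UPos b) :
    coeffMap ι L (oneBessel b x X0 X) = oneBessel b (ι x) X0 X := by
  simp [oneBessel]

theorem coeffMap_famSum (ι : K →ₐ[ℂ] K') (c : ℕ → ℕ → K) (v : VDeg b s 0 × VPos b s) :
    coeffMap ι L (famSum c v) = famSum (fun l d => ι (c l d)) v := by
  simp only [famSum, vTerm, map_add, map_sum, coeffMap_tmul]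

theorem coeffMap_sBessel (ι : K →ₐ[ℂ] K') (x : K) (v : VDeg b s 0 × VPos b s) :
    coeffMap ι L (sBessel b x v) = sBessel b (ι x) v := by
  rw [sBessel_eq, sBessel_eq, map_add, coeffMap_famSum]
  simp only [besselCoeff, map_inv₀, map_pow, coeffMap_tmul, map_one]
  rfl

/-- The canonical form of a 1-Bessel operator does not depend on the place. -/
theorem phiGen_comap [FiniteDimensional ℂ L] (hΨ : IsHomotopy b s Ψ) (P : Place K' δ')
    (ι : K →ₐ[ℂ] K')
    (hδ : ∀ c, ι (δ c) = δ' (ι c)) (x : K) (hx : ι x = P.x) (X0 : H) (X : UPos b) :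
    phiGen b s δ x X0 X = phiGen b s δ' P.x X0 X := by
  obtain ⟨y, h⟩ := phi_solution (P.comap ι hδ x hx) hΨ X0 X
  obtain ⟨y', h'⟩ := phi_solution P hΨ X0 X
  have h1 := h.map ι hδ (Γ' := P.weightFil 0) fun e c hc => by
    rw [Place.weightFil, Place.mem_ordGE] at hc ⊢
    exact hc
  rw [coeffMap_oneBessel, coeffMap_sBessel, show ι (P.comap ι hδ x hx).x = P.x from hx] at h1
  exact (existsUnique_bessel P hΨ X0 X).unique h1.isCanonicalForm h'.isCanonicalForm

/-- This allows the local operator with coordinate `z - w` to be placed in `𝔤(ℂ(z))`, where it can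
be compared directly with the global operator. -/
theorem phiAtGen_ratPlace [FiniteDimensional ℂ L] (hΨ : IsHomotopy b s Ψ) (w : ℂ) (X0 : H) :
    phiAtGen b s ratDeriv (ratPlace w).x X0 = PhiAt b s X0 :=
  funext fun X => congrArg Prod.snd
    (phiGen_comap hΨ laurentPlace (ratExpand w) (ratExpand_derivative w) (zSub w)
      (ratExpand_zSub_self w) X0 X)

end PhiComap

/-! ### Triangular maps -/

section Triangular

variable {ι : Type*} [LinearOrder ι] [Finite ι] {U V : ι → Type*} [∀ i, AddCommGroup (U i)]
  [∀ i, Module ℂ (U i)] [∀ i, AddCommGroup (V i)] [∀ i, Module ℂ (V i)]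
  {φ : (∀ i, U i) → ∀ i, V i} {A : ∀ i, U i →ₗ[ℂ] V i}

theorem eq_of_triangular {l : ι}
    (hφ : ∀ l X X', (∀ i < l, X i = X' i) → φ X l - φ X' l = A l (X l - X' l))
    (hA : ∀ i < l, Function.Injective (A i)) {X X' : ∀ i, U i} (h : ∀ i < l, φ X i = φ X' i) :
    ∀ i < l, X i = X' i := by
  intro i
  induction i using WellFoundedLT.induction with
  | ind i ih =>
    intro hi
    have := hφ i X X' fun k hk => ih k hk (hk.trans hi)
    rw [h i hi, sub_self, eq_comm, map_eq_zero_iff _ (hA i hi)] at this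
    exact sub_eq_zero.mp this

theorem surjective_of_triangular
    (hφ : ∀ l X X', (∀ i < l, X i = X' i) → φ X l - φ X' l = A l (X l - X' l))
    (hA : ∀ i, Function.Surjective (A i)) : Function.Surjective φ := by
  classical
  have := Fintype.ofFinite ι
  intro v
  have key : ∀ t : Finset ι, ∃ X, ∀ i ∈ t, φ X i = v i := by
    intro t
    -- Indices are treated in increasing order: by triangularity, changing the argument at a new
    -- maximal index leaves the values already attained untouched.
    induction t using Finset.induction_on_max with
    | empty => exact ⟨0, by simp⟩
    | insert a t ht ih =>
      obtain ⟨X, hX⟩ := ih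
      obtain ⟨ξ, hξ⟩ := hA a (v a - φ X a)
      refine ⟨Function.update X a (X a + ξ), fun i hi => ?_⟩
      have h1 : ∀ k, k ≠ a → Function.update X a (X a + ξ) k = X k := fun k hk =>
        Function.update_of_ne hk _ _
      rcases Finset.mem_insert.mp hi with rfl | hi
      · have := hφ i (Function.update X i (X i + ξ)) X fun k hk => h1 k hk.ne
        rwa [Function.update_self, add_sub_cancel_left, hξ, sub_left_inj] at this
      · have hia := ht i hi
        have := hφ i (Function.update X a (X a + ξ)) X fun k hk => h1 k (hk.trans hia).ne
        rw [h1 i hia.ne, sub_self, map_zero, sub_eq_zero] at this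
        rw [this, hX i hi]
  obtain ⟨X, hX⟩ := key Finset.univ
  exact ⟨X, funext fun i => hX i (Finset.mem_univ i)⟩

/-- By induction the lower blocks are injective, so a preimage of a vector differing from `φ 0` only
at `l` agrees with `0` below `l`. Its `l`-th entry then solves the block equation. The block is
surjective, hence injective by dimension. -/
theorem injective_of_triangular [∀ i, FiniteDimensional ℂ (U i)] [∀ i, FiniteDimensional ℂ (V i)]
    (hφ : ∀ l X X', (∀ i < l, X i = X' i) → φ X l - φ X' l = A l (X l - X' l))
    (hr : ∀ i, Module.finrank ℂ (U i) = Module.finrank ℂ (V i)) (h : Function.Surjective φ)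
    (l : ι) :
    Function.Injective (A l) := by
  classical
  induction l using WellFoundedLT.induction with
  | ind l ih =>
    rw [LinearMap.injective_iff_surjective_of_finrank_eq_finrank (hr l)]
    intro η
    obtain ⟨X, hX⟩ := h (φ 0 + Pi.single l η)
    refine ⟨X l, ?_⟩
    have h0 := eq_of_triangular (X := X) (X' := 0) hφ ih fun i hi => by
      rw [hX, Pi.add_apply, Pi.single_eq_of_ne hi.ne, add_zero]
    have := hφ l X 0 h0
    rw [hX, Pi.add_apply, Pi.single_eq_same, add_sub_cancel_left, Pi.zero_apply, sub_zero] at this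
    exact this.symm

/-- A triangular map is bijective if and only if its diagonal blocks are injective. -/
theorem bijective_iff_of_triangular [∀ i, FiniteDimensional ℂ (U i)]
    [∀ i, FiniteDimensional ℂ (V i)]
    (hφ : ∀ l X X', (∀ i < l, X i = X' i) → φ X l - φ X' l = A l (X l - X' l))
    (hr : ∀ i, Module.finrank ℂ (U i) = Module.finrank ℂ (V i)) :
    Function.Bijective φ ↔ ∀ i, Function.Injective (A i) := by
  refine ⟨fun h => injective_of_triangular hφ hr h.2, fun h => ⟨fun X X' e => funext fun l => ?_,
    surjective_of_triangular hφ fun i =>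
      (LinearMap.injective_iff_surjective_of_finrank_eq_finrank (hr i)).mp (h i)⟩⟩
  have := hφ l X X' (eq_of_triangular hφ (fun i _ => h i) fun i _ => congrFun e i)
  rw [e, sub_self, eq_comm, map_eq_zero_iff _ (h l)] at this
  exact sub_eq_zero.mp this

end Triangular

/-! ### Partial fractions -/

section PartialFractions

variable {N : ℕ} (w : Fin N → ℂ)

/-- The finite singularities `0, w_1, …, w_N`. -/
def pole (o : Option (Fin N)) : ℂ := o.elim 0 w

/-- The span of the functions `z⁻¹` and `(z - w_j)⁻¹`. -/
def poleSpan : Submodule ℂ (RatFunc ℂ) :=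
  Submodule.span ℂ (Set.range fun o => (zSub (pole w o))⁻¹)

/-- The span of the products of `e` functions `z⁻¹`, `(z - w_j)⁻¹`. -/
def globFil (e : ℕ) : Submodule ℂ (RatFunc ℂ) := poleSpan w ^ e

theorem inv_zSub_mem_poleSpan (o : Option (Fin N)) : (zSub (pole w o))⁻¹ ∈ poleSpan w :=
  Submodule.subset_span ⟨o, rfl⟩

theorem inv_mem_poleSpan (j : Fin N) : (zSub (w j))⁻¹ ∈ poleSpan w :=
  inv_zSub_mem_poleSpan w (some j)

theorem inv_X_mem_poleSpan : (RatFunc.X)⁻¹ ∈ poleSpan w := by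
  rw [X_eq_zSub]
  exact inv_zSub_mem_poleSpan w none

theorem mulLE_globFil : MulLE (globFil w) (globFil w) (globFil w) := by
  intro a c hc a' c' hc'
  rw [globFil, pow_add]
  exact Submodule.mul_mem_mul hc hc'

theorem ratDeriv_mem_of_mem_poleSpan {c : RatFunc ℂ} (hc : c ∈ poleSpan w) :
    ratDeriv c ∈ globFil w 2 := by
  induction hc using Submodule.span_induction with
  | mem c hc =>
    obtain ⟨o, rfl⟩ := hc
    dsimp only
    rw [Derivation.leibniz_inv, ratDeriv_zSub, globFil, pow_two, smul_eq_mul, mul_one, pow_two,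
      neg_mem_iff]
    exact Submodule.mul_mem_mul (inv_zSub_mem_poleSpan w o) (inv_zSub_mem_poleSpan w o)
  | zero => rw [map_zero]; exact zero_mem _
  | add u v _ _ hu hv => rw [map_add]; exact add_mem hu hv
  | smul t u _ hu => rw [Derivation.map_smul]; exact Submodule.smul_mem _ _ hu

theorem derLE_globFil : DerLE ratDeriv (globFil w) (globFil w) := by
  intro a
  induction a with
  | zero =>
    intro c hc
    rw [globFil, pow_zero, Submodule.mem_one] at hc
    obtain ⟨t, rfl⟩ := hc
    rw [der_algebraMap]
    exact zero_mem _
  | succ a ih =>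
    intro c hc
    rw [globFil, pow_succ] at hc
    induction hc using Submodule.mul_induction_on' with
    | mem_mul_mem g hg k hk =>
      rw [der_mul]
      refine add_mem ?_ ?_
      · exact mulLE_globFil w a _ hg 2 _ (ratDeriv_mem_of_mem_poleSpan w hk)
      · have := mulLE_globFil w (a + 1) _ (ih _ hg) 1 k (by rwa [globFil, pow_one])
        rwa [mul_comm] at this
    | add g _ k _ hg hk => rw [map_add]; exact add_mem hg hk

/-- The functions which occur in the partial fraction expansions. -/
def simpleFrac (e : ℕ) : Submodule ℂ (RatFunc ℂ) :=
  Submodule.span ℂ {c | c = (RatFunc.X)⁻¹ ∨ ∃ j, ∃ k < e + 1, c = (zSub (w j))⁻¹ ^ (k + 1)}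

theorem inv_X_mem_simpleFrac (e : ℕ) : (RatFunc.X)⁻¹ ∈ simpleFrac w e :=
  Submodule.subset_span (Or.inl rfl)

theorem pow_mem_simpleFrac {e k : ℕ} (h : k < e + 1) (j : Fin N) :
    (zSub (w j))⁻¹ ^ (k + 1) ∈ simpleFrac w e :=
  Submodule.subset_span (Or.inr ⟨j, k, h, rfl⟩)

theorem simpleFrac_mono {e e' : ℕ} (h : e ≤ e') : simpleFrac w e ≤ simpleFrac w e' := by
  refine Submodule.span_mono ?_
  rintro c (hc | ⟨j, k, hk, hc⟩)
  · exact Or.inl hc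
  · exact Or.inr ⟨j, k, by omega, hc⟩

theorem inv_zSub_mul {u v : ℂ} (h : u ≠ v) : (zSub u)⁻¹ * (zSub v)⁻¹ =
    (u - v)⁻¹ • ((zSub u)⁻¹ - (zSub v)⁻¹) := by
  have h1 := zSub_ne_zero u
  have h2 := zSub_ne_zero v
  have h3 : algebraMap ℂ (RatFunc ℂ) (u - v) ≠ 0 :=
    (map_ne_zero _).mpr (sub_ne_zero.mpr h)
  have h4 : algebraMap ℂ (RatFunc ℂ) (u - v) = zSub v - zSub u := by
    rw [zSub, zSub, map_sub, sub_sub_sub_cancel_left]; rfl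
  rw [Algebra.smul_def, map_inv₀, h4]
  rw [h4] at h3
  field_simp

/-- Distinct poles are separated by `inv_zSub_mul`, and an equal pole raises the order by one. For a
pole of higher order at another point, each separation lowers the order by one. -/
theorem mul_inv_mem_simpleFrac (hw : Function.Injective w) (hw0 : ∀ j, w j ≠ 0) {e : ℕ}
    {c : RatFunc ℂ} (hc : c ∈ simpleFrac w e) (j : Fin N) :
    c * (zSub (w j))⁻¹ ∈ simpleFrac w (e + 1) := by
  unfold simpleFrac at hc
  induction hc using Submodule.span_induction with
  | mem c hc =>
    rcases hc with rfl | ⟨i, k, hk, rfl⟩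
    · rw [X_eq_zSub, inv_zSub_mul (hw0 j).symm]
      refine Submodule.smul_mem _ _ (sub_mem ?_ ?_)
      · rw [← X_eq_zSub]; exact inv_X_mem_simpleFrac w _
      · simpa using pow_mem_simpleFrac w (e := e + 1) (k := 0) (by omega) j
    · by_cases hij : i = j
      · subst hij
        rw [← pow_succ]
        exact pow_mem_simpleFrac w (by omega) i
      · induction k with
        | zero =>
          rw [zero_add, pow_one, inv_zSub_mul (hw.ne hij)]
          refine Submodule.smul_mem _ _ (sub_mem ?_ ?_)
          · simpa using pow_mem_simpleFrac w (e := e + 1) (k := 0) (by omega) i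
          · simpa using pow_mem_simpleFrac w (e := e + 1) (k := 0) (by omega) j
        | succ k ih =>
          rw [pow_succ, mul_assoc, inv_zSub_mul (hw.ne hij), mul_smul_comm, mul_sub, ← pow_succ]
          exact Submodule.smul_mem _ _ (sub_mem (pow_mem_simpleFrac w (by omega) i)
            (ih (by omega)))
  | zero => rw [zero_mul]; exact zero_mem _
  | add u v _ _ hu hv => rw [add_mul]; exact add_mem hu hv
  | smul t u _ hu => rw [smul_mul_assoc]; exact Submodule.smul_mem _ _ hu

theorem X_mul_inv_zSub (u : ℂ) : RatFunc.X * (zSub u)⁻¹ = 1 + u • (zSub u)⁻¹ := by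
  have h1 := zSub_ne_zero u
  have h : (RatFunc.X : RatFunc ℂ) = zSub u + algebraMap ℂ (RatFunc ℂ) u :=
    (sub_add_cancel _ _).symm
  rw [h, add_mul, mul_inv_cancel₀ h1, Algebra.smul_def]

/-- The partial fraction expansion of the coefficients of the canonical form. -/
theorem X_pow_mul_mem_simpleFrac (hw : Function.Injective w) (hw0 : ∀ j, w j ≠ 0) (e : ℕ) :
    ∀ c ∈ globFil w (e + 1), RatFunc.X ^ e * c ∈ simpleFrac w e := by
  induction e with
  | zero =>
    intro c hc
    rw [globFil, zero_add, pow_one] at hc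
    rw [pow_zero, one_mul]
    refine Submodule.span_le.mpr ?_ hc
    rintro _ ⟨_ | j, rfl⟩
    · have := inv_X_mem_simpleFrac w 0
      rwa [X_eq_zSub] at this
    · simpa [pole] using pow_mem_simpleFrac w (e := 0) (k := 0) (by omega) j
  | succ e ih =>
    intro c hc
    rw [globFil, pow_succ] at hc
    induction hc using Submodule.mul_induction_on' with
    | mem_mul_mem g hg k hk =>
      have hg' := ih g hg
      -- Each additional factor `z` is spent on one new pole: `z/(z - u) = 1 + u/(z - u)`. For `u =
      -- 0` the pole disappears, so the pole at the origin stays simple after multiplication by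
      -- `z^e`.
      rw [show RatFunc.X ^ (e + 1) * (g * k) = (RatFunc.X ^ e * g) * (RatFunc.X * k) by ring]
      unfold poleSpan at hk
      induction hk using Submodule.span_induction with
      | mem k hk =>
        obtain ⟨o, rfl⟩ := hk
        dsimp only
        rw [X_mul_inv_zSub, mul_add, mul_one, mul_smul_comm]
        refine add_mem (simpleFrac_mono w (Nat.le_succ e) hg') ?_
        rcases o with _ | j
        · rw [pole, Option.elim_none, zero_smul]; exact zero_mem _
        · exact Submodule.smul_mem _ _ (mul_inv_mem_simpleFrac w hw hw0 hg' j)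
      | zero => rw [mul_zero, mul_zero]; exact zero_mem _
      | add u v _ _ hu hv => rw [mul_add, mul_add]; exact add_mem hu hv
      | smul t u _ hu =>
        rw [mul_smul_comm, mul_smul_comm]; exact Submodule.smul_mem _ _ hu
    | add g _ k _ hg hk => rw [mul_add]; exact add_mem hg hk

/-- A product of `e` functions with at most simple poles has order at least `-e` at every point, so
one global solution has nonnegative weights at all places simultaneously. -/
theorem globFil_le_weightFil (u : ℂ) (e : ℕ) : globFil w e ≤ (ratPlace u).weightFil 0 e := by
  induction e with
  | zero =>
    intro c hc
    rw [globFil, pow_zero, Submodule.mem_one] at hc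
    obtain ⟨t, rfl⟩ := hc
    rw [Algebra.algebraMap_eq_smul_one]
    refine Submodule.smul_mem _ _ (Place.mem_ordGE.mpr fun m hm => ?_)
    rw [Place.co_one, if_neg (by simp at hm; omega)]
  | succ e ih =>
    intro c hc
    rw [globFil, pow_succ] at hc
    induction hc using Submodule.mul_induction_on' with
    | mem_mul_mem g hg k hk =>
      refine (ratPlace u).mulLE_weightFil 0 0 e g (ih hg) 1 k ?_
      refine Submodule.span_le.mpr ?_ hk
      rintro _ ⟨o, rfl⟩
      by_cases h : u = pole w o
      · dsimp only
        rw [← h]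
        exact Place.x_inv_mem (P := ratPlace u) (by simp)
      · exact Place.ordGE_anti (by simp) (inv_zSub_mem h)
    | add g _ k _ hg hk => exact add_mem hg hk

end PartialFractions

/-! ### The canonical form over `ℂ(z)` -/

section Global

variable {L : Type*} [LieRing L] [LieAlgebra ℂ L] {n : ℕ} {H : LieSubalgebra ℂ L}
  {b : LieAlgebra.Basis (Fin n) H} {s : Submodule ℂ L} {N : ℕ} (w : Fin N → ℂ)

/-- The coefficients of the canonical form of an operator over `ℂ(z)`. -/
abbrev GlobCoef (b : LieAlgebra.Basis (Fin n) H) (s : Submodule ℂ L) (N : ℕ) : Type _ :=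
  VDeg b s 0 × (Fin N → VDeg b s 0) × VN b s N

/-- The coefficients at the `j`-th singularity. -/
def GlobCoef.at (v : GlobCoef b s N) (j : Fin N) : VDeg b s 0 × VPos b s := (v.2.1 j, v.2.2 j)

/-- The coefficients of the expansion at the origin. -/
def originCoeff (l d : ℕ) : RatFunc ℂ := if l = 0 then (RatFunc.X ^ (d + 1))⁻¹ else 0

/-- The coefficients of the expansion at `u`. -/
def pointCoeff (u : ℂ) (l d : ℕ) : RatFunc ℂ := (RatFunc.X ^ d)⁻¹ * (zSub u ^ (d + 1 - l))⁻¹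

variable (b s) in
/-- The element of `𝔰(ℂ(z))` with given coefficients. -/
def globSum : GlobCoef b s N →ₗ[ℂ] RatFunc ℂ ⊗[ℂ] L where
  toFun v := famSum originCoeff (v.1, 0) + ∑ j, famSum (pointCoeff (w j)) (v.at j)
  map_add' v v' := by
    rw [add_add_add_comm, ← famSum_add, ← Finset.sum_add_distrib]
    simp only [← famSum_add]
    rw [show ((v.1, 0) + (v'.1, 0) : VDeg b s 0 × VPos b s) = ((v + v').1, 0) by simp]
    rfl
  map_smul' t v := by
    rw [RingHom.id_apply, smul_add, ← famSum_smul, Finset.smul_sum]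
    simp only [← famSum_smul]
    rw [show (t • (v.1, 0) : VDeg b s 0 × VPos b s) = ((t • v).1, 0) by simp]
    rfl

theorem globSum_apply (v : GlobCoef b s N) : globSum b s w v =
    famSum originCoeff (v.1, 0) + ∑ j, famSum (pointCoeff (w j)) (v.at j) := rfl

theorem vTerm_zero {K : Type*} [Field K] [Algebra ℂ K] {i : ℕ} (v : VDeg b s i) :
    vTerm b (fun _ => (0 : K)) v = 0 := by
  simp [vTerm]

theorem famSum_origin (u : VDeg b s 0) (v : VPos b s) : famSum originCoeff (u, v) =
    vTerm b (fun d => ((RatFunc.X : RatFunc ℂ) ^ (d + 1))⁻¹) u := by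
  have h : ∀ l : Finset.Icc 1 (coxeterNumber b - 1),
      originCoeff (l : ℕ) = fun _ => (0 : RatFunc ℂ) := fun l => by
    have := (Finset.mem_Icc.mp l.2).1
    funext d
    rw [originCoeff, if_neg (by omega)]
  simp only [famSum, h, vTerm_zero, Finset.sum_const_zero, add_zero]
  rfl

theorem globalS_eq (v : GlobCoef b s N) :
    globalS b w v = prinNilK b (RatFunc ℂ) + globSum b s w v := by
  rw [globSum_apply, famSum_origin, ← add_assoc]
  rfl

theorem tmul_mem_range_globSum (hw : Function.Injective w) (hw0 : ∀ j, w j ≠ 0) {d : ℕ}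
    {c : RatFunc ℂ} (hc : c ∈ globFil w (d + 1)) (hd : d < coxeterNumber b) {σ : L}
    (hσ : σ ∈ sGrade b s d) : c ⊗ₜ[ℂ] σ ∈ LinearMap.range (globSum b s w) := by
  classical
  have hX : (RatFunc.X : RatFunc ℂ) ≠ 0 := RatFunc.X_ne_zero
  have key : ∀ t ∈ simpleFrac w d,
      ((RatFunc.X ^ d)⁻¹ * t) ⊗ₜ[ℂ] σ ∈ LinearMap.range (globSum b s w) := by
    intro t ht
    unfold simpleFrac at ht
    induction ht using Submodule.span_induction with
    | mem t ht =>
      rcases ht with rfl | ⟨j, k, hk, rfl⟩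
      · obtain ⟨v, hv⟩ := tmul_mem_famSpace originCoeff (Nat.zero_le d) hd hσ
        refine ⟨(v.1, 0), ?_⟩
        rw [globSum_apply, famSum_origin, ← famSum_origin v.1 v.2, hv, originCoeff, if_pos rfl,
          pow_succ, mul_inv]
        have h0 : ∀ j, famSum (pointCoeff (w j)) (GlobCoef.at ((v.1, 0) : GlobCoef b s N) j) = 0 :=
          fun j => by
            have := famSum_sub (pointCoeff (w j)) (0 : VDeg b s 0 × VPos b s) 0
            rwa [sub_self, sub_self] at this
        simp only [h0, Finset.sum_const_zero, add_zero]
      -- The pole order is `k + 1 = d + 1 - l`, whence `l = d - k`.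
      · obtain ⟨v, hv⟩ := tmul_mem_famSpace (pointCoeff (w j)) (l := d - k) (by omega) hd hσ
        refine ⟨(0, Pi.single j v.1, Pi.single j v.2), ?_⟩
        rw [globSum_apply, Finset.sum_eq_single j]
        · rw [show GlobCoef.at ((0, Pi.single j v.1, Pi.single j v.2) : GlobCoef b s N) j = v by
            simp [GlobCoef.at], hv, pointCoeff, inv_pow, show d + 1 - (d - k) = k + 1 by omega]
          rw [famSum_origin]
          simp [vTerm]
        · intro i _ hi
          rw [show GlobCoef.at ((0, Pi.single j v.1, Pi.single j v.2) : GlobCoef b s N) i = 0 by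
            simp [GlobCoef.at, hi]]
          have := famSum_sub (pointCoeff (w i)) (0 : VDeg b s 0 × VPos b s) 0
          rwa [sub_self, sub_self] at this
        · simp
    | zero => rw [mul_zero, TensorProduct.zero_tmul]; exact zero_mem _
    | add u v _ _ hu hv => rw [mul_add, TensorProduct.add_tmul]; exact add_mem hu hv
    | smul t u _ hu =>
      rw [mul_smul_comm, ← TensorProduct.smul_tmul']; exact Submodule.smul_mem _ _ hu
  have := key _ (X_pow_mul_mem_simpleFrac w hw hw0 d c hc)
  rwa [inv_mul_cancel_left₀ (pow_ne_zero d hX)] at this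

theorem gspan_globFil_le [FiniteDimensional ℂ L] (hw : Function.Injective w)
    (hw0 : ∀ j, w j ≠ 0) :
    gspan (fun e => globFil w (e + 1)) (sGrade b s) ≤ LinearMap.range (globSum b s w) := by
  refine gspan_le fun e c hc σ hσ => ?_
  by_cases he : e < coxeterNumber b
  · exact tmul_mem_range_globSum w hw hw0 hc he hσ
  · have : σ ∈ grade b e := hσ.2
    rw [grade_eq_bot b (by omega), Submodule.mem_bot] at this
    rw [this, TensorProduct.tmul_zero]
    exact zero_mem _

theorem globalOne_eq (r : H) (X0 : Fin N → H) (X : UN b N) :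
    globalOne b w r X0 X = prinNilK b (RatFunc ℂ) + (RatFunc.X)⁻¹ ⊗ₜ[ℂ] (r : L) +
      ∑ j, ((zSub (w j))⁻¹ ⊗ₜ[ℂ] (X0 j : L) +
        ∑ i : Finset.Icc 1 (coxeterNumber b - 1),
          ((zSub (w j))⁻¹ * (RatFunc.X ^ (i : ℕ))⁻¹) ⊗ₜ[ℂ] (X j i : L)) := by
  simp only [globalOne, smul_add, Finset.smul_sum, TensorProduct.smul_tmul', smul_eq_mul, mul_one]

theorem globalOne_sub_mem (r : H) (X0 : Fin N → H) (X : UN b N) :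
    globalOne b w r X0 X - prinNilK b (RatFunc ℂ) ∈ operFil b (pos (globFil w)) := by
  rw [globalOne_eq, add_assoc, add_sub_cancel_left]
  have hpos : ∀ {e c}, c ∈ globFil w (e + 1) → c ∈ pos (globFil w) (e + 1) := fun {e c} hc =>
    mem_pos.mpr ⟨fun h => by omega, fun _ => hc⟩
  have h1 : ∀ {c}, c ∈ poleSpan w → c ∈ globFil w 1 := fun {c} hc => by rwa [globFil, pow_one]
  have hH : ∀ x : H, (x : L) ∈ wt b (((0 + 1 : ℕ) : ℂ) - 1) := fun x => by
    simpa using cartan_le_wt b x.2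
  refine add_mem (tmul_mem_gspan 1 (hpos (h1 (inv_X_mem_poleSpan w))) (hH r))
    (Submodule.sum_mem _ fun j _ => add_mem
      (tmul_mem_gspan 1 (hpos (h1 (inv_mem_poleSpan w j))) (hH _))
      (Submodule.sum_mem _ fun i _ => tmul_mem_gspan (i + 1) (hpos ?_) ?_))
  · rw [← inv_pow, mul_comm, globFil, pow_succ]
    exact Submodule.mul_mem_mul (Submodule.pow_mem_pow _ (inv_X_mem_poleSpan w) _)
      (inv_mem_poleSpan w j)
  · simpa [grade_eq_wt] using mem_wt_of_grade (X j i).2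

variable {Ψ : L →ₗ[ℂ] L}

theorem exists_global_solution [FiniteDimensional ℂ L] (hΨ : IsHomotopy b s Ψ)
    (hw : Function.Injective w) (hw0 : ∀ j, w j ≠ 0) (r : H) (X0 : Fin N → H) (X : UN b N) :
    ∃ y, ∃ v : GlobCoef b s N, Solution b s ratDeriv (globFil w) y (globalOne b w r X0 X)
      (globalS b w v) := by
  obtain ⟨y, T, hT, hmem⟩ := exists_solution hΨ (mulLE_globFil w) (derLE_globFil w)
    (globalOne_sub_mem w r X0 X)
  obtain ⟨v, hv⟩ := gspan_globFil_le w hw hw0 hmem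
  refine ⟨y, v, ?_⟩
  rw [globalS_eq, hv, add_sub_cancel]
  exact hT

/-! ### Reading the coefficients at a singularity -/

theorem co_originCoeff {u : ℂ} (hu : u ≠ 0) {m : ℤ} (hm : m < 0) (l d : ℕ) :
    (ratPlace u).co m (originCoeff l d) = 0 := by
  unfold originCoeff
  split_ifs
  · rw [X_eq_zSub]
    exact Place.mem_ordGE.mp (inv_zSub_pow_mem hu _) m hm
  · exact map_zero _

theorem co_pointCoeff_of_ne {u u' : ℂ} (hu : u ≠ 0) (h : u ≠ u') {m : ℤ} (hm : m < 0) (l d : ℕ) :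
    (ratPlace u).co m (pointCoeff u' l d) = 0 := by
  unfold pointCoeff
  rw [X_eq_zSub]
  exact Place.mem_ordGE.mp
    (Place.mul_mem_ordGE (inv_zSub_pow_mem hu d) (inv_zSub_pow_mem h (d + 1 - l))) m (by simpa)

theorem co_pointCoeff (u : ℂ) (m : ℤ) (l d : ℕ) :
    (ratPlace u).co m (pointCoeff u l d) =
      (ratPlace u).co (m + (d + 1 - l : ℕ)) (zSub 0 ^ d)⁻¹ := by
  unfold pointCoeff
  rw [X_eq_zSub, mul_comm, ← ratPlace_x u]
  exact Place.co_inv_mul _ _ _ _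

/-- At `w_j` the terms from the origin and the other points are regular. Terms with larger `l` have
poles of lower order, and those with smaller `l` vanish by assumption. Only the leading value
`w_j^{-d}` of the factor `z^{-d}` remains. -/
theorem extract_globSum (hw : Function.Injective w) (hw0 : ∀ j, w j ≠ 0) (j : Fin N) {d l : ℕ}
    (hl : l ≤ d) (hd : d < coxeterNumber b) {v : GlobCoef b s N}
    (hv : ∀ l' < l, coef (v.at j) d l' = 0) :
    extract b ((ratPlace (w j)).co ((l : ℤ) - (d + 1 : ℕ))) d (globSum b s w v) =
      (w j ^ d)⁻¹ • coef (v.at j) d l := by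
  have hm : (l : ℤ) - (d + 1 : ℕ) < 0 := by push_cast; omega
  rw [globSum_apply, map_add, map_sum, extract_famSum _ hd,
    Finset.sum_eq_zero fun l' _ => by rw [co_originCoeff (hw0 j) hm, zero_smul], zero_add,
    Finset.sum_eq_single j]
  · rw [extract_famSum _ hd, Finset.sum_eq_single l]
    · rw [co_pointCoeff, show (l : ℤ) - (d + 1 : ℕ) + (d + 1 - l : ℕ) = 0 by omega,
        co_zero_inv_zSub_pow (hw0 j), sub_zero]
    · intro l' hl' hne
      rcases lt_or_gt_of_ne hne with h | h
      · rw [hv l' h, smul_zero]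
      · rw [Finset.mem_range] at hl'
        rw [co_pointCoeff, Place.mem_ordGE.mp (inv_zSub_pow_mem (hw0 j) d) _ (by omega), zero_smul]
    · intro h
      exact absurd (Finset.mem_range.mpr (by omega)) h
  · intro i _ hi
    rw [extract_famSum _ hd]
    exact Finset.sum_eq_zero fun l' _ => by
      rw [co_pointCoeff_of_ne (hw0 j) (hw.ne hi.symm) hm, zero_smul]
  · simp

/-- The factor `z^{-d}` mixes each coefficient into those of larger `l` on expansion at `w_j`, so
the coefficients are eliminated successively from `l = 0` upwards. -/
theorem coef_eq_zero (hw : Function.Injective w) (hw0 : ∀ j, w j ≠ 0) (j : Fin N) {p : ℕ}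
    {v : GlobCoef b s N}
    (hv : globSum b s w v ∈ operFil b (pos ((ratPlace (w j)).weightFil p))) {d : ℕ}
    (hd : d < coxeterNumber b) : ∀ l < p, coef (v.at j) d l = 0 := by
  intro l
  induction l using Nat.strong_induction_on with
  | _ l ih =>
    intro hl
    by_cases hld : l ≤ d
    · have := extract_globSum w hw hw0 j hld hd fun l' hl' => ih l' hl' (hl'.trans hl)
      rw [extract_weightFil _ (by omega) hv, eq_comm, smul_eq_zero] at this
      exact this.resolve_left (inv_ne_zero (pow_ne_zero d (hw0 j)))
    · exact coef_of_lt (by omega)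

theorem globSum_injective (hw : Function.Injective w) (hw0 : ∀ j, w j ≠ 0) :
    Function.Injective (globSum b s w) := by
  rw [injective_iff_map_eq_zero]
  intro v hv
  have hz : ∀ d l, coef (0 : VDeg b s 0 × VPos b s) d l = 0 := fun d l => by
    simpa using coef_smul (0 : ℂ) (0 : VDeg b s 0 × VPos b s) d l
  have hat : ∀ j, v.at j = 0 := fun j => ext_coef fun d l hl hd => by
    rw [hz]
    -- The zero operator has every weight; `p = d + 1` is enough to reach all `l ≤ d`.
    exact coef_eq_zero w hw hw0 j (p := d + 1) (by rw [hv]; exact zero_mem _) hd l (by omega)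
  rw [globSum_apply] at hv
  have h0 : ∀ j, famSum (pointCoeff (w j)) (v.at j) = 0 := fun j => by
    rw [hat j]
    have := famSum_sub (pointCoeff (w j)) (0 : VDeg b s 0 × VPos b s) 0
    rwa [sub_self, sub_self] at this
  simp only [h0, Finset.sum_const_zero, add_zero] at hv
  have h1 : ((v.1, 0) : VDeg b s 0 × VPos b s) = 0 := ext_coef fun d l hl hd => by
    rw [hz]
    by_cases hl0 : l = 0
    -- With the data at the `w_j` gone, the remaining terms are pure powers of `z`, read off at the
    -- place `0`.
    · have := congrArg (extract b ((ratPlace 0).co (-(d + 1 : ℕ))) d) hv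
      rw [extract_famSum _ hd, Finset.sum_eq_single 0, map_zero, originCoeff, if_pos rfl,
        X_eq_zSub, ← ratPlace_x 0, Place.co_pow_inv, if_pos (by simp), one_smul] at this
      · rwa [hl0]
      · intro l' _ hl'
        rw [originCoeff, if_neg hl', map_zero, zero_smul]
      · simp
    · unfold coef VDeg.comp
      split_ifs <;> rfl
  have h2 : v.1 = 0 := congrArg Prod.fst h1
  refine Prod.ext h2 (Prod.ext (funext fun j => ?_) (funext fun j => ?_))
  · exact congrArg Prod.fst (hat j)
  · exact congrArg Prod.snd (hat j)

theorem existsUnique_global [FiniteDimensional ℂ L] (hΨ : IsHomotopy b s Ψ)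
    (hw : Function.Injective w) (hw0 : ∀ j, w j ≠ 0) (r : H) (X0 : Fin N → H) (X : UN b N) :
    ∃! v : GlobCoef b s N,
      IsCanonicalForm b s ratDeriv (globalOne b w r X0 X) (globalS b w v) := by
  obtain ⟨y, v, h⟩ := exists_global_solution w hΨ hw hw0 r X0 X
  refine ⟨v, h.isCanonicalForm, fun v' hv' => ?_⟩
  obtain ⟨y', h'⟩ := hv'.exists_solution
    (operFil_mono (pos_le_pos fun _ => le_top) (globalOne_sub_mem w r X0 X))
  have := h'.unique hΨ (h.mono fun _ => le_top)
  rw [globalS_eq, globalS_eq] at this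
  exact globSum_injective w hw hw0 (add_left_cancel this)

theorem miura_solution [FiniteDimensional ℂ L] (hΨ : IsHomotopy b s Ψ)
    (hw : Function.Injective w) (hw0 : ∀ j, w j ≠ 0) (r : H) (X0 : Fin N → H) (X : UN b N)
    (u : ℂ) : ∃ y, Solution b s ratDeriv ((ratPlace u).weightFil 0) y (globalOne b w r X0 X)
      (globalS b w (miuraFull b s w r X0 X)) := by
  obtain ⟨y, v, h⟩ := exists_global_solution w hΨ hw hw0 r X0 X
  have hspec : IsCanonicalForm b s ratDeriv (globalOne b w r X0 X)
      (globalS b w (miuraFull b s w r X0 X)) := Classical.epsilon_spec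
    (p := fun v => IsCanonicalForm b s ratDeriv (globalOne b w r X0 X) (globalS b w v))
    ⟨v, h.isCanonicalForm⟩
  rw [(existsUnique_global w hΨ hw hw0 r X0 X).unique hspec h.isCanonicalForm]
  exact ⟨y, h.mono (globFil_le_weightFil w u)⟩

/-! ### Comparison of the local and the global operators -/

theorem globalOne_sub_eq (r : H) (X0 : Fin N → H) (X X' : UN b N) :
    globalOne b w r X0 X - globalOne b w r X0 X' =
      ∑ j, ∑ i : Finset.Icc 1 (coxeterNumber b - 1),
        ((zSub (w j))⁻¹ * (RatFunc.X ^ (i : ℕ))⁻¹) ⊗ₜ[ℂ] ((X j i : L) - X' j i) := by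
  rw [globalOne_eq, globalOne_eq, add_sub_add_left_eq_sub, ← Finset.sum_sub_distrib]
  simp only [add_sub_add_left_eq_sub, ← Finset.sum_sub_distrib, TensorProduct.tmul_sub]

theorem inv_X_pow_mem {u : ℂ} (hu : u ≠ 0) (i : ℕ) :
    ((RatFunc.X : RatFunc ℂ) ^ i)⁻¹ ∈ (ratPlace u).ordGE 0 := by
  rw [X_eq_zSub]
  exact inv_zSub_pow_mem hu i

theorem inv_mul_inv_X_pow_mem {u : ℂ} (hu : u ≠ 0) (v : ℂ) (i : ℕ) :
    (zSub v)⁻¹ * (RatFunc.X ^ i)⁻¹ ∈ (ratPlace u).ordGE (-1) := by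
  have h : (zSub v)⁻¹ ∈ (ratPlace u).ordGE (-1) := by
    by_cases h : u = v
    · rw [← h, ← ratPlace_x]
      exact Place.x_inv_mem le_rfl
    · exact Place.ordGE_anti (by norm_num) (inv_zSub_mem h)
  exact Place.ordGE_anti (by norm_num) (Place.mul_mem_ordGE h (inv_X_pow_mem hu i))

theorem inv_mul_inv_X_pow_mem_of_ne {u v : ℂ} (hu : u ≠ 0) (huv : u ≠ v) (i : ℕ) :
    (zSub v)⁻¹ * (RatFunc.X ^ i)⁻¹ ∈ (ratPlace u).ordGE 0 :=
  Place.ordGE_anti (by norm_num) (Place.mul_mem_ordGE (inv_zSub_mem huv) (inv_X_pow_mem hu i))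

/-- Subtracting the value `u^{-i}` of `z^{-i}` at `u` cancels the simple pole. This is the source of
the factors `w_j^{-l}`. -/
theorem inv_mul_sub_mem {u : ℂ} (hu : u ≠ 0) (i : ℕ) :
    (zSub u)⁻¹ * (RatFunc.X ^ i)⁻¹ - (u ^ i)⁻¹ • (zSub u)⁻¹ ∈ (ratPlace u).ordGE 0 := by
  rw [Place.mem_ordGE]
  intro m hm
  have h1 := Place.co_inv_mul (ratPlace u) 1 m (RatFunc.X ^ i)⁻¹
  have h2 := Place.co_pow_inv (P := ratPlace u) 1 m
  rw [ratPlace_x, pow_one] at h1 h2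
  rw [map_sub, map_smul, h1, h2]
  by_cases hm1 : m = -1
  · subst hm1
    rw [X_eq_zSub, show (-1 : ℤ) + (1 : ℕ) = 0 by norm_num, co_zero_inv_zSub_pow hu, if_pos rfl]
    simp
  · rw [Place.mem_ordGE.mp (inv_X_pow_mem hu i) _ (by push_cast; omega),
      if_neg (by push_cast; omega), smul_zero, sub_zero]

theorem globalOne_sub_mem_weightFil {u : ℂ} (hu : u ≠ 0) {l : ℕ} (r : H) (X0 : Fin N → H)
    {X X' : UN b N}
    (h : ∀ i : Finset.Icc 1 (coxeterNumber b - 1), (i : ℕ) < l → ∀ j, X j i = X' j i) :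
    globalOne b w r X0 X - globalOne b w r X0 X' ∈
      operFil b (pos ((ratPlace u).weightFil l)) := by
  rw [globalOne_sub_eq]
  refine Submodule.sum_mem _ fun j _ => Submodule.sum_mem _ fun i _ => ?_
  by_cases hi : (i : ℕ) < l
  · rw [h i hi, sub_self, TensorProduct.tmul_zero]
    exact zero_mem _
  · exact tmul_mem_weightFil _
      (Place.ordGE_anti (by push_cast; omega) (inv_mul_inv_X_pow_mem hu (w j) i))
      (sub_mem (X j i).2 (X' j i).2)

/-- Both operators have the same polar part `X^0(j)/(z - w_j)` in degree `0`. The other terms of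
degree `0` are regular at `w_j`, and simple poles in positive degree already have weight at least
`1`. -/
theorem globalOne_sub_oneBessel_mem (hw : Function.Injective w) (hw0 : ∀ j, w j ≠ 0) (j : Fin N)
    (r : H) (X0 : Fin N → H) (X : UN b N) (Y : UPos b) :
    globalOne b w r X0 X - oneBessel b (ratPlace (w j)).x (X0 j) Y ∈
      operFil b (pos ((ratPlace (w j)).weightFil 1)) := by
  have hH : ∀ x : H, (x : L) ∈ grade b 0 := fun x => by
    rw [grade_eq_wt]
    simpa using cartan_le_wt b x.2
  have e : globalOne b w r X0 X - oneBessel b (ratPlace (w j)).x (X0 j) Y =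
      (RatFunc.X)⁻¹ ⊗ₜ[ℂ] (r : L) +
      ∑ i ∈ Finset.univ.erase j, (zSub (w i))⁻¹ ⊗ₜ[ℂ] (X0 i : L) +
      ∑ i, ∑ k : Finset.Icc 1 (coxeterNumber b - 1),
          ((zSub (w i))⁻¹ * (RatFunc.X ^ (k : ℕ))⁻¹) ⊗ₜ[ℂ] (X i k : L) -
      ∑ k : Finset.Icc 1 (coxeterNumber b - 1), (zSub (w j))⁻¹ ⊗ₜ[ℂ] (Y k : L) := by
    rw [globalOne_eq, oneBessel, Finset.sum_add_distrib, ←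
      Finset.add_sum_erase _ _ (Finset.mem_univ j),
      TensorProduct.tmul_add, TensorProduct.tmul_sum, ratPlace_x]
    abel
  rw [e]
  refine sub_mem (add_mem (add_mem (tmul_mem_weightFil _ ?_ (hH r))
    (Submodule.sum_mem _ fun i hi => tmul_mem_weightFil _ ?_ (hH _)))
    (Submodule.sum_mem _ fun i _ => Submodule.sum_mem _ fun k _ =>
      tmul_mem_weightFil _ ?_ (X i k).2))
    (Submodule.sum_mem _ fun k _ => tmul_mem_weightFil _ ?_ (Y k).2)
  · simpa using inv_X_pow_mem (hw0 j) 1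
  · exact Place.ordGE_anti (by norm_num) (inv_zSub_mem (hw.ne (Finset.ne_of_mem_erase hi).symm))
  · have := (Finset.mem_Icc.mp k.2).1
    exact Place.ordGE_anti (by push_cast; omega) (inv_mul_inv_X_pow_mem (hw0 j) (w i) k)
  · have := (Finset.mem_Icc.mp k.2).1
    rw [← ratPlace_x]
    exact Place.x_inv_mem (by push_cast; omega)

/-- Modulo weight `l + 1` only the residue at `w_j` in degree `l` survives. Changes at the other
points are regular in degrees at least `l`, and changes at `w_j` in higher degrees are simple poles.
-/
theorem globalOne_sub_sub_mem (hw : Function.Injective w) (hw0 : ∀ j, w j ≠ 0) (j : Fin N)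
    (r : H) (X0 : Fin N → H) (l : Finset.Icc 1 (coxeterNumber b - 1)) {X X' : UN b N}
    (h : ∀ i < l, ∀ j, X j i = X' j i) :
    globalOne b w r X0 X - globalOne b w r X0 X' -
      (oneBessel b (ratPlace (w j)).x (X0 j) (Pi.single l ((w j ^ (l : ℕ))⁻¹ • (X j l - X' j l))) -
        oneBessel b (ratPlace (w j)).x (X0 j) 0) ∈
      operFil b (pos ((ratPlace (w j)).weightFil (l + 1))) := by
  have e : oneBessel b (ratPlace (w j)).x (X0 j)
        (Pi.single l ((w j ^ (l : ℕ))⁻¹ • (X j l - X' j l))) -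
      oneBessel b (ratPlace (w j)).x (X0 j) 0 =
      ((w j ^ (l : ℕ))⁻¹ • (zSub (w j))⁻¹) ⊗ₜ[ℂ] ((X j l : L) - X' j l) := by
    rw [oneBessel_sub_eq, Finset.sum_eq_single l]
    · simp [TensorProduct.smul_tmul, ratPlace_x]
    · intro i _ hi
      simp [hi]
    · simp
  rw [e, globalOne_sub_eq, ← Finset.add_sum_erase _ _ (Finset.mem_univ j),
    ← Finset.add_sum_erase _ _ (Finset.mem_univ l), add_right_comm, add_sub_right_comm,
    add_sub_right_comm, ← TensorProduct.sub_tmul]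
  refine add_mem (add_mem (tmul_mem_weightFil _ (Place.ordGE_anti (by push_cast; omega)
    (inv_mul_sub_mem (hw0 j) l)) (sub_mem (X j l).2 (X' j l).2))
    (Submodule.sum_mem _ fun k hk => Submodule.sum_mem _ fun i _ => ?_))
    (Submodule.sum_mem _ fun i hi => ?_)
  · by_cases hi : i < l
    · rw [h i hi, sub_self, TensorProduct.tmul_zero]
      exact zero_mem _
    · have hi' : (l : ℕ) ≤ i := not_lt.mp hi
      exact tmul_mem_weightFil _ (Place.ordGE_anti (by push_cast; omega)
        (inv_mul_inv_X_pow_mem_of_ne (hw0 j) (hw.ne (Finset.ne_of_mem_erase hk).symm) i))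
        (sub_mem (X k i).2 (X' k i).2)
  · rcases lt_or_gt_of_ne (Finset.ne_of_mem_erase hi) with hil | hil
    · rw [h i hil, sub_self, TensorProduct.tmul_zero]
      exact zero_mem _
    · have hi' : (l : ℕ) < i := hil
      exact tmul_mem_weightFil _ (Place.ordGE_anti (by push_cast; omega)
        (inv_mul_inv_X_pow_mem (hw0 j) (w j) i)) (sub_mem (X j i).2 (X' j i).2)

/-- The scaling of the component of degree `d` by `u^d`. -/
def scaleDeg (u : ℂ) (i : ℕ) : VDeg b s i →ₗ[ℂ] VDeg b s i :=
  LinearMap.pi fun d => (u ^ (d : ℕ)) • LinearMap.proj d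

theorem scaleDeg_injective {u : ℂ} (hu : u ≠ 0) (i : ℕ) :
    Function.Injective (scaleDeg (b := b) (s := s) u i) := fun _ _ h => funext fun d =>
  smul_right_injective _ (pow_ne_zero (d : ℕ) hu) (congrFun h d)

/-- The components of the extended Miura map depend on the top arguments as those of the maps
`Φ^{X^0(j)}` do, up to scalings. -/
theorem miura_sub_eq [FiniteDimensional ℂ L] (hΨ : IsHomotopy b s Ψ)
    (hw : Function.Injective w) (hw0 : ∀ j, w j ≠ 0) (r : H) (X0 : Fin N → H)
    (l : Finset.Icc 1 (coxeterNumber b - 1)) {X X' : UN b N} (h : ∀ i < l, ∀ j, X j i = X' j i)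
    (j : Fin N) : miura b s w r X0 X j l - miura b s w r X0 X' j l =
      scaleDeg (w j) l (phiLin (ratPlace (w j)) hΨ (X0 j) l
        ((w j ^ (l : ℕ))⁻¹ • (X j l - X' j l))) := by
  set P := ratPlace (w j) with hP
  have hl1 := (Finset.mem_Icc.mp l.2).1
  set Y : UPos b := Pi.single l ((w j ^ (l : ℕ))⁻¹ • (X j l - X' j l)) with hY
  have hYlt : ∀ i < l, Y i = (0 : UPos b) i := fun i hi => Pi.single_eq_of_ne hi.ne _
  obtain ⟨y0, h0⟩ := miura_solution w hΨ hw hw0 r X0 X (w j)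
  obtain ⟨y1, h1⟩ := miura_solution w hΨ hw hw0 r X0 X' (w j)
  obtain ⟨y2, h2⟩ := phi_solution P hΨ (X0 j) Y
  obtain ⟨y3, h3⟩ := phi_solution P hΨ (X0 j) 0
  have h01 := globalOne_sub_mem_weightFil w (hw0 j) (l := l) r X0 fun i hi => h i hi
  -- The difference of the two global canonical forms has weight at least `l`, so its coefficients
  -- of lower index vanish, as needed for reading off the `l`-th ones by `extract_globSum`.
  have low := (h0.sub_mem hΨ (P.comparison_weightFil (Nat.zero_le l)) h1 h01).2
  have key := Solution.sub_smul_sub_mem hΨ (P.comparison_weightFil (Nat.zero_le 1))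
    (P.comparison_weightFil (Nat.zero_le l)) (P.comparison_weightFil (Nat.le_succ l))
    (P.mulLE_weightFil_succ l) (P.comparison_weightFil hl1).le
    (y := ![y0, y1, y2, y3])
    (A := ![globalOne b w r X0 X, globalOne b w r X0 X', oneBessel b P.x (X0 j) Y,
      oneBessel b P.x (X0 j) 0])
    (T := ![globalS b w (miuraFull b s w r X0 X), globalS b w (miuraFull b s w r X0 X'),
      sBessel b P.x (phiGen b s ratDeriv P.x (X0 j) Y),
      sBessel b P.x (phiGen b s ratDeriv P.x (X0 j) 0)])
    (by
      intro i
      fin_cases i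
      · exact h0
      · exact h1
      · exact h2
      · exact h3)
    h01
    (oneBessel_sub_mem_weightFil P (X0 j) fun i hi => hYlt i hi)
    (globalOne_sub_oneBessel_mem w hw hw0 j r X0 X Y) 1
    (by
      rw [one_smul]
      exact globalOne_sub_sub_mem w hw hw0 j r X0 l h)
  rw [one_smul] at key
  change globalS b w (miuraFull b s w r X0 X) - globalS b w (miuraFull b s w r X0 X') -
    (sBessel b P.x (phiGen b s ratDeriv P.x (X0 j) Y) -
      sBessel b P.x (phiGen b s ratDeriv P.x (X0 j) 0)) ∈ _ at key
  rw [globalS_eq, globalS_eq, add_sub_add_left_eq_sub, ← map_sub] at key low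
  rw [sBessel_eq, sBessel_eq, add_sub_add_left_eq_sub, ← famSum_sub] at key
  have hphi : phiLin P hΨ (X0 j) l ((w j ^ (l : ℕ))⁻¹ • (X j l - X' j l)) =
      phiAtGen b s ratDeriv P.x (X0 j) Y l - phiAtGen b s ratDeriv P.x (X0 j) 0 l := rfl
  rw [hphi]
  funext ⟨d, hd⟩
  have hd' := Finset.mem_Icc.mp hd
  have hdc : d < coxeterNumber b := by have := one_le_coxeterNumber (b := b); omega
  have e := extract_weightFil P (d := d) (m := (l : ℤ) - (d + 1 : ℕ)) (by push_cast; omega) key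
  rw [map_sub, extract_bessel P hd'.1 hdc, hP, extract_globSum w hw hw0 j hd'.1 hdc
    (coef_eq_zero w hw hw0 j low hdc), sub_eq_zero,
    inv_smul_eq_iff₀ (pow_ne_zero d (hw0 j)), coef_coe, coef_coe, VDeg.comp, VDeg.comp,
    dif_pos hd, dif_pos hd] at e
  exact Subtype.ext e

end Global

/-! ### Equivalence of the bijectivity conditions -/

section Bijectivity

variable {L : Type*} [LieRing L] [LieAlgebra ℂ L] {n : ℕ} {H : LieSubalgebra ℂ L}
  {b : LieAlgebra.Basis (Fin n) H} {s : Submodule ℂ L} {Ψ : L →ₗ[ℂ] L}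

theorem bijective_phiAt_iff [FiniteDimensional ℂ L] (hs : IsTransversal b s)
    (hΨ : IsHomotopy b s Ψ) (u : ℂ) (X0 : H) : Function.Bijective (PhiAt b s X0) ↔
      ∀ l, Function.Injective (phiLin (ratPlace u) hΨ X0 l) := by
  rw [← phiAtGen_ratPlace hΨ u]
  exact bijective_iff_of_triangular
    (fun l X X' h => phiAt_sub_eq_phiLin (ratPlace u) hΨ X0 l h)
    fun l => (finrank_VDeg hs l).symm

/-- The diagonal blocks of the extended Miura map. -/
def miuraLin [FiniteDimensional ℂ L] (hΨ : IsHomotopy b s Ψ) {N : ℕ} (w : Fin N → ℂ)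
    (X0 : Fin N → H) (l : Finset.Icc 1 (coxeterNumber b - 1)) :
    (Fin N → grade b l) →ₗ[ℂ] (Fin N → VDeg b s l) :=
  LinearMap.pi fun j => scaleDeg (w j) l ∘ₗ phiLin (ratPlace (w j)) hΨ (X0 j) l ∘ₗ
    ((w j ^ (l : ℕ))⁻¹ • LinearMap.proj j)

/-- The block is a product over `j`, and the scalings on either side of `phiLin` are harmless
because `w_j ≠ 0`. -/
theorem miuraLin_injective_iff [FiniteDimensional ℂ L] (hΨ : IsHomotopy b s Ψ) {N : ℕ}
    {w : Fin N → ℂ} (hw0 : ∀ j, w j ≠ 0) (X0 : Fin N → H)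
    (l : Finset.Icc 1 (coxeterNumber b - 1)) : Function.Injective (miuraLin hΨ w X0 l) ↔
      ∀ j, Function.Injective (phiLin (ratPlace (w j)) hΨ (X0 j) l) := by
  have e : ⇑(miuraLin hΨ w X0 l) = Pi.map fun j ξ => scaleDeg (w j) l
      (phiLin (ratPlace (w j)) hΨ (X0 j) l ((w j ^ (l : ℕ))⁻¹ • ξ)) := rfl
  rw [e, Pi.map_injective]
  refine forall_congr' fun j => ?_
  have hc := MulAction.bijective (α := ℂˣ) (β := grade b l)
    (Units.mk0 _ (inv_ne_zero (pow_ne_zero (l : ℕ) (hw0 j))))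
  exact ((scaleDeg_injective (hw0 j) l).of_comp_iff _).trans (Function.Injective.of_comp_iff' _ hc)

theorem bijective_miura_iff [FiniteDimensional ℂ L] (hs : IsTransversal b s) {N : ℕ}
    {w : Fin N → ℂ} (hw : Function.Injective w) (hw0 : ∀ j, w j ≠ 0) (r : H) (X0 : Fin N → H) :
    Function.Bijective (miura b s w r X0) ↔ ∀ j, Function.Bijective (PhiAt b s (X0 j)) := by
  obtain ⟨Ψ, hΨ⟩ := exists_isHomotopy hs
  -- The data are regrouped by degree first: triangularity holds for the degrees, with all points
  -- treated together.
  let φ : (∀ i : Finset.Icc 1 (coxeterNumber b - 1), Fin N → grade b i) →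
      ∀ i : Finset.Icc 1 (coxeterNumber b - 1), Fin N → VDeg b s i :=
    fun X i j => miura b s w r X0 (fun j i => X i j) j i
  have h1 : Function.Bijective (miura b s w r X0) ↔ Function.Bijective φ := by
    have e : φ = Equiv.piComm (fun (_ : Fin N) (i : Finset.Icc 1 (coxeterNumber b - 1)) =>
        VDeg b s i) ∘ miura b s w r X0 ∘
          Equiv.piComm (fun (i : Finset.Icc 1 (coxeterNumber b - 1)) (_ : Fin N) =>
            grade b i) := rfl
    rw [e, Equiv.comp_bijective, Equiv.bijective_comp]
  have h2 : Function.Bijective φ ↔ ∀ l, Function.Injective (miuraLin hΨ w X0 l) :=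
    bijective_iff_of_triangular (fun l X X' h => funext fun j =>
      miura_sub_eq w hΨ hw hw0 r X0 l (fun i hi j => congrFun (h i hi) j) j) fun l => by
        simp only [Module.finrank_pi_fintype, Finset.sum_const, ← finrank_VDeg hs]
  rw [h1, h2]
  simp only [miuraLin_injective_iff hΨ hw0]
  exact forall_comm.trans
    (forall_congr' fun j => (bijective_phiAt_iff hs hΨ (w j) (X0 j)).symm)

end Bijectivity

end Oper

end

theorem mainTheorem4 {L : Type*} [LieRing L] [LieAlgebra ℂ L] [FiniteDimensional ℂ L]
    [LieAlgebra.IsSimple ℂ L] {n : ℕ} {H : LieSubalgebra ℂ L}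
    (b : LieAlgebra.Basis (Fin n) H) (hA : b.A.IsSimplyLaced)
    (s : Submodule ℂ L) (hs : Oper.IsTransversal b s)
    {N : ℕ} (w : Fin N → ℂ) (hw : Function.Injective w) (hw0 : ∀ j, w j ≠ 0)
    (r : H) (X0 : Fin N → H) :
    (∀ (Y0 : H) (X : Oper.UPos b), ∃! v : Oper.VDeg b s 0 × Oper.VPos b s,
      Oper.IsCanonicalForm b s Oper.laurentDeriv
        (Oper.oneBessel b Oper.laurentX Y0 X) (Oper.sBessel b Oper.laurentX v)) ∧
    (∀ X : Oper.UN b N, ∃! v : Oper.VDeg b s 0 × (Fin N → Oper.VDeg b s 0) × Oper.VN b s N,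
      Oper.IsCanonicalForm b s Oper.ratDeriv
        (Oper.globalOne b w r X0 X) (Oper.globalS b w v)) ∧
    (Function.Bijective (Oper.miura b s w r X0) ↔
      ∀ j, Function.Bijective (Oper.PhiAt b s (X0 j))) := by
  obtain ⟨Ψ, hΨ⟩ := Oper.exists_isHomotopy hs
  exact ⟨fun Y0 X => Oper.existsUnique_bessel Oper.laurentPlace hΨ Y0 X,
    fun X => Oper.existsUnique_global w hΨ hw hw0 r X0 X,
    Oper.bijective_miura_iff hs hw hw0 r X0⟩
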